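/- **Setting.** Let $\mathbf x(t)\in\mathbb R^M$, $t\in\mathbb R$, be a (jointly measurable) zero-mean jointly wide-sense stationary process with finite variances and joint power spectral density $\mathbf C_{\mathbf x}(f)$ (integrable, nonnegative Hermitian a.e., $\mathbb E\{\mathbf x(t+\tau)\mathbf x^T(t)\}=\int \mathbf C_{\mathbf x}(f)e^{j2\pi f\tau}\,df$). Let $\mathbf s\in\mathbb R^N$ be a zero-mean random vector with finite variances whose MMSE estimate is linear, $\tilde{\mathbf s}=\mathbb E\{\mathbf s\mid \mathbf x(t),t\in\mathbb R\}=(\boldsymbol\Gamma*\mathbf x)(0)$, where $\boldsymbol\Gamma$ is a filter with real impulse response and frequency response $\boldsymbol\Gamma(f)$. Let $\mathbf y(t)=(\mathbf H*\mathbf x)(t)\in\mathbb R^K$ be the output of a given analog filter with real impulse response and frequency response $\mathbf H(f)$. Both convolutions are understood in mean square: the output is a mean-square limit of ordinary convolutions $\mathbf h_j*\mathbf x$ with real integrable $\mathbf h_j$ whose Fourier transforms $\mathbf A_j$ converge to the frequency response $\mathbf A$, i.e. $\int\mathrm{tr}\big((\mathbf A_j-\mathbf A)\mathbf C_{\mathbf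 x}(\mathbf A_j-\mathbf A)^H\big)df\to0$. Fix $f_s>0$, $T_s=1/f_s$, a number of bits $b$ and a dynamic range $\gamma>0$, and put $\Delta=2\gamma/2^b$, $\mathbf y[n]=T_s\mathbf y(nT_s)$. The ADC outputs are $\mathsf z_k[n]=q_b(\mathsf y_k[n]+\mathsf w_k[n])$, where $q_b(u)=\Delta(\lfloor u/\Delta\rfloor+\tfrac12)$ if $|u|<\gamma$ and $q_b(u)=\mathrm{sign}(u)(\gamma-\tfrac\Delta2)$ otherwise, and where the dither variables $\mathsf w_k[n]$ are i.i.d. over $n,k$ with the triangular density $\tfrac1\Delta(1-|w|/\Delta)$ on $|w|\le\Delta$ and jointly independent of the process $\mathbf x$; overload has probability zero, $\Pr\{|\mathsf y_k[n]+\mathsf w_k[n]|\ge\gamma\}=0$ for all $n,k$. A linear digital recovery filter is a sequence $\mathbf G[n]\in\mathbb R^{N\times K}$, $n\in\mathbb Z$, with task estimate $\hat{\mathbf s}=\sum_{n}\mathbf G[-n]\mathbf z[n]$, understood in mean square ($\hat{\mathbf s}$ is a mean-square limit of the outputs of filters with finitely many taps that tend to $\mathbf G$ tap by tap). **Proposition.**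 Put $$\mathbf S(f)=\sum_{k\in\mathbb Z}\boldsymbol\Gamma(f-kf_s)\mathbf C_{\mathbf x}(f-kf_s)\mathbf H^H(f-kf_s),\qquad \mathbf C_{\mathbf z}(e^{j2\pi fT_s})=T_s\sum_{k\in\mathbb Z}\mathbf H(f-kf_s)\mathbf C_{\mathbf x}(f-kf_s)\mathbf H^H(f-kf_s)+\frac{\Delta^2}{4}\mathbf I_K .$$ These series converge and $\mathbf C_{\mathbf z}$ is invertible for almost every $f$, and the integrals below converge. Among all linear digital recovery filters, the mean squared error $\mathbb E\|\tilde{\mathbf s}-\hat{\mathbf s}\|^2$ has exactly one minimizer, namely $$\mathbf G^{\mathrm o}[n]=T_s\int_{-f_s/2}^{f_s/2}\mathbf S(f)\,\mathbf C_{\mathbf z}^{-1}(e^{j2\pi fT_s})\,e^{j2\pi fnT_s}\,df ,\qquad n\in\mathbb Z,$$ which is real, and the resulting minimum is $$\mathbb E\|\tilde{\mathbf s}\|^2-\mathrm{tr}\Big(T_s\int_{-f_s/2}^{f_s/2}\mathbf S(f)\,\mathbf C_{\mathbf z}^{-1}(e^{j2\pi fT_s})\,\mathbf S^H(f)\,df\Big).$$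 If, moreover, the dither is independent of the pair $(\mathbf s,\mathbf x)$, then $\mathbf G^{\mathrm o}$ is also the unique minimizer of $\mathbb E\|\mathbf s-\hat{\mathbf s}\|^2$, and for its estimate $\mathbb E\|\mathbf s-\hat{\mathbf s}\|^2=\mathbb E\|\mathbf s-\tilde{\mathbf s}\|^2+\mathbb E\|\tilde{\mathbf s}-\hat{\mathbf s}\|^2$. -/

import Mathlib

open MeasureTheory ProbabilityTheory Filter Topology
open scoped Matrix FourierTransform ENNReal ComplexOrder

namespace TaskADC

noncomputable section

/-! ### Signal model -/

/-- `x` is a (jointly measurable) real `M`-variate continuous-time process which is zero-mean,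
jointly wide-sense stationary and has finite variances. -/
structure IsZeroMeanWSS {Ω : Type*} [MeasurableSpace Ω] (P : Measure Ω) {M : ℕ}
    (x : ℝ → Ω → Fin M → ℝ) : Prop where
  measurable : Measurable (fun p : ℝ × Ω => x p.1 p.2)
  memLp : ∀ t m, MemLp (fun ω => x t ω m) 2 P
  mean_zero : ∀ t m, ∫ ω, x t ω m ∂P = 0
  stationary : ∀ t τ i j,
    ∫ ω, x (t + τ) ω i * x t ω j ∂P = ∫ ω, x τ ω i * x 0 ω j ∂P

/-- `C` is the joint power spectral density of the stationary process `x`: the integrable density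
of its (nonnegative Hermitian matrix valued) spectral measure, so that the autocorrelation matrix
function `τ ↦ E[x(τ) x(0)ᵀ]` is the inverse Fourier transform of `C`. -/
structure IsJointPSD {Ω : Type*} [MeasurableSpace Ω] (P : Measure Ω) {M : ℕ}
    (x : ℝ → Ω → Fin M → ℝ) (C : ℝ → Matrix (Fin M) (Fin M) ℂ) : Prop where
  integrable : ∀ i j, Integrable (fun f => C f i j)
  posSemidef : ∀ᵐ f : ℝ, (C f).PosSemidef
  autocorrelation : ∀ (τ : ℝ) (i j : Fin M),
    ((∫ ω, x τ ω i * x 0 ω j ∂P : ℝ) : ℂ) =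
      ∫ f : ℝ, C f i j * Complex.exp (2 * Real.pi * Complex.I * f * τ)

/-- Frequency response of a multivariate filter with real impulse response `h`: the entrywise
Fourier transform. -/
def freqResponse {L M : ℕ} (h : ℝ → Matrix (Fin L) (Fin M) ℝ) (f : ℝ) :
    Matrix (Fin L) (Fin M) ℂ :=
  Matrix.of fun l m => 𝓕 (fun t : ℝ => ((h t l m : ℝ) : ℂ)) f

/-- The convolution `(h * x)(t)`, that is `∑ₘ ∫ h_{l,m}(τ) xₘ(t - τ) dτ`, path by path. -/
def convolve {Ω : Type*} {L M : ℕ} (h : ℝ → Matrix (Fin L) (Fin M) ℝ)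
    (x : ℝ → Ω → Fin M → ℝ) (t : ℝ) (ω : Ω) (l : Fin L) : ℝ :=
  ∑ m, ∫ τ, h τ l m * x (t - τ) ω m

/-- `Y` is the value at time `t` of the output of the linear time-invariant filter with frequency
response `H` driven by the stationary process `x` with joint PSD `C`.

The convolution with the inverse Fourier transform of `H` is understood in mean square: `Y` is the
mean-square limit of the convolutions of `x` with real integrable impulse responses whose frequency
responses tend to `H` in the mean-square distance
`∫ tr((A - H) C (A - H)ᴴ) df` that `C` induces. If `H` is itself the Fourier transform of
a real integrable `h`, one can take the constant sequence `h`; filters such as the identity or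
an ideal low-pass filter, whose impulse responses are not integrable functions, are included. -/
def IsFilterOutputAt {Ω : Type*} [MeasurableSpace Ω] (P : Measure Ω) {L M : ℕ}
    (x : ℝ → Ω → Fin M → ℝ) (C : ℝ → Matrix (Fin M) (Fin M) ℂ)
    (H : ℝ → Matrix (Fin L) (Fin M) ℂ) (t : ℝ) (Y : Ω → Fin L → ℝ) : Prop :=
  (∀ l, MemLp (fun ω => Y ω l) 2 P) ∧
  ∃ h : ℕ → ℝ → Matrix (Fin L) (Fin M) ℝ,
    (∀ j l m, Integrable (fun τ => h j τ l m)) ∧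
    Tendsto (fun j => ∫⁻ f : ℝ,
      ‖((freqResponse (h j) f - H f) * C f * (freqResponse (h j) f - H f)ᴴ).trace‖ₑ)
      atTop (𝓝 0) ∧
    ∀ l, Tendsto (fun j => eLpNorm (fun ω => convolve (h j) x t ω l - Y ω l) 2 P) atTop (𝓝 0)

/-- The task: a zero-mean random vector `s` with finite variances whose MMSE estimate
`E[s | x(t), t ∈ ℝ]` is `sT`, and this estimate is linear, `sT = (Γ * x)(0)`, for the filter with
frequency response `Γ`. -/
structure IsLinearTask {Ω : Type*} [MeasurableSpace Ω] (P : Measure Ω) {M N : ℕ}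
    (x : ℝ → Ω → Fin M → ℝ) (C : ℝ → Matrix (Fin M) (Fin M) ℂ)
    (s : Ω → Fin N → ℝ) (Γ : ℝ → Matrix (Fin N) (Fin M) ℂ) (sT : Ω → Fin N → ℝ) : Prop where
  measurable : Measurable s
  memLp : ∀ i, MemLp (fun ω => s ω i) 2 P
  mean_zero : ∀ i, ∫ ω, s ω i ∂P = 0
  mmse : ∀ i, (fun ω => sT ω i) =ᵐ[P]
    P[fun ω => s ω i | MeasurableSpace.comap (fun ω t => x t ω) MeasurableSpace.pi]
  linear : IsFilterOutputAt P x C Γ 0 sT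

/-! ### Sampling and dithered quantization -/

/-- Quantization step size `Δ = 2 γ / 2 ^ b` of a `b`-bit quantizer with dynamic range `γ`. -/
def stepSize (γ : ℝ) (b : ℕ) : ℝ := 2 * γ / 2 ^ b

open Classical in
/-- The uniform mid-rise quantizer with `b` bits and dynamic range `γ`. -/
def midRise (γ : ℝ) (b : ℕ) (u : ℝ) : ℝ :=
  if |u| < γ then stepSize γ b * ((⌊u / stepSize γ b⌋ : ℝ) + 1 / 2)
  else Real.sign u * (γ - stepSize γ b / 2)

open Classical in
/-- The triangular probability density of width `2 Δ`. -/
def ditherPDF (Δ : ℝ) (u : ℝ) : ℝ :=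
  if |u| ≤ Δ then 1 / Δ * (1 - |u| / Δ) else 0

/-- `w` is the dither: independent and identically distributed in time and space, with the
triangular density of width `2 Δ`, and independent of the input process `x`. -/
structure IsDither {Ω : Type*} [MeasurableSpace Ω] (P : Measure Ω) {M K : ℕ} (Δ : ℝ)
    (x : ℝ → Ω → Fin M → ℝ) (w : ℤ → Ω → Fin K → ℝ) : Prop where
  measurable : ∀ n k, Measurable (fun ω => w n ω k)
  law : ∀ n k, P.map (fun ω => w n ω k) =
    volume.withDensity (fun u => ENNReal.ofReal (ditherPDF Δ u))
  indep : iIndepFun (fun (p : ℤ × Fin K) ω => w p.1 ω p.2) P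
  indep_input : IndepFun (fun ω n => w n ω) (fun ω t => x t ω) P

/-- The samples `y[n] = Tₛ y(n Tₛ)` with `Tₛ = 1 / fₛ`. -/
def sample {Ω : Type*} {K : ℕ} (fs : ℝ) (y : ℝ → Ω → Fin K → ℝ) (n : ℤ) (ω : Ω) (k : Fin K) : ℝ :=
  1 / fs * y (n * (1 / fs)) ω k

/-- The quantizer outputs `z[n] = q_b(y[n] + w[n])`, entry by entry. -/
def adcOutput {Ω : Type*} {K : ℕ} (fs γ : ℝ) (b : ℕ) (y : ℝ → Ω → Fin K → ℝ)
    (w : ℤ → Ω → Fin K → ℝ) (n : ℤ) (ω : Ω) (k : Fin K) : ℝ :=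
  midRise γ b (sample fs y n ω k + w n ω k)

/-- The quantizers operate within their dynamic range: zero overload probability. -/
def NoOverload {Ω : Type*} [MeasurableSpace Ω] (P : Measure Ω) {K : ℕ} (fs γ : ℝ)
    (y : ℝ → Ω → Fin K → ℝ) (w : ℤ → Ω → Fin K → ℝ) : Prop :=
  ∀ n k, P {ω | γ ≤ |sample fs y n ω k + w n ω k|} = 0

/-! ### Linear digital recovery -/

/-- Output at time `0` of a filter `G` with finitely many taps:
`(G * z)[0] = ∑ₙ G[n] z[-n]`. -/
def firOutput {Ω : Type*} {N K : ℕ} (G : ℤ →₀ Matrix (Fin N) (Fin K) ℝ)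
    (z : ℤ → Ω → Fin K → ℝ) (ω : Ω) : Fin N → ℝ :=
  G.sum fun n A => A *ᵥ z (-n) ω

/-- `sHat = ∑ₙ G[-n] z[n] = (G * z)[0]` in mean square: `sHat` is the mean-square limit of
the outputs of filters with finitely many taps that tend to `G` tap by tap. Whenever the
series converges in mean square, its finite partial sums are such a sequence. -/
def IsDigitalOutput {Ω : Type*} [MeasurableSpace Ω] (P : Measure Ω) {N K : ℕ}
    (z : ℤ → Ω → Fin K → ℝ) (G : ℤ → Matrix (Fin N) (Fin K) ℝ) (sHat : Ω → Fin N → ℝ) : Prop :=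
  (∀ i, MemLp (fun ω => sHat ω i) 2 P) ∧
  ∃ Gj : ℕ → (ℤ →₀ Matrix (Fin N) (Fin K) ℝ),
    (∀ n, Tendsto (fun j => Gj j n) atTop (𝓝 (G n))) ∧
    ∀ i, Tendsto (fun j => eLpNorm (fun ω => firOutput (Gj j) z ω i - sHat ω i) 2 P)
      atTop (𝓝 0)

/-- `E ‖u‖²` with the Euclidean norm. -/
def meanSq {Ω : Type*} [MeasurableSpace Ω] (P : Measure Ω) {N : ℕ} (u : Ω → Fin N → ℝ) : ℝ :=
  ∫ ω, ∑ i, (u ω i) ^ 2 ∂P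

/-- `G` is an MSE-minimizing linear digital filter for recovering `u` from the sequence `z`. -/
def IsMSEOptimal {Ω : Type*} [MeasurableSpace Ω] (P : Measure Ω) {N K : ℕ}
    (z : ℤ → Ω → Fin K → ℝ) (u : Ω → Fin N → ℝ) (G : ℤ → Matrix (Fin N) (Fin K) ℝ) : Prop :=
  ∃ v : Ω → Fin N → ℝ, IsDigitalOutput P z G v ∧
    ∀ (G' : ℤ → Matrix (Fin N) (Fin K) ℝ) (v' : Ω → Fin N → ℝ), IsDigitalOutput P z G' v' →
      meanSq P (fun ω => u ω - v ω) ≤ meanSq P (fun ω => u ω - v' ω)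

/-! ### The closed forms -/

/-- The `k`-th alias `A(f - k fₛ) C(f - k fₛ) Bᴴ(f - k fₛ)` of a cross-spectrum. -/
def aliasTerm {L L' M : ℕ} (fs : ℝ) (A : ℝ → Matrix (Fin L) (Fin M) ℂ)
    (C : ℝ → Matrix (Fin M) (Fin M) ℂ) (B : ℝ → Matrix (Fin L') (Fin M) ℂ) (f : ℝ) (k : ℤ) :
    Matrix (Fin L) (Fin L') ℂ :=
  A (f - k * fs) * C (f - k * fs) * (B (f - k * fs))ᴴ

/-- The aliased cross-spectrum `S(f) = ∑ₖ Γ(f - k fₛ) C(f - k fₛ) Hᴴ(f - k fₛ)`. -/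
def crossSpectrum {N K M : ℕ} (fs : ℝ) (Γ : ℝ → Matrix (Fin N) (Fin M) ℂ)
    (C : ℝ → Matrix (Fin M) (Fin M) ℂ) (H : ℝ → Matrix (Fin K) (Fin M) ℂ) (f : ℝ) :
    Matrix (Fin N) (Fin K) ℂ :=
  ∑' k : ℤ, aliasTerm fs Γ C H f k

/-- `C_z(e^{j 2 π f Tₛ}) = Tₛ ∑ₖ H(f - k fₛ) C(f - k fₛ) Hᴴ(f - k fₛ) + Δ² / 4 I`. -/
def outputSpectrum {K M : ℕ} (fs Δ : ℝ) (C : ℝ → Matrix (Fin M) (Fin M) ℂ)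
    (H : ℝ → Matrix (Fin K) (Fin M) ℂ) (f : ℝ) : Matrix (Fin K) (Fin K) ℂ :=
  ((1 / fs : ℝ) : ℂ) • (∑' k : ℤ, aliasTerm fs H C H f k) +
    ((Δ ^ 2 / 4 : ℝ) : ℂ) • (1 : Matrix (Fin K) (Fin K) ℂ)

/-- Entrywise integral `∫ F(f) df` over `[-fₛ/2, fₛ/2]`. -/
def bandIntegral {L L' : ℕ} (fs : ℝ) (F : ℝ → Matrix (Fin L) (Fin L') ℂ) :
    Matrix (Fin L) (Fin L') ℂ :=
  Matrix.of fun i j => ∫ f in (-(fs / 2))..(fs / 2), F f i j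

/-- Convergence of `bandIntegral fs F`. -/
def BandIntegrable {L L' : ℕ} (fs : ℝ) (F : ℝ → Matrix (Fin L) (Fin L') ℂ) : Prop :=
  ∀ i j, IntervalIntegrable (fun f => F f i j) volume (-(fs / 2)) (fs / 2)

end

end TaskADC

open TaskADC

/-! The problem is a projection in `L²(P)`, solved by moving it to a weighted `L²` space on the band
`(-fₛ/2, fₛ/2]`.

Correlations of filtered versions of `x` are integrals against `C`. This holds for integrable
impulse responses by Fubini (`integral_convTerm_mul_eq_spectral`) and passes to mean-square limits
(`IsSpectralLimit.integral_mul_eq_inner`). Sampling folds such integrals over the line into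
integrals over the band of the aliased sums (`integral_bandChar_mul_tsum_aliasTerm`).

For a fixed input, the triangular dither gives the quantization error mean `0` and second moment
`Δ²/4`, whatever the input is. Hence the errors are uncorrelated with functions of `x` and with each
other (`IsDither.integral_quantized_mul_quantized`), and quantization only adds `Δ²/4` times the
identity to the spectrum of the samples. So `E[z_k[n] z_l[m]]` is the inner product of the
exponentials `e^{j2πfnTₛ} e_k` and `e^{j2πfmTₛ} e_l` in the space of row functions `g` with `∫ g C_z
gᴴ < ∞`: finite combinations of samples are mapped isometrically to trigonometric polynomials.

Since `C_z ≥ Δ²/4`, this space is complete (`IsCoercive.completeSpace`) and embeds in the unweighted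
`L²`, so Fourier coefficients are continuous functionals that jointly determine an element up to
norm zero. Therefore a filter and its mean-square output determine each other
(`IsTapLimit.taps_unique`, `IsTapLimit.limit_unique`), and every element of the closed span of the
samples is the output of a real filter (`exists_isTapLimit`).

The outputs are thus exactly the points of that closed span, and the unique optimal one is the
orthogonal projection of `s̃`. Its representative `g` has the correlations with the exponentials
that `s̃` has with the samples, namely the Fourier coefficients of `S`. By uniqueness of Fourier
coefficients `g C_z = S` almost everywhere, so `g = S C_z⁻¹`; the taps are its Fourier coefficients,
and Pythagoras gives the minimum. If the dither is independent of `(s, x)`, then `s - s̃` is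
orthogonal to all samples, so `s` and `s̃` have the same projection. -/

noncomputable section

/-! ### Sesquilinear forms of positive semidefinite matrices -/

/-- The sesquilinear form `a A bᴴ` of row vectors. -/
def hermForm {ι : Type*} [Fintype ι] (A : Matrix ι ι ℂ) (a b : ι → ℂ) : ℂ :=
  ∑ i, ∑ j, a i * A i j * star (b j)

section HermForm

variable {ι : Type*} [Fintype ι] (A : Matrix ι ι ℂ)

lemma hermForm_add_left (a a' b : ι → ℂ) :
    hermForm A (a + a') b = hermForm A a b + hermForm A a' b := by
  simp only [hermForm, Pi.add_apply, add_mul, Finset.sum_add_distrib]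

lemma hermForm_add_right (a b b' : ι → ℂ) :
    hermForm A a (b + b') = hermForm A a b + hermForm A a b' := by
  simp only [hermForm, Pi.add_apply, star_add, mul_add, Finset.sum_add_distrib]

lemma hermForm_smul_left (c : ℂ) (a b : ι → ℂ) :
    hermForm A (c • a) b = c * hermForm A a b := by
  simp only [hermForm, Pi.smul_apply, smul_eq_mul, Finset.mul_sum, mul_assoc]

lemma hermForm_smul_right (c : ℂ) (a b : ι → ℂ) :
    hermForm A a (c • b) = star c * hermForm A a b := by
  simp only [hermForm, Pi.smul_apply, smul_eq_mul, Finset.mul_sum, star_mul']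
  refine Finset.sum_congr rfl fun i _ => Finset.sum_congr rfl fun j _ => by ring

lemma hermForm_neg_left (a b : ι → ℂ) : hermForm A (-a) b = -hermForm A a b := by
  simpa using hermForm_smul_left A (-1) a b

lemma hermForm_neg_right (a b : ι → ℂ) : hermForm A a (-b) = -hermForm A a b := by
  simpa using hermForm_smul_right A (-1) a b

lemma hermForm_sub_left (a a' b : ι → ℂ) :
    hermForm A (a - a') b = hermForm A a b - hermForm A a' b := by
  rw [sub_eq_add_neg, hermForm_add_left, hermForm_neg_left, sub_eq_add_neg]

lemma hermForm_sub_right (a b b' : ι → ℂ) :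
    hermForm A a (b - b') = hermForm A a b - hermForm A a b' := by
  rw [sub_eq_add_neg, hermForm_add_right, hermForm_neg_right, sub_eq_add_neg]

lemma mul_mul_conjTranspose_apply {L L' : Type*} (B : Matrix L ι ℂ) (B' : Matrix L' ι ℂ)
    (l : L) (l' : L') : (B * A * B'ᴴ) l l' = hermForm A (B l) (B' l') := by
  simp only [hermForm, Matrix.mul_apply, Matrix.conjTranspose_apply, Finset.sum_mul]
  rw [Finset.sum_comm]

variable {A}

lemma Matrix.IsHermitian.star_hermForm (hA : A.IsHermitian) (a b : ι → ℂ) :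
    star (hermForm A a b) = hermForm A b a := by
  simp only [hermForm, star_sum, star_mul', star_star]
  rw [Finset.sum_comm]
  refine Finset.sum_congr rfl fun i _ => Finset.sum_congr rfl fun j _ => ?_
  rw [hA.apply]; ring

lemma Matrix.PosSemidef.hermForm_self_nonneg (hA : A.PosSemidef) (a : ι → ℂ) :
    0 ≤ hermForm A a a := by
  have h := hA.dotProduct_mulVec_nonneg (star a)
  convert h using 1
  simp only [hermForm, dotProduct, Matrix.mulVec, star_star, Finset.mul_sum, Pi.star_apply,
    mul_assoc]

lemma Matrix.PosSemidef.hermForm_self_re_nonneg (hA : A.PosSemidef) (a : ι → ℂ) :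
    0 ≤ (hermForm A a a).re := (Complex.nonneg_iff.1 (hA.hermForm_self_nonneg a)).1

lemma Matrix.PosSemidef.ofReal_re_hermForm (hA : A.PosSemidef) (a : ι → ℂ) :
    ((hermForm A a a).re : ℂ) = hermForm A a a :=
  Complex.ext (by simp) (by simpa using (Complex.nonneg_iff.1 (hA.hermForm_self_nonneg a)).2)

lemma Matrix.PosSemidef.norm_hermForm_self (hA : A.PosSemidef) (a : ι → ℂ) :
    ‖hermForm A a a‖ = (hermForm A a a).re := by
  rw [← hA.ofReal_re_hermForm, Complex.norm_real, Real.norm_of_nonneg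
    (hA.hermForm_self_re_nonneg a), Complex.ofReal_re]

/-- Rotating `b` by the phase `c` of the cross term makes that term real; the bound is then
nonnegativity of the form at `a - c • b`. This weak form of Cauchy–Schwarz suffices to dominate
cross terms by integrable diagonal ones. -/
lemma Matrix.PosSemidef.two_mul_norm_hermForm_le (hA : A.PosSemidef) (a b : ι → ℂ) :
    2 * ‖hermForm A a b‖ ≤ (hermForm A a a).re + (hermForm A b b).re := by
  by_cases h0 : hermForm A a b = 0
  · rw [h0]; simpa using add_nonneg (hA.hermForm_self_re_nonneg a) (hA.hermForm_self_re_nonneg b)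
  set h := hermForm A a b with hh
  have hn : (‖h‖ : ℂ) ≠ 0 := by simpa using h0
  set c : ℂ := h / ‖h‖ with hc
  have hcc : star c * c = 1 := by
    rw [hc, star_div₀, div_mul_div_comm, Complex.star_def, Complex.conj_ofReal,
      Complex.conj_mul', ← pow_two, div_self (pow_ne_zero 2 hn)]
  have hch : star c * h = ‖h‖ := by
    rw [hc, star_div₀, div_mul_eq_mul_div, Complex.star_def, Complex.conj_ofReal,
      Complex.conj_mul', pow_two, mul_div_assoc, div_self hn, mul_one]
  have hch' : c * hermForm A b a = ‖h‖ := by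
    rw [← hA.1.star_hermForm, ← hh, ← star_star c, ← star_mul', hch]; simp
  have key : hermForm A (a - c • b) (a - c • b)
      = hermForm A a a + hermForm A b b - ‖h‖ - ‖h‖ := by
    rw [hermForm_sub_left, hermForm_sub_right, hermForm_sub_right, hermForm_smul_left,
      hermForm_smul_left, hermForm_smul_right, hermForm_smul_right, ← hh, hch, hch', ← mul_assoc,
      mul_comm c, hcc]
    ring
  have := hA.hermForm_self_re_nonneg (a - c • b)
  rw [key] at this
  simp at this
  linarith

end HermForm

/-! ### The pre-Hilbert space with a matrix weight -/

section Weight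

variable {α : Type*} [MeasurableSpace α]

/-- A measurable family of positive semidefinite matrices. -/
structure SpectralWeight (μ : Measure α) (ι : Type*) [Fintype ι] where
  toFun : α → Matrix ι ι ℂ
  aestronglyMeasurable : ∀ i j, AEStronglyMeasurable (fun f => toFun f i j) μ
  posSemidef : ∀ᵐ f ∂μ, (toFun f).PosSemidef

variable {μ : Measure α} {ι : Type*} [Fintype ι]

namespace SpectralWeight

variable (C : SpectralWeight μ ι)

lemma aestronglyMeasurable_hermForm {a b : α → ι → ℂ}
    (ha : ∀ i, AEStronglyMeasurable (fun f => a f i) μ)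
    (hb : ∀ i, AEStronglyMeasurable (fun f => b f i) μ) :
    AEStronglyMeasurable (fun f => hermForm (C.toFun f) (a f) (b f)) μ := by
  unfold hermForm
  refine Finset.aestronglyMeasurable_fun_sum _ fun i _ =>
    Finset.aestronglyMeasurable_fun_sum _ fun j _ => ?_
  exact ((ha i).mul (C.aestronglyMeasurable i j)).mul (hb j).star

lemma integrable_hermForm {a b : α → ι → ℂ}
    (ha : ∀ i, AEStronglyMeasurable (fun f => a f i) μ)
    (hb : ∀ i, AEStronglyMeasurable (fun f => b f i) μ)
    (ha' : Integrable (fun f => hermForm (C.toFun f) (a f) (a f)) μ)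
    (hb' : Integrable (fun f => hermForm (C.toFun f) (b f) (b f)) μ) :
    Integrable (fun f => hermForm (C.toFun f) (a f) (b f)) μ := by
  refine (ha'.norm.add hb'.norm).mono' (C.aestronglyMeasurable_hermForm ha hb) ?_
  filter_upwards [C.posSemidef] with f hf
  have h := hf.two_mul_norm_hermForm_le (a f) (b f)
  simp only [Pi.add_apply, hf.norm_hermForm_self]
  linarith [norm_nonneg (hermForm (C.toFun f) (a f) (b f))]

/-- The row-vector functions `a` with `∫ a C aᴴ < ∞`. -/
def submodule : Submodule ℂ (α → ι → ℂ) where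
  carrier := {a | (∀ i, AEStronglyMeasurable (fun f => a f i) μ) ∧
    Integrable (fun f => hermForm (C.toFun f) (a f) (a f)) μ}
  add_mem' := by
    rintro a b ⟨ha, ha'⟩ ⟨hb, hb'⟩
    refine ⟨fun i => (ha i).add (hb i), ?_⟩
    simp only [Pi.add_apply, hermForm_add_left, hermForm_add_right]
    exact (ha'.add (C.integrable_hermForm hb ha hb' ha')).add
      ((C.integrable_hermForm ha hb ha' hb').add hb')
  zero_mem' := ⟨fun i => aestronglyMeasurable_const, by simp [hermForm]⟩
  smul_mem' := by
    rintro c a ⟨ha, ha'⟩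
    refine ⟨fun i => (ha i).const_smul c, ?_⟩
    simp only [Pi.smul_apply, hermForm_smul_left, hermForm_smul_right]
    exact (ha'.const_mul _).const_mul _

/-- The pre-Hilbert space of row-vector functions `a` with `∫ a C aᴴ < ∞`. -/
def Space : Type _ := C.submodule

/-- Only the algebraic structure is transferred: a submodule of a function space would also carry
the topology of pointwise convergence, which must not compete with that of the weighted norm. -/
instance : AddCommGroup C.Space := inferInstanceAs (AddCommGroup C.submodule)
instance : Module ℂ C.Space := inferInstanceAs (Module ℂ C.submodule)

variable {C}

/-- The function underlying an element of the weighted space. -/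
def Space.val (a : C.Space) : α → ι → ℂ := Subtype.val (p := (· ∈ C.submodule)) a

variable (C) in
/-- Constructor of elements of the weighted space. -/
def toSpace (a : α → ι → ℂ) (ha : ∀ i, AEStronglyMeasurable (fun f => a f i) μ)
    (ha' : Integrable (fun f => hermForm (C.toFun f) (a f) (a f)) μ) : C.Space :=
  (⟨a, ha, ha'⟩ : C.submodule)

@[simp] lemma toSpace_val (a : α → ι → ℂ) (ha ha') : (toSpace C a ha ha').val = a := rfl
@[simp] lemma val_add (a b : C.Space) : (a + b).val = a.val + b.val := rfl
@[simp] lemma val_smul (c : ℂ) (b : C.Space) : (c • b).val = c • b.val := rfl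
@[simp] lemma val_sub (a b : C.Space) : (a - b).val = a.val - b.val := rfl

lemma Space.aesm (a : C.Space) (i : ι) : AEStronglyMeasurable (fun f => a.val f i) μ :=
  a.2.1 i

lemma Space.integrable (a b : C.Space) :
    Integrable (fun f => hermForm (C.toFun f) (a.val f) (b.val f)) μ :=
  C.integrable_hermForm a.2.1 b.2.1 a.2.2 b.2.2

variable (C) in
/-- The pre-inner product `∫ b C aᴴ`. -/
@[reducible]
def core : PreInnerProductSpace.Core ℂ C.Space where
  inner a b := ∫ f, hermForm (C.toFun f) (b.val f) (a.val f) ∂μ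
  conj_inner_symm a b := by
    rw [← integral_conj]
    refine integral_congr_ae ?_
    filter_upwards [C.posSemidef] with f hf
    exact hf.1.star_hermForm _ _
  re_inner_nonneg a := by
    rw [← integral_re (a.integrable a)]
    refine integral_nonneg_of_ae ?_
    filter_upwards [C.posSemidef] with f hf
    exact hf.hermForm_self_re_nonneg _
  add_left a b c := by
    rw [← integral_add (c.integrable a) (c.integrable b)]
    simp only [val_add, Pi.add_apply, hermForm_add_right]
  smul_left a b r := by
    rw [← integral_const_mul]
    simp only [val_smul, Pi.smul_apply, hermForm_smul_right]
    rfl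

/-- Only a seminorm is available: functions are not identified almost everywhere and the weight may
be singular. -/
instance : SeminormedAddCommGroup C.Space :=
  @InnerProductSpace.Core.toSeminormedAddCommGroup ℂ C.Space _ _ _ C.core

instance : InnerProductSpace ℂ C.Space := InnerProductSpace.ofCore C.core

lemma inner_def (a b : C.Space) :
    inner ℂ a b = ∫ f, hermForm (C.toFun f) (b.val f) (a.val f) ∂μ := rfl

lemma norm_sq_eq (a : C.Space) :
    ‖a‖ ^ 2 = ∫ f, (hermForm (C.toFun f) (a.val f) (a.val f)).re ∂μ := by
  rw [norm_sq_eq_re_inner (𝕜 := ℂ) a, inner_def, ← integral_re (a.integrable a)]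
  rfl

lemma lintegral_eq (a : C.Space) :
    ∫⁻ f, ENNReal.ofReal (hermForm (C.toFun f) (a.val f) (a.val f)).re ∂μ
      = ENNReal.ofReal (‖a‖ ^ 2) := by
  rw [norm_sq_eq, ofReal_integral_eq_lintegral_ofReal]
  · exact (a.integrable a).re
  · filter_upwards [C.posSemidef] with f hf
    exact hf.hermForm_self_re_nonneg _

end SpectralWeight

end Weight

end

/-! ### Coercive weights: embedding into the unweighted space and completeness -/

noncomputable section

section

variable {α : Type*} [MeasurableSpace α] {μ : Measure α}

lemma MeasureTheory.MemLp.eLpNorm_two_eq {E : Type*} [NormedAddCommGroup E] {f : α → E}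
    (hf : MemLp f 2 μ) : eLpNorm f 2 μ = ENNReal.ofReal (√(∫ x, ‖f x‖ ^ 2 ∂μ)) := by
  rw [hf.eLpNorm_eq_integral_rpow_norm (by norm_num) (by norm_num)]
  simp [Real.sqrt_eq_rpow]

lemma MeasureTheory.MemLp.norm_toLp_two_sq {E : Type*} [NormedAddCommGroup E] {f : α → E}
    (hf : MemLp f 2 μ) : ‖hf.toLp f‖ ^ 2 = ∫ x, ‖f x‖ ^ 2 ∂μ := by
  have h0 : 0 ≤ ∫ x, ‖f x‖ ^ 2 ∂μ := by positivity
  rw [Lp.norm_toLp, hf.eLpNorm_two_eq, ENNReal.toReal_ofReal (Real.sqrt_nonneg _), Real.sq_sqrt h0]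

namespace SpectralWeight

variable {ι : Type*} [Fintype ι] {C : SpectralWeight μ ι} {c : ℝ}

lemma Space.aesm_val (a : C.Space) : AEStronglyMeasurable a.val μ :=
  (aemeasurable_pi_iff.2 fun i => (a.aesm i).aemeasurable).aestronglyMeasurable

/-- The family of matrices is bounded below by `c` times the identity. -/
def IsCoercive (C : SpectralWeight μ ι) (c : ℝ) : Prop :=
  0 < c ∧ ∀ᵐ f ∂μ, ∀ a : ι → ℂ, c * ‖a‖ ^ 2 ≤ (hermForm (C.toFun f) a a).re

lemma IsCoercive.norm_sq_le (hC : C.IsCoercive c) (a : C.Space) :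
    ∀ᵐ f ∂μ, ‖a.val f‖ ^ 2 ≤ c⁻¹ * (hermForm (C.toFun f) (a.val f) (a.val f)).re := by
  filter_upwards [hC.2] with f hf
  rw [le_inv_mul_iff₀ hC.1]
  exact hf _

lemma IsCoercive.integrable_norm_sq (hC : C.IsCoercive c) (a : C.Space) :
    Integrable (fun f => ‖a.val f‖ ^ 2) μ := by
  refine ((a.integrable a).re.const_mul c⁻¹).mono' (a.aesm_val.norm.pow 2) ?_
  filter_upwards [hC.norm_sq_le a] with f hf
  rw [Real.norm_of_nonneg (by positivity)]
  exact hf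

lemma IsCoercive.memLp (hC : C.IsCoercive c) (a : C.Space) : MemLp a.val 2 μ :=
  (memLp_two_iff_integrable_sq_norm a.aesm_val).2 (hC.integrable_norm_sq a)

lemma IsCoercive.integral_norm_sq_le (hC : C.IsCoercive c) (a : C.Space) :
    ∫ f, ‖a.val f‖ ^ 2 ∂μ ≤ c⁻¹ * ‖a‖ ^ 2 := by
  rw [norm_sq_eq, ← integral_const_mul]
  exact integral_mono_ae (hC.integrable_norm_sq a) ((a.integrable a).re.const_mul c⁻¹)
    (hC.norm_sq_le a)

/-- The embedding of a coercive weighted space into the unweighted space. -/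
def IsCoercive.toL2 (hC : C.IsCoercive c) : C.Space →L[ℂ] Lp (ι → ℂ) 2 μ :=
  LinearMap.mkContinuous
    { toFun := fun a => (hC.memLp a).toLp a.val
      map_add' := fun a b => MemLp.toLp_add (hC.memLp a) (hC.memLp b)
      map_smul' := fun r a => MemLp.toLp_const_smul r (hC.memLp a) } (√(c⁻¹)) (by
    intro a
    refine abs_le_of_sq_le_sq' ?_ (by positivity) |>.2
    rw [mul_pow, Real.sq_sqrt (inv_nonneg.2 hC.1.le)]
    change ‖(hC.memLp a).toLp a.val‖ ^ 2 ≤ _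
    rw [MemLp.norm_toLp_two_sq]
    exact hC.integral_norm_sq_le a)

lemma IsCoercive.coeFn_toL2 (hC : C.IsCoercive c) (a : C.Space) : hC.toL2 a =ᵐ[μ] a.val :=
  MemLp.coeFn_toLp (hC.memLp a)

lemma continuous_hermForm (A : Matrix ι ι ℂ) : Continuous fun a : ι → ℂ => hermForm A a a := by
  unfold hermForm; fun_prop

/-- Fatou's lemma: a weighted Cauchy sequence converges to its unweighted limit. -/
lemma IsCoercive.completeSpace (hC : C.IsCoercive c) : CompleteSpace C.Space := by
  refine Metric.complete_of_cauchySeq_tendsto fun u hu => ?_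
  obtain ⟨g, hg⟩ := cauchySeq_tendsto_of_complete (hC.toL2.uniformContinuous.comp_cauchySeq hu)
  obtain ⟨ns, hns, hae⟩ := (tendstoInMeasure_of_tendsto_Lp hg).exists_seq_tendsto_ae
  have hgm : ∀ i, AEStronglyMeasurable (fun f => g f i) μ := fun i =>
    (aemeasurable_pi_iff.1 (Lp.aestronglyMeasurable g).aemeasurable i).aestronglyMeasurable
  have hlim : ∀ᵐ f ∂μ, Tendsto (fun l => (u (ns l)).val f) atTop (𝓝 (g f)) := by
    have : ∀ᵐ f ∂μ, ∀ l, hC.toL2 (u (ns l)) f = (u (ns l)).val f :=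
      ae_all_iff.2 fun l => hC.coeFn_toL2 _
    filter_upwards [hae, this] with f h1 h2
    simpa [h2] using h1
  -- Almost everywhere along `ns` the integrand at `u n - u (ns l)` tends to the integrand at `u n -
  -- g`, so Fatou bounds the weighted distance to `g` by the Cauchy modulus.
  have hfatou : ∀ ε : ℝ, 0 < ε → ∃ n₀, ∀ n ≥ n₀,
      ∫⁻ f, ENNReal.ofReal (hermForm (C.toFun f) ((u n).val f - g f) ((u n).val f - g f)).re ∂μ
        ≤ ENNReal.ofReal (ε ^ 2) := by
    intro ε hε
    obtain ⟨n₀, hn₀⟩ := Metric.cauchySeq_iff.1 hu ε hε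
    refine ⟨n₀, fun n hn => ?_⟩
    calc _ = ∫⁻ f, liminf (fun l => ENNReal.ofReal (hermForm (C.toFun f)
            ((u n - u (ns l)).val f) ((u n - u (ns l)).val f)).re) atTop ∂μ := by
          refine lintegral_congr_ae ?_
          filter_upwards [hlim] with f hf
          refine (Tendsto.liminf_eq ?_).symm
          refine ENNReal.tendsto_ofReal ?_
          refine (Complex.continuous_re.tendsto _).comp
            (((continuous_hermForm (C.toFun f)).tendsto _).comp (hf.const_sub _))
      _ ≤ liminf (fun l => ∫⁻ f, ENNReal.ofReal (hermForm (C.toFun f)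
            ((u n - u (ns l)).val f) ((u n - u (ns l)).val f)).re ∂μ) atTop := by
          refine lintegral_liminf_le' fun l => ?_
          exact ((u n - u (ns l)).integrable _).re.aestronglyMeasurable.aemeasurable.ennreal_ofReal
      _ ≤ _ := by
          refine liminf_le_of_le (by isBoundedDefault) fun b hb => ?_
          obtain ⟨l, hl1, hl2⟩ := (hb.and (eventually_ge_atTop n₀)).exists
          refine hl1.trans ?_
          rw [lintegral_eq]
          refine ENNReal.ofReal_le_ofReal ?_
          have := hn₀ n hn (ns l) (hl2.trans (hns.id_le l))
          rw [dist_eq_norm] at this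
          gcongr
  have hmem : ∀ n, (∀ i, AEStronglyMeasurable (fun f => (u n).val f i - g f i) μ) := fun n i =>
    ((u n).aesm i).sub (hgm i)
  have hint : ∀ n, ∫⁻ f, ENNReal.ofReal
      (hermForm (C.toFun f) ((u n).val f - g f) ((u n).val f - g f)).re ∂μ ≠ ⊤ →
      Integrable (fun f => hermForm (C.toFun f) ((u n).val f - g f) ((u n).val f - g f)) μ := by
    intro n hn
    refine ⟨C.aestronglyMeasurable_hermForm (hmem n) (hmem n), ?_⟩
    refine lt_of_le_of_lt (le_of_eq ?_) hn.lt_top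
    refine lintegral_congr_ae ?_
    filter_upwards [C.posSemidef] with f hf
    rw [← ofReal_norm, hf.norm_hermForm_self]
  obtain ⟨n₁, hn₁⟩ := hfatou 1 one_pos
  -- So far `g` is only an unweighted limit. It lies in the weighted space because `u n₁` and the
  -- difference `u n₁ - g` do.
  let d : C.Space := toSpace C (fun f => (u n₁).val f - g f) (hmem n₁)
    (hint n₁ (ne_top_of_le_ne_top ENNReal.ofReal_ne_top (hn₁ n₁ le_rfl)))
  refine ⟨u n₁ - d, ?_⟩
  have hval : (u n₁ - d).val = g := by
    ext f i; simp [d]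
  rw [Metric.tendsto_atTop]
  intro ε hε
  obtain ⟨n₀, h⟩ := hfatou (ε / 2) (half_pos hε)
  refine ⟨n₀, fun n hn => ?_⟩
  have h1 := h n hn
  have h2 := lintegral_eq (u n - (u n₁ - d))
  rw [val_sub, hval] at h2
  simp only [Pi.sub_apply] at h2
  rw [h2, ENNReal.ofReal_le_ofReal_iff (by positivity)] at h1
  rw [dist_eq_norm]
  have := abs_le_of_sq_le_sq' h1 (by positivity) |>.2
  linarith

end SpectralWeight

end

end

/-! ### Fourier analysis on the band -/

noncomputable section

/-- The normalized Lebesgue measure on the band `(-fₛ/2, fₛ/2]`. -/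
def bandMeasure (fs : ℝ) : Measure ℝ :=
  ENNReal.ofReal (1 / fs) • volume.restrict (Set.Ioc (-(fs / 2)) (fs / 2))

/-- The exponential `f ↦ e^{j 2 π f n Tₛ}`. -/
def bandChar (fs : ℝ) (n : ℤ) (f : ℝ) : ℂ :=
  Complex.exp (2 * Real.pi * Complex.I * f * n * (1 / fs : ℝ))

lemma bandChar_eq (fs : ℝ) (n : ℤ) (f : ℝ) :
    bandChar fs n f = Complex.exp ((2 * Real.pi * f * n * (1 / fs) : ℝ) * Complex.I) := by
  rw [bandChar]; congr 1; push_cast; ring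

lemma norm_bandChar (fs : ℝ) (n : ℤ) (f : ℝ) : ‖bandChar fs n f‖ = 1 := by
  rw [bandChar_eq, Complex.norm_exp_ofReal_mul_I]

lemma star_bandChar (fs : ℝ) (n : ℤ) (f : ℝ) : star (bandChar fs n f) = bandChar fs (-n) f := by
  rw [bandChar_eq, bandChar_eq, Complex.star_def, ← Complex.exp_conj]
  congr 1
  rw [map_mul, Complex.conj_I, Complex.conj_ofReal]
  push_cast; ring

lemma bandChar_add (fs : ℝ) (m n : ℤ) (f : ℝ) :
    bandChar fs (m + n) f = bandChar fs m f * bandChar fs n f := by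
  rw [bandChar, bandChar, bandChar, ← Complex.exp_add]; congr 1; push_cast; ring

lemma bandChar_zero (fs : ℝ) (f : ℝ) : bandChar fs 0 f = 1 := by simp [bandChar]

@[fun_prop]
lemma continuous_bandChar (fs : ℝ) (n : ℤ) : Continuous (bandChar fs n) := by
  unfold bandChar; fun_prop

lemma bandChar_sub_zsmul {fs : ℝ} (hfs : 0 < fs) (n k : ℤ) (f : ℝ) :
    bandChar fs n (f - k * fs) = bandChar fs n f := by
  have h : (fs : ℂ) ≠ 0 := by exact_mod_cast hfs.ne'
  rw [bandChar, bandChar, Complex.exp_eq_exp_iff_exists_int]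
  refine ⟨-(k * n), ?_⟩
  push_cast; field_simp; ring

lemma bandMeasure_absolutelyContinuous (fs : ℝ) : bandMeasure fs ≪ volume :=
  Measure.smul_absolutelyContinuous.trans Measure.restrict_le_self.absolutelyContinuous

section

variable {fs : ℝ} (hfs : 0 < fs)
include hfs

lemma integral_bandMeasure (F : ℝ → ℂ) :
    ∫ f, F f ∂(bandMeasure fs) = ((1 / fs : ℝ) : ℂ) * ∫ f in (-(fs / 2))..(fs / 2), F f := by
  rw [bandMeasure, integral_smul_measure, intervalIntegral.integral_of_le (by linarith),
    ENNReal.toReal_ofReal (by positivity), Complex.real_smul]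

lemma integrable_bandMeasure_iff {F : ℝ → ℂ} : Integrable F (bandMeasure fs) ↔
    IntegrableOn F (Set.Ioc (-(fs / 2)) (fs / 2)) := by
  rw [bandMeasure, integrable_smul_measure _ ENNReal.ofReal_ne_top]
  · rfl
  · simpa using hfs

lemma integrable_bandMeasure_iff_intervalIntegrable {F : ℝ → ℂ} :
    Integrable F (bandMeasure fs) ↔
    IntervalIntegrable F volume (-(fs / 2)) (fs / 2) := by
  rw [integrable_bandMeasure_iff hfs, intervalIntegrable_iff_integrableOn_Ioc_of_le (by linarith)]

lemma ae_bandMeasure_iff {p : ℝ → Prop} : (∀ᵐ f ∂(bandMeasure fs), p f) ↔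
    ∀ᵐ f ∂(volume.restrict (Set.Ioc (-(fs / 2)) (fs / 2))), p f := by
  rw [bandMeasure]
  exact Measure.ae_ennreal_smul_measure_iff (by simpa using hfs)

lemma isProbabilityMeasure_bandMeasure : IsProbabilityMeasure (bandMeasure fs) := by
  constructor
  rw [bandMeasure, Measure.smul_apply, Measure.restrict_apply MeasurableSet.univ, Set.univ_inter,
    Real.volume_Ioc, smul_eq_mul, ← ENNReal.ofReal_mul (by positivity)]
  rw [show 1 / fs * (fs / 2 - -(fs / 2)) = 1 by field_simp; ring, ENNReal.ofReal_one]

lemma integral_bandChar (n : ℤ) :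
    ∫ f, bandChar fs n f ∂(bandMeasure fs) = if n = 0 then 1 else 0 := by
  split_ifs with h
  · have := isProbabilityMeasure_bandMeasure hfs
    simp [h, bandChar_zero]
  · rw [integral_bandMeasure hfs]
    have hc : (2 * Real.pi * Complex.I * n * (1 / fs : ℝ) : ℂ) ≠ 0 := by
      have : (n : ℂ) ≠ 0 := by exact_mod_cast h
      have h' : (fs : ℂ) ≠ 0 := by exact_mod_cast hfs.ne'
      simp [this, h', Real.pi_ne_zero]
    have : ∀ f : ℝ, bandChar fs n f
        = Complex.exp ((2 * Real.pi * Complex.I * n * (1 / fs : ℝ) : ℂ) * f) := by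
      intro f; rw [bandChar]; congr 1; ring
    simp only [this]
    rw [integral_exp_mul_complex hc, ← this, ← this,
      show -(fs / 2) = fs / 2 - (1 : ℤ) * fs by push_cast; ring, bandChar_sub_zsmul hfs]
    simp

/-- An integrable function on the band is determined by its Fourier coefficients. -/
lemma ae_eq_zero_of_integral_bandChar_mul_eq_zero {F : ℝ → ℂ} (hF : Integrable F (bandMeasure fs))
    (h : ∀ n : ℤ, ∫ f, bandChar fs n f * F f ∂(bandMeasure fs) = 0) :
    F =ᵐ[bandMeasure fs] 0 := by
  have : Fact (0 < fs) := ⟨hfs⟩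
  -- Integration against `F` is a bounded functional on continuous functions on the circle. It
  -- vanishes on exponentials, hence on the uniform closure of trigonometric polynomials, which is
  -- everything.
  let Λ : C(AddCircle fs, ℂ) →L[ℂ] ℂ := LinearMap.mkContinuous
    { toFun := fun φ => ∫ f, φ (f : AddCircle fs) * F f ∂(bandMeasure fs)
      map_add' := fun φ ψ => by
        rw [← integral_add]
        · simp [add_mul]
        · exact hF.bdd_mul (φ.continuous.comp
            (AddCircle.continuous_mk' fs)).aestronglyMeasurable (c := ‖φ‖)
            (Eventually.of_forall fun f => φ.norm_coe_le_norm _)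
        · exact hF.bdd_mul (ψ.continuous.comp
            (AddCircle.continuous_mk' fs)).aestronglyMeasurable (c := ‖ψ‖)
            (Eventually.of_forall fun f => ψ.norm_coe_le_norm _)
      map_smul' := fun r φ => by
        simp only [RingHom.id_apply, smul_eq_mul]
        rw [← integral_const_mul]
        simp [mul_assoc] }
    (∫ f, ‖F f‖ ∂(bandMeasure fs)) (fun φ => by
      change ‖∫ f, φ (f : AddCircle fs) * F f ∂(bandMeasure fs)‖ ≤ _
      refine (norm_integral_le_integral_norm _).trans ?_
      rw [← integral_mul_const]
      refine integral_mono_of_nonneg (Eventually.of_forall fun f => norm_nonneg _)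
        (hF.norm.mul_const _) (Eventually.of_forall fun f => ?_)
      simp only [norm_mul]
      rw [mul_comm]
      gcongr
      exact φ.norm_coe_le_norm _)
  have hΛ : ∀ φ, Λ φ = 0 := by
    have hle : Submodule.span ℂ (Set.range (@fourier fs)) ≤ LinearMap.ker (Λ : _ →ₗ[ℂ] ℂ) := by
      rw [Submodule.span_le]
      rintro _ ⟨n, rfl⟩
      change ∫ f, fourier n (f : AddCircle fs) * F f ∂(bandMeasure fs) = 0
      rw [← h n]
      refine integral_congr_ae (Eventually.of_forall fun f => ?_)
      simp only [fourier_coe_apply, bandChar]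
      congr 2
      push_cast; ring
    have hle' := Submodule.topologicalClosure_minimal _ hle
      (ContinuousLinearMap.isClosed_ker Λ)
    rw [span_fourier_closure_eq_top] at hle'
    exact fun φ => hle' (Submodule.mem_top : φ ∈ _)
  -- Test functions supported in the open band vanish at both end points, so they lift to continuous
  -- functions on the circle, where `Λ` is known to vanish.
  have hU : ∀ᵐ x : ℝ, x ∈ Set.Ioo (-(fs / 2)) (fs / 2) → F x = 0 := by
    refine isOpen_Ioo.ae_eq_zero_of_integral_contDiff_smul_eq_zero ?_ fun g hg hgc hgs => ?_
    · exact (((integrable_bandMeasure_iff hfs).1 hF).mono_set Set.Ioo_subset_Ioc_self).locallyIntegrableOn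
    · have hg0 : ∀ x, x ∉ Set.Ioo (-(fs / 2)) (fs / 2) → g x = 0 := fun x hx => by
        by_contra h0
        exact hx (hgs (subset_tsupport g h0))
      have hcont : Continuous (AddCircle.liftIco fs (-(fs / 2)) (fun x => (g x : ℂ))) := by
        refine AddCircle.liftIco_continuous ?_ ?_
        · rw [hg0 _ (by simp), hg0 _ (by simp)]
        · exact (Complex.continuous_ofReal.comp hg.continuous).continuousOn
      have h0 := hΛ ⟨_, hcont⟩
      change ∫ f, AddCircle.liftIco fs (-(fs / 2)) (fun x => (g x : ℂ)) (f : AddCircle fs) * F f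
        ∂(bandMeasure fs) = 0 at h0
      rw [integral_bandMeasure hfs, intervalIntegral.integral_of_le (by linarith),
        integral_Ioc_eq_integral_Ioo] at h0
      have h1 : ∫ x, g x • F x = ∫ x in Set.Ioo (-(fs / 2)) (fs / 2), g x • F x := by
        rw [← integral_indicator measurableSet_Ioo]
        refine integral_congr_ae (Eventually.of_forall fun x => ?_)
        by_cases hx : x ∈ Set.Ioo (-(fs / 2)) (fs / 2)
        · simp [hx]
        · simp [hx, hg0 x hx]
      rw [h1, ← (mul_eq_zero.1 h0).resolve_left (by
        have : fs ≠ 0 := hfs.ne'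
        simp [this])]
      refine setIntegral_congr_fun measurableSet_Ioo fun x hx => ?_
      rw [AddCircle.liftIco_coe_apply ⟨hx.1.le, by linarith [hx.2]⟩, Complex.real_smul]
  rw [EventuallyEq, ae_bandMeasure_iff hfs, ← Measure.restrict_congr_set Ioo_ae_eq_Ioc]
  exact (ae_restrict_iff' measurableSet_Ioo).2 hU

end

end

/-! ### Spectral correlations of convolutions with integrable kernels -/

noncomputable section

variable {Ω : Type*} [MeasurableSpace Ω] {P : Measure Ω} {M : ℕ} {x : ℝ → Ω → Fin M → ℝ}

namespace TaskADC.IsZeroMeanWSS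

lemma measurable_eval (hx : IsZeroMeanWSS P x) (m : Fin M) :
    Measurable (fun p : ℝ × Ω => x p.1 p.2 m) :=
  (measurable_pi_apply m).comp hx.measurable

lemma integral_mul_eq (hx : IsZeroMeanWSS P x) (t t' : ℝ) (i j : Fin M) :
    ∫ ω, x t ω i * x t' ω j ∂P = ∫ ω, x (t - t') ω i * x 0 ω j ∂P := by
  rw [← hx.stationary t' (t - t') i j, add_sub_cancel]

lemma integrable_mul (hx : IsZeroMeanWSS P x) (t t' : ℝ) (i j : Fin M) :
    Integrable (fun ω => x t ω i * x t' ω j) P :=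
  (hx.memLp t i).integrable_mul (hx.memLp t' j)

/-- By `|uv| ≤ u² + v²` and stationarity the bound does not depend on the two times; this uniformity
is what makes Fubini applicable to convolutions. -/
lemma integral_abs_mul_le (hx : IsZeroMeanWSS P x) (t t' : ℝ) (i j : Fin M) :
    ∫ ω, |x t ω i * x t' ω j| ∂P
      ≤ ∫ ω, x 0 ω i * x 0 ω i ∂P + ∫ ω, x 0 ω j * x 0 ω j ∂P := by
  have h1 := hx.integral_mul_eq t t i i
  have h2 := hx.integral_mul_eq t' t' j j
  rw [sub_self] at h1 h2
  rw [← h1, ← h2, ← integral_add (hx.integrable_mul _ _ _ _) (hx.integrable_mul _ _ _ _)]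
  refine integral_mono (hx.integrable_mul _ _ _ _).abs
    ((hx.integrable_mul _ _ _ _).add (hx.integrable_mul _ _ _ _)) fun ω => ?_
  simp only
  rw [abs_le]
  constructor <;> nlinarith [sq_nonneg (x t ω i + x t' ω j), sq_nonneg (x t ω i - x t' ω j),
    sq_nonneg (x t ω i), sq_nonneg (x t' ω j)]

section Convolution

variable {h h' : ℝ → ℝ} (t t' : ℝ) (m m' : Fin M)

lemma aestronglyMeasurable_convKernel (hx : IsZeroMeanWSS P x) [SFinite P] (hh : Integrable h) :
    AEStronglyMeasurable (fun p : ℝ × Ω => h p.1 * x (t - p.1) p.2 m) (volume.prod P) := by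
  refine hh.aestronglyMeasurable.comp_fst.mul ?_
  exact ((hx.measurable_eval m).comp
    ((measurable_const.sub measurable_fst).prodMk measurable_snd)).aestronglyMeasurable

variable [IsProbabilityMeasure P]

lemma integrable_convKernel_mul (hx : IsZeroMeanWSS P x) (hh : Integrable h) (hh' : Integrable h') :
    Integrable (fun p : (ℝ × ℝ) × Ω => (h p.1.1 * x (t - p.1.1) p.2 m) *
      (h' p.1.2 * x (t' - p.1.2) p.2 m')) ((volume.prod volume).prod P) := by
  have hmeas : AEStronglyMeasurable (fun p : (ℝ × ℝ) × Ω => (h p.1.1 * x (t - p.1.1) p.2 m) *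
      (h' p.1.2 * x (t' - p.1.2) p.2 m')) ((volume.prod volume).prod P) := by
    refine AEStronglyMeasurable.mul (AEStronglyMeasurable.mul ?_ ?_)
      (AEStronglyMeasurable.mul ?_ ?_)
    · exact hh.aestronglyMeasurable.comp_fst.comp_fst
    · exact ((hx.measurable_eval m).comp ((measurable_const.sub
        measurable_fst.fst).prodMk measurable_snd)).aestronglyMeasurable
    · exact hh'.aestronglyMeasurable.comp_snd.comp_fst
    · exact ((hx.measurable_eval m').comp ((measurable_const.sub
        measurable_fst.snd).prodMk measurable_snd)).aestronglyMeasurable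
  have hform : ∀ (p : ℝ × ℝ) (ω : Ω), (h p.1 * x (t - p.1) ω m) * (h' p.2 * x (t' - p.2) ω m')
      = (h p.1 * h' p.2) * (x (t - p.1) ω m * x (t' - p.2) ω m') := fun p ω => by ring
  rw [integrable_prod_iff hmeas]
  refine ⟨Eventually.of_forall fun p => ?_, ?_⟩
  · simp only [hform]
    exact (hx.integrable_mul _ _ _ _).const_mul _
  · refine ((hh.mul_prod hh').norm.mul_const (∫ ω, x 0 ω m * x 0 ω m ∂P
      + ∫ ω, x 0 ω m' * x 0 ω m' ∂P)).mono' hmeas.norm.integral_prod_right' ?_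
    refine Eventually.of_forall fun p => ?_
    rw [Real.norm_of_nonneg (by positivity)]
    simp only [hform]
    simp only [norm_mul (h _ * h' _), integral_const_mul]
    refine mul_le_mul_of_nonneg_left ?_ (norm_nonneg _)
    exact hx.integral_abs_mul_le _ _ _ _

lemma aestronglyMeasurable_convTerm (hx : IsZeroMeanWSS P x) (hh : Integrable h) :
    AEStronglyMeasurable (fun ω => ∫ τ, h τ * x (t - τ) ω m) P :=
  (hx.aestronglyMeasurable_convKernel t m hh).prod_swap.integral_prod_right'

/-- The square of a path integral is a double integral of the product kernel, which is jointly
integrable with `ω`; integrating out the two delays first leaves an integrable function of `ω`. -/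
lemma memLp_convTerm (hx : IsZeroMeanWSS P x) (hh : Integrable h) :
    MemLp (fun ω => ∫ τ, h τ * x (t - τ) ω m) 2 P := by
  rw [memLp_two_iff_integrable_sq (hx.aestronglyMeasurable_convTerm t m hh)]
  have := (hx.integrable_convKernel_mul t t m m hh hh).integral_prod_right
  refine this.congr (Eventually.of_forall fun ω => ?_)
  simp only
  rw [pow_two, ← integral_prod_mul]

lemma integral_convTerm_mul (hx : IsZeroMeanWSS P x) (hh : Integrable h) (hh' : Integrable h') :
    ∫ ω, (∫ τ, h τ * x (t - τ) ω m) * (∫ τ, h' τ * x (t' - τ) ω m') ∂P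
      = ∫ p : ℝ × ℝ, (h p.1 * h' p.2) *
          ∫ ω, x (t - p.1 - (t' - p.2)) ω m * x 0 ω m' ∂P := by
  have hswap := integral_integral_swap (f := fun (p : ℝ × ℝ) ω => (h p.1 * x (t - p.1) ω m) *
    (h' p.2 * x (t' - p.2) ω m')) (hx.integrable_convKernel_mul t t' m m' hh hh')
  -- This is valid for every `ω`, also where a path integral diverges: `integral_prod_mul` needs no
  -- integrability.
  have hprod : ∀ ω, (∫ τ, h τ * x (t - τ) ω m) * (∫ τ, h' τ * x (t' - τ) ω m')
      = ∫ p : ℝ × ℝ, (h p.1 * x (t - p.1) ω m) * (h' p.2 * x (t' - p.2) ω m') := fun ω =>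
    (integral_prod_mul (fun τ => h τ * x (t - τ) ω m) (fun τ => h' τ * x (t' - τ) ω m')).symm
  simp only [hprod]
  refine hswap.symm.trans ?_
  refine integral_congr_ae (Eventually.of_forall fun p => ?_)
  simp only
  rw [← hx.integral_mul_eq, ← integral_const_mul]
  refine integral_congr_ae (Eventually.of_forall fun ω => ?_)
  simp only
  ring

end Convolution

end TaskADC.IsZeroMeanWSS

/-- The spectral weight of a joint power spectral density. -/
def TaskADC.IsJointPSD.weight {C : ℝ → Matrix (Fin M) (Fin M) ℂ} (hC : IsJointPSD P x C) :
    SpectralWeight (volume : Measure ℝ) (Fin M) where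
  toFun := C
  aestronglyMeasurable := fun i j => (hC.integrable i j).aestronglyMeasurable
  posSemidef := hC.posSemidef

/-- The exponential `f ↦ e^{j 2 π f t}`. -/
def timeShift (t f : ℝ) : ℂ := Complex.exp ((2 * Real.pi * f * t : ℝ) * Complex.I)

lemma norm_timeShift (t f : ℝ) : ‖timeShift t f‖ = 1 := Complex.norm_exp_ofReal_mul_I _

lemma star_timeShift (t f : ℝ) : star (timeShift t f) = timeShift (-t) f := by
  rw [timeShift, timeShift, Complex.star_def, ← Complex.exp_conj, map_mul, Complex.conj_I,
    Complex.conj_ofReal]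
  congr 1; push_cast; ring

lemma timeShift_add (s t f : ℝ) : timeShift (s + t) f = timeShift s f * timeShift t f := by
  rw [timeShift, timeShift, timeShift, ← Complex.exp_add]; congr 1; push_cast; ring

@[fun_prop]
lemma continuous_timeShift (t : ℝ) : Continuous (timeShift t) := by unfold timeShift; fun_prop

lemma fourier_ofReal_eq (h : ℝ → ℝ) (f : ℝ) :
    𝓕 (fun t : ℝ => (h t : ℂ)) f = ∫ τ, (h τ : ℂ) * timeShift (-τ) f := by
  rw [Real.fourier_real_eq_integral_exp_smul]
  refine integral_congr_ae (Eventually.of_forall fun τ => ?_)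
  simp only [timeShift, smul_eq_mul]
  rw [mul_comm]; congr 3; push_cast; ring

lemma continuous_fourier_ofReal {h : ℝ → ℝ} (hh : Integrable h) :
    Continuous (𝓕 (fun t : ℝ => (h t : ℂ))) :=
  VectorFourier.fourierIntegral_continuous Real.continuous_fourierChar
    (by exact continuous_inner) hh.ofReal

lemma norm_fourier_ofReal_le (h : ℝ → ℝ) (f : ℝ) :
    ‖𝓕 (fun t : ℝ => (h t : ℂ)) f‖ ≤ ∫ τ, ‖h τ‖ := by
  rw [fourier_ofReal_eq]
  refine (norm_integral_le_integral_norm _).trans (le_of_eq ?_)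
  simp [norm_timeShift]

lemma star_fourier_ofReal (h : ℝ → ℝ) (f : ℝ) :
    star (𝓕 (fun t : ℝ => (h t : ℂ)) f) = ∫ τ, (h τ : ℂ) * timeShift τ f := by
  rw [fourier_ofReal_eq, Complex.star_def, ← integral_conj]
  refine integral_congr_ae (Eventually.of_forall fun τ => ?_)
  simp only [map_mul, Complex.conj_ofReal, ← Complex.star_def, star_timeShift, neg_neg]

section

variable [IsProbabilityMeasure P] {C : ℝ → Matrix (Fin M) (Fin M) ℂ}

/-- Write the autocorrelation as the inverse Fourier integral of `C` and exchange the integrals; the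
exponential at `t - τ - (t' - τ')` splits into a shift and a Fourier kernel for each of the two
filters. -/
lemma TaskADC.IsZeroMeanWSS.integral_convTerm_mul_eq_spectral (hx : IsZeroMeanWSS P x)
    (hC : IsJointPSD P x C) {h h' : ℝ → ℝ}
    (hh : Integrable h) (hh' : Integrable h') (t t' : ℝ) (m m' : Fin M) :
    ((∫ ω, (∫ τ, h τ * x (t - τ) ω m) * (∫ τ, h' τ * x (t' - τ) ω m') ∂P : ℝ) : ℂ)
      = ∫ f, (timeShift t f * 𝓕 (fun t : ℝ => (h t : ℂ)) f) * C f m m' *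
          star (timeShift t' f * 𝓕 (fun t : ℝ => (h' t : ℂ)) f) := by
  rw [hx.integral_convTerm_mul t t' m m' hh hh', ← integral_complex_ofReal]
  have hint : Integrable (fun q : (ℝ × ℝ) × ℝ => (((h q.1.1 : ℂ) * (h' q.1.2 : ℂ)) * C q.2 m m') *
      timeShift (t - q.1.1 - (t' - q.1.2)) q.2) ((volume.prod volume).prod volume) := by
    refine Integrable.mul_bdd (c := 1)
      ((Integrable.mul_prod (hh.ofReal (𝕜 := ℂ)) (hh'.ofReal (𝕜 := ℂ))).mul_prod
        (hC.integrable m m')) ?_ ?_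
    · exact Continuous.aestronglyMeasurable (by unfold timeShift; fun_prop)
    · exact Eventually.of_forall fun q => (norm_timeShift _ _).le
  have hswap := integral_integral_swap (f := fun (p : ℝ × ℝ) f =>
    (((h p.1 : ℂ) * (h' p.2 : ℂ)) * C f m m') * timeShift (t - p.1 - (t' - p.2)) f) hint
  have hL : ∀ p : ℝ × ℝ, ((h p.1 * h' p.2 * ∫ ω, x (t - p.1 - (t' - p.2)) ω m * x 0 ω m' ∂P : ℝ) : ℂ)
      = ∫ f, (((h p.1 : ℂ) * (h' p.2 : ℂ)) * C f m m') * timeShift (t - p.1 - (t' - p.2)) f := by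
    intro p
    rw [Complex.ofReal_mul, hC.autocorrelation, ← integral_const_mul]
    refine integral_congr_ae (Eventually.of_forall fun f => ?_)
    simp only [timeShift]
    push_cast
    rw [mul_assoc ((h p.1 : ℂ) * (h' p.2 : ℂ))]
    congr 3; ring
  simp only [hL]
  rw [show (volume : Measure (ℝ × ℝ)) = volume.prod volume from rfl, hswap]
  refine integral_congr_ae (Eventually.of_forall fun f => ?_)
  simp only
  rw [star_mul', star_fourier_ofReal, fourier_ofReal_eq]
  have := integral_prod_mul (μ := (volume : Measure ℝ)) (ν := (volume : Measure ℝ))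
    (fun τ => (h τ : ℂ) * timeShift (-τ) f) (fun τ => (h' τ : ℂ) * timeShift τ f)
  rw [show ∀ a b c d e : ℂ, a * b * c * (d * e) = (a * c * d) * (b * e) by intros; ring, ← this,
    ← integral_const_mul]
  refine integral_congr_ae (Eventually.of_forall fun p => ?_)
  simp only
  rw [show t - p.1 - (t' - p.2) = t + -p.1 + (-t' + p.2) by ring, timeShift_add, timeShift_add,
    timeShift_add (-t'), star_timeShift]
  ring

end

end

/-! ### Mean-square filter outputs and their spectral representatives -/

noncomputable section

section L2

variable {Ω : Type*} [MeasurableSpace Ω] {P : Measure Ω}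

lemma inner_toLp_toLp {U V : Ω → ℝ} (hU : MemLp U 2 P) (hV : MemLp V 2 P) :
    inner ℝ (hU.toLp U) (hV.toLp V) = ∫ ω, U ω * V ω ∂P := by
  rw [L2.inner_def]
  refine integral_congr_ae ?_
  filter_upwards [hU.coeFn_toLp, hV.coeFn_toLp] with ω h1 h2
  rw [h1, h2]
  simp [mul_comm]

lemma tendsto_toLp {U : ℕ → Ω → ℝ} {V : Ω → ℝ} (hU : ∀ j, MemLp (U j) 2 P) (hV : MemLp V 2 P)
    (h : Tendsto (fun j => eLpNorm (fun ω => U j ω - V ω) 2 P) atTop (𝓝 0)) :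
    Tendsto (fun j => (hU j).toLp (U j)) atTop (𝓝 (hV.toLp V)) :=
  (Lp.tendsto_Lp_iff_tendsto_eLpNorm'' U hU V hV).2 h

end L2

variable {Ω : Type*} [MeasurableSpace Ω] {P : Measure Ω} [IsProbabilityMeasure P] {M L L' : ℕ}
  {x : ℝ → Ω → Fin M → ℝ} {C : ℝ → Matrix (Fin M) (Fin M) ℂ}

lemma TaskADC.IsZeroMeanWSS.memLp_convolve (hx : IsZeroMeanWSS P x)
    {h : ℝ → Matrix (Fin L) (Fin M) ℝ} (hh : ∀ l m, Integrable (fun τ => h τ l m)) (t : ℝ)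
    (l : Fin L) : MemLp (fun ω => convolve h x t ω l) 2 P :=
  memLp_finsetSum _ fun m _ => hx.memLp_convTerm t m (hh l m)

/-- The row `f ↦ e^{j 2 π f t} A(f)_l` of a shifted frequency response. -/
def shiftedRow (A : ℝ → Matrix (Fin L) (Fin M) ℂ) (t : ℝ) (l : Fin L) (f : ℝ) : Fin M → ℂ :=
  timeShift t f • A f l

lemma continuous_shiftedRow_freqResponse {h : ℝ → Matrix (Fin L) (Fin M) ℝ}
    (hh : ∀ l m, Integrable (fun τ => h τ l m)) (t : ℝ) (l : Fin L) (m : Fin M) :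
    Continuous fun f => shiftedRow (freqResponse h) t l f m :=
  (continuous_timeShift t).mul (continuous_fourier_ofReal (hh l m))

omit [IsProbabilityMeasure P] in
lemma integrable_shiftedRow_mul (hC : IsJointPSD P x C)
    {h : ℝ → Matrix (Fin L) (Fin M) ℝ} (hh : ∀ l m, Integrable (fun τ => h τ l m))
    {h' : ℝ → Matrix (Fin L') (Fin M) ℝ} (hh' : ∀ l m, Integrable (fun τ => h' τ l m))
    (t t' : ℝ) (l : Fin L) (l' : Fin L') (m m' : Fin M) :
    Integrable fun f => shiftedRow (freqResponse h) t l f m * C f m m' *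
      star (shiftedRow (freqResponse h') t' l' f m') := by
  refine Integrable.mul_bdd (c := ∫ τ, ‖h' τ l' m'‖) (Integrable.bdd_mul (c := ∫ τ, ‖h τ l m‖)
    (hC.integrable m m') (continuous_shiftedRow_freqResponse hh t l m).aestronglyMeasurable ?_)
    (continuous_shiftedRow_freqResponse hh' t' l' m').star.aestronglyMeasurable ?_
  · refine Eventually.of_forall fun f => ?_
    change ‖timeShift t f * _‖ ≤ _
    rw [norm_mul, norm_timeShift, one_mul]
    exact norm_fourier_ofReal_le _ _
  · refine Eventually.of_forall fun f => ?_
    change ‖star (timeShift t' f * _)‖ ≤ _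
    rw [norm_star, norm_mul, norm_timeShift, one_mul]
    exact norm_fourier_ofReal_le _ _

lemma integral_convolve_mul (hx : IsZeroMeanWSS P x) (hC : IsJointPSD P x C)
    {h : ℝ → Matrix (Fin L) (Fin M) ℝ} (hh : ∀ l m, Integrable (fun τ => h τ l m))
    {h' : ℝ → Matrix (Fin L') (Fin M) ℝ} (hh' : ∀ l m, Integrable (fun τ => h' τ l m))
    (t t' : ℝ) (l : Fin L) (l' : Fin L') :
    ((∫ ω, convolve h x t ω l * convolve h' x t' ω l' ∂P : ℝ) : ℂ) =
      ∫ f, hermForm (C f) (shiftedRow (freqResponse h) t l f)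
        (shiftedRow (freqResponse h') t' l' f) := by
  simp only [convolve, Finset.sum_mul_sum, hermForm]
  rw [integral_finsetSum, Complex.ofReal_sum, integral_finsetSum]
  · refine Finset.sum_congr rfl fun m _ => ?_
    rw [integral_finsetSum, Complex.ofReal_sum, integral_finsetSum]
    · exact Finset.sum_congr rfl fun m' _ =>
        hx.integral_convTerm_mul_eq_spectral hC (hh l m) (hh' l' m') t t' m m'
    · exact fun m' _ => integrable_shiftedRow_mul hC hh hh' t t' l l' m m'
    · exact fun m' _ => (hx.memLp_convTerm t m (hh l m)).integrable_mul
        (hx.memLp_convTerm t' m' (hh' l' m'))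
  · exact fun m _ => integrable_finsetSum _ fun m' _ =>
      integrable_shiftedRow_mul hC hh hh' t t' l l' m m'
  · exact fun m _ => integrable_finsetSum _ fun m' _ =>
      (hx.memLp_convTerm t m (hh l m)).integrable_mul (hx.memLp_convTerm t' m' (hh' l' m'))

lemma hermForm_shiftedRow (A : ℝ → Matrix (Fin L) (Fin M) ℂ) (B : ℝ → Matrix (Fin L') (Fin M) ℂ)
    (t t' : ℝ) (l : Fin L) (l' : Fin L') (f : ℝ) :
    hermForm (C f) (shiftedRow A t l f) (shiftedRow B t' l' f)
      = timeShift (t - t') f * (A f * C f * (B f)ᴴ) l l' := by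
  rw [shiftedRow, shiftedRow, hermForm_smul_left, hermForm_smul_right, star_timeShift,
    mul_mul_conjTranspose_apply, sub_eq_add_neg, timeShift_add, mul_assoc]

/-- The element of the spectral space that represents a convolution. -/
def convolveSpace (hC : IsJointPSD P x C)
    {h : ℝ → Matrix (Fin L) (Fin M) ℝ} (hh : ∀ l m, Integrable (fun τ => h τ l m))
    (t : ℝ) (l : Fin L) : hC.weight.Space :=
  SpectralWeight.toSpace hC.weight (shiftedRow (freqResponse h) t l)
    (fun m => (continuous_shiftedRow_freqResponse hh t l m).aestronglyMeasurable)
    (integrable_finsetSum _ fun m _ => integrable_finsetSum _ fun m' _ =>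
      integrable_shiftedRow_mul hC hh hh t t l l m m')

/-- `U` is a mean-square limit of convolutions whose spectral representatives tend to `a`. -/
def IsSpectralLimit (hC : IsJointPSD P x C) (U : Ω → ℝ) (a : hC.weight.Space) : Prop :=
  ∃ (L : ℕ) (l : Fin L) (t : ℝ) (h : ℕ → ℝ → Matrix (Fin L) (Fin M) ℝ)
    (hh : ∀ j l m, Integrable (fun τ => h j τ l m)),
    Tendsto (fun j => convolveSpace hC (hh j) t l) atTop (𝓝 a) ∧
    Tendsto (fun j => eLpNorm (fun ω => convolve (h j) x t ω l - U ω) 2 P) atTop (𝓝 0)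

/-- The identity holds for convolutions, and both inner products are continuous. The two variables
may come from different filters at different times, so one statement covers all correlations among
`s̃` and the samples of `y`. -/
lemma IsSpectralLimit.integral_mul_eq_inner (hx : IsZeroMeanWSS P x) {hC : IsJointPSD P x C}
    {U V : Ω → ℝ} {a b : hC.weight.Space} (ha : IsSpectralLimit hC U a)
    (hb : IsSpectralLimit hC V b) (hU : MemLp U 2 P) (hV : MemLp V 2 P) :
    ((∫ ω, U ω * V ω ∂P : ℝ) : ℂ) = inner ℂ b a := by
  obtain ⟨L, l, t, h, hh, h1, h2⟩ := ha
  obtain ⟨L', l', t', h', hh', h1', h2'⟩ := hb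
  have e1 := ((tendsto_toLp (fun j => hx.memLp_convolve (hh j) t l) hU h2).inner (𝕜 := ℝ)
    (tendsto_toLp (fun j => hx.memLp_convolve (hh' j) t' l') hV h2'))
  have e2 := h1'.inner (𝕜 := ℂ) h1
  simp only [inner_toLp_toLp] at e1
  refine tendsto_nhds_unique ((Complex.continuous_ofReal.tendsto _).comp e1) (e2.congr fun j => ?_)
  exact (integral_convolve_mul hx hC (hh j) (hh' j) t t' l l').symm

omit [IsProbabilityMeasure P] in
-- The trace distance dominates the weighted distance of every single row, and the time shift has
-- modulus one. Finiteness of `∫ tr(A C Aᴴ)` is not assumed: it follows from one approximant at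
-- finite distance from `A`.
lemma TaskADC.IsFilterOutputAt.exists_isSpectralLimit
    (hC : IsJointPSD P x C) {A : ℝ → Matrix (Fin L) (Fin M) ℂ}
    (hA : ∀ l m, AEMeasurable (fun f => A f l m)) {t : ℝ} {Y : Ω → Fin L → ℝ}
    (hY : IsFilterOutputAt P x C A t Y) (l : Fin L) :
    ∃ a : hC.weight.Space, a.val = shiftedRow A t l ∧ IsSpectralLimit hC (fun ω => Y ω l) a := by
  obtain ⟨-, h, hh, hlim, hconv⟩ := hY
  have hAm : ∀ m, AEStronglyMeasurable (fun f => shiftedRow A t l f m) volume := fun m =>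
    (continuous_timeShift t).aestronglyMeasurable.mul (hA l m).aestronglyMeasurable
  have hdm : ∀ j m, AEStronglyMeasurable (fun f =>
      shiftedRow (freqResponse (h j)) t l f m - shiftedRow A t l f m) volume := fun j m =>
    (continuous_shiftedRow_freqResponse (hh j) t l m).aestronglyMeasurable.sub (hAm m)
  have hpt : ∀ j, ∀ᵐ f : ℝ,
      ‖hermForm (C f) (shiftedRow (freqResponse (h j)) t l f - shiftedRow A t l f)
        (shiftedRow (freqResponse (h j)) t l f - shiftedRow A t l f)‖ₑ ≤
      ‖((freqResponse (h j) f - A f) * C f * (freqResponse (h j) f - A f)ᴴ).trace‖ₑ := by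
    intro j
    filter_upwards [hC.posSemidef] with f hf
    have hD := hf.mul_mul_conjTranspose_same (freqResponse (h j) f - A f)
    rw [enorm_le_iff_norm_le]
    have e : shiftedRow (freqResponse (h j)) t l f - shiftedRow A t l f
        = timeShift t f • (freqResponse (h j) f - A f) l := by
      rw [shiftedRow, shiftedRow, ← smul_sub]; rfl
    rw [e, hermForm_smul_left, hermForm_smul_right, norm_mul, norm_mul, norm_star, norm_timeShift,
      one_mul, one_mul, ← mul_mul_conjTranspose_apply]
    refine CStarAlgebra.norm_le_norm_of_nonneg_of_le (ha := hD.diag_nonneg) ?_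
    · rw [Matrix.trace]
      exact Finset.single_le_sum (f := fun i => Matrix.diag ((freqResponse (h j) f - A f) * C f *
        (freqResponse (h j) f - A f)ᴴ) i) (fun i _ => hD.diag_nonneg) (Finset.mem_univ l)
  -- Some approximant is at trace distance below `1`; subtracting the difference from it puts the
  -- row of `A` into the weighted space.
  obtain ⟨j₀, hj₀⟩ := ((tendsto_order.1 hlim).2 1 one_pos).exists
  let d : hC.weight.Space := SpectralWeight.toSpace hC.weight
    (fun f => shiftedRow (freqResponse (h j₀)) t l f - shiftedRow A t l f) (hdm j₀)
    ⟨hC.weight.aestronglyMeasurable_hermForm (hdm j₀) (hdm j₀),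
      (lintegral_mono_ae (hpt j₀)).trans_lt (hj₀.trans ENNReal.one_lt_top)⟩
  have hval : (convolveSpace hC (hh j₀) t l - d).val = shiftedRow A t l := by
    exact sub_sub_cancel (shiftedRow (freqResponse (h j₀)) t l) (shiftedRow A t l)
  refine ⟨convolveSpace hC (hh j₀) t l - d, hval, L, l, t, h, hh, ?_, hconv l⟩
  set a := convolveSpace hC (hh j₀) t l - d with ha
  have hsq : Tendsto (fun j => ENNReal.ofReal (‖convolveSpace hC (hh j) t l - a‖ ^ 2)) atTop
      (𝓝 0) := by
    refine tendsto_of_tendsto_of_tendsto_of_le_of_le tendsto_const_nhds hlim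
      (fun _ => zero_le) fun j => ?_
    simp only
    rw [← SpectralWeight.lintegral_eq]
    refine lintegral_mono_ae ?_
    filter_upwards [hpt j] with f hf
    refine le_trans ?_ hf
    rw [SpectralWeight.val_sub, hval, ← ofReal_norm]
    exact ENNReal.ofReal_le_ofReal (Complex.re_le_norm _)
  rw [tendsto_iff_norm_sub_tendsto_zero]
  have h1 := (ENNReal.tendsto_toReal ENNReal.zero_ne_top).comp hsq
  have h2 := (Real.continuous_sqrt.tendsto _).comp h1
  simp only [ENNReal.toReal_zero, Real.sqrt_zero] at h2
  refine h2.congr fun j => ?_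
  simp [Real.sqrt_sq]

end

/-! ### Filter outputs as functions of the process -/

noncomputable section

variable {Ω : Type*} [MeasurableSpace Ω] {P : Measure Ω} [IsProbabilityMeasure P] {M : ℕ}
  {x : ℝ → Ω → Fin M → ℝ} {C : ℝ → Matrix (Fin M) (Fin M) ℂ}

/-- The σ-algebra generated by the process `x`. -/
abbrev processSigma (x : ℝ → Ω → Fin M → ℝ) : MeasurableSpace Ω :=
  MeasurableSpace.comap (fun ω t => x t ω) MeasurableSpace.pi

namespace TaskADC.IsZeroMeanWSS

omit [IsProbabilityMeasure P] in
lemma measurable_process (hx : IsZeroMeanWSS P x) : Measurable (fun ω t => x t ω) :=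
  measurable_pi_lambda _ fun _ => hx.measurable.comp (measurable_const.prodMk measurable_id)

omit [IsProbabilityMeasure P] in
lemma processSigma_le (hx : IsZeroMeanWSS P x) : processSigma x ≤ ‹MeasurableSpace Ω› :=
  hx.measurable_process.comap_le

omit [MeasurableSpace Ω] in
lemma _root_.measurable_processSigma (t : ℝ) (m : Fin M) :
    Measurable[processSigma x] (fun ω => x t ω m) := by
  have h : Measurable[processSigma x] (fun ω t => x t ω) := comap_measurable _
  exact Measurable.comp (g := fun p : ℝ → Fin M → ℝ => p t m)
    ((measurable_pi_apply m).comp (measurable_pi_apply t)) h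

/-- A convolution integral is a function of the process. -/
lemma aestronglyMeasurable_convTerm_processSigma (hx : IsZeroMeanWSS P x) {h : ℝ → ℝ}
    (hh : Integrable h) (t : ℝ) (m : Fin M) :
    AEStronglyMeasurable[processSigma x] (fun ω => ∫ τ, h τ * x (t - τ) ω m) P := by
  have hc := hx.memLp_convTerm t m hh
  have : Fact (processSigma x ≤ ‹MeasurableSpace Ω›) := ⟨hx.processSigma_le⟩
  suffices hmem : hc.toLp _ ∈ lpMeas ℝ ℝ (processSigma x) 2 P by
    exact (mem_lpMeas_iff_aestronglyMeasurable.1 hmem).congr hc.coeFn_toLp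
  -- Joint measurability of `x` refers to the full σ-algebra, so measurability of the integral with
  -- respect to `processSigma x` is obtained by duality: a vector orthogonal to all `processSigma
  -- x`-measurable ones is orthogonal to each `x s`, hence by Fubini to the integral.
  rw [← Submodule.orthogonal_orthogonal (lpMeas ℝ ℝ (processSigma x) 2 P),
    Submodule.mem_orthogonal]
  intro v hv
  have hvx : ∀ s, ∫ ω, v ω * x s ω m ∂P = 0 := by
    intro s
    have h1 := (Submodule.mem_orthogonal' _ _).1 hv ((hx.memLp s m).toLp _)
      (mem_lpMeas_iff_aestronglyMeasurable.2
        ((measurable_processSigma s m).stronglyMeasurable.aestronglyMeasurable.congr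
          (hx.memLp s m).coeFn_toLp.symm))
    rw [← inner_toLp_toLp (Lp.memLp v) (hx.memLp s m), Lp.toLp_coeFn]
    exact h1
  have hmeas : AEStronglyMeasurable (fun p : ℝ × Ω => v p.2 * (h p.1 * x (t - p.1) p.2 m))
      (volume.prod P) :=
    (Lp.aestronglyMeasurable v).comp_snd.mul (hx.aestronglyMeasurable_convKernel t m hh)
  have hint : Integrable (fun p : ℝ × Ω => v p.2 * (h p.1 * x (t - p.1) p.2 m))
      (volume.prod P) := by
    have hvi : Integrable (fun ω => v ω ^ 2) P := (Lp.memLp v).integrable_sq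
    have hb : ∀ s, ∫ ω, ‖v ω * x s ω m‖ ∂P ≤
        ∫ ω, v ω ^ 2 ∂P + ∫ ω, x 0 ω m * x 0 ω m ∂P := by
      intro s
      have h1 := hx.integral_mul_eq s s m m
      rw [sub_self] at h1
      rw [← h1, ← integral_add hvi (hx.integrable_mul _ _ _ _)]
      refine integral_mono ((Lp.memLp v).integrable_mul (hx.memLp s m)).norm
        (hvi.add (hx.integrable_mul _ _ _ _)) fun ω => ?_
      simp only [Real.norm_eq_abs]
      rw [abs_le]
      constructor <;> nlinarith [sq_nonneg (v ω + x s ω m), sq_nonneg (v ω - x s ω m),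
        sq_nonneg (v ω), sq_nonneg (x s ω m)]
    have hform : ∀ τ ω, v ω * (h τ * x (t - τ) ω m) = h τ * (v ω * x (t - τ) ω m) :=
      fun τ ω => by ring
    rw [integrable_prod_iff hmeas]
    refine ⟨Eventually.of_forall fun τ => ?_, ?_⟩
    · simp only [hform]
      exact ((Lp.memLp v).integrable_mul (hx.memLp _ m)).const_mul _
    · refine (hh.norm.mul_const (∫ ω, v ω ^ 2 ∂P + ∫ ω, x 0 ω m * x 0 ω m ∂P)).mono'
        hmeas.norm.integral_prod_right' (Eventually.of_forall fun τ => ?_)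
      rw [Real.norm_of_nonneg (by positivity)]
      simp only [hform]
      simp only [norm_mul (h _), integral_const_mul]
      exact mul_le_mul_of_nonneg_left (hb _) (norm_nonneg _)
  rw [← Lp.toLp_coeFn v (Lp.memLp v), inner_toLp_toLp (Lp.memLp v) hc]
  have hswap := integral_integral_swap (f := fun τ ω => v ω * (h τ * x (t - τ) ω m)) hint
  simp only [integral_const_mul] at hswap
  rw [← hswap]
  refine integral_eq_zero_of_ae (Eventually.of_forall fun τ => ?_)
  have : ∀ ω, v ω * (h τ * x (t - τ) ω m) = h τ * (v ω * x (t - τ) ω m) := fun ω => by ring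
  simp only [this, integral_const_mul, hvx, mul_zero, Pi.zero_apply]

end TaskADC.IsZeroMeanWSS

omit [IsProbabilityMeasure P] in
lemma aestronglyMeasurable_fun_sum_of_le {m : MeasurableSpace Ω} {ι : Type*} (s : Finset ι)
    {f : ι → Ω → ℝ} (hf : ∀ i ∈ s, AEStronglyMeasurable[m] (f i) P) :
    AEStronglyMeasurable[m] (fun ω => ∑ i ∈ s, f i ω) P := by
  classical
  induction s using Finset.induction_on with
  | empty => simpa using stronglyMeasurable_const.aestronglyMeasurable
  | insert i s hi ih =>
    simp only [Finset.sum_insert hi]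
    exact (hf i (Finset.mem_insert_self i s)).add
      (ih fun j hj => hf j (Finset.mem_insert_of_mem hj))

/-- The square-integrable functions of the process form a closed subspace, so measurability passes
from the convolutions to their mean-square limit. -/
lemma IsSpectralLimit.aestronglyMeasurable_processSigma (hx : IsZeroMeanWSS P x)
    {hC : IsJointPSD P x C} {U : Ω → ℝ} {a : hC.weight.Space} (ha : IsSpectralLimit hC U a)
    (hU : MemLp U 2 P) : AEStronglyMeasurable[processSigma x] U P := by
  obtain ⟨L, l, t, h, hh, -, h2⟩ := ha
  have hlim := tendsto_toLp (fun j => hx.memLp_convolve (hh j) t l) hU h2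
  have hmem := (isClosed_aestronglyMeasurable (F := ℝ) (p := 2) (μ := P)
    hx.processSigma_le).mem_of_tendsto hlim (Eventually.of_forall fun j => by
      refine AEStronglyMeasurable.congr ?_ (hx.memLp_convolve (hh j) t l).coeFn_toLp.symm
      exact aestronglyMeasurable_fun_sum_of_le _ fun m _ =>
        hx.aestronglyMeasurable_convTerm_processSigma (hh j l m) t m)
  exact AEStronglyMeasurable.congr hmem hU.coeFn_toLp

end

/-! ### Moments of the dithered quantizer -/

noncomputable section

/-- The uniform mid-rise quantizer with unlimited range. -/
def midRiseUnbounded (Δ u : ℝ) : ℝ := Δ * ((⌊u / Δ⌋ : ℝ) + 1 / 2)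

@[fun_prop]
lemma measurable_midRiseUnbounded (Δ : ℝ) : Measurable (midRiseUnbounded Δ) := by
  unfold midRiseUnbounded
  refine measurable_const.mul (Measurable.add_const ?_ _)
  exact (measurable_from_top (f := fun n : ℤ => (n : ℝ))).comp
    (Int.measurable_floor.comp (measurable_id.div_const Δ))

lemma midRise_eq {γ : ℝ} {b : ℕ} {u : ℝ} (h : |u| < γ) :
    midRise γ b u = midRiseUnbounded (stepSize γ b) u := by
  simp [midRise, midRiseUnbounded, h]

/-- The constant is crude; only boundedness of the error matters, for square integrability. -/
lemma abs_midRiseUnbounded_sub_le {Δ : ℝ} (hΔ : 0 < Δ) (u : ℝ) :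
    |midRiseUnbounded Δ u - u| ≤ Δ := by
  have h1 := Int.floor_le (u / Δ)
  have h2 := Int.lt_floor_add_one (u / Δ)
  rw [le_div_iff₀ hΔ] at h1
  rw [div_lt_iff₀ hΔ] at h2
  rw [midRiseUnbounded, abs_le]
  constructor <;> nlinarith

/-- The triangular law of width `2 Δ`. -/
def ditherMeasure (Δ : ℝ) : Measure ℝ :=
  volume.withDensity (fun u => ENNReal.ofReal (ditherPDF Δ u))

lemma ditherPDF_nonneg {Δ : ℝ} (hΔ : 0 < Δ) (u : ℝ) : 0 ≤ ditherPDF Δ u := by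
  unfold ditherPDF
  split_ifs with h
  · have : |u| / Δ ≤ 1 := (div_le_one hΔ).2 h
    have : 0 ≤ 1 - |u| / Δ := by linarith
    positivity
  · exact le_rfl

lemma measurable_ditherPDF (Δ : ℝ) : Measurable (ditherPDF Δ) := by
  unfold ditherPDF
  refine Measurable.ite ?_ (by fun_prop) measurable_const
  exact measurableSet_le (by fun_prop) measurable_const

lemma integral_ditherMeasure {Δ : ℝ} (hΔ : 0 < Δ) (g : ℝ → ℝ) :
    ∫ u, g u ∂(ditherMeasure Δ) = ∫ u in (-Δ)..Δ, ditherPDF Δ u * g u := by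
  rw [ditherMeasure, integral_withDensity_eq_integral_toReal_smul
    (measurable_ditherPDF Δ).ennreal_ofReal (Eventually.of_forall fun _ => ENNReal.ofReal_lt_top),
    intervalIntegral.integral_of_le (by linarith), ← integral_Icc_eq_integral_Ioc,
    ← integral_indicator measurableSet_Icc]
  refine integral_congr_ae (Eventually.of_forall fun u => ?_)
  simp only [ENNReal.toReal_ofReal (ditherPDF_nonneg hΔ u), smul_eq_mul]
  by_cases hu : u ∈ Set.Icc (-Δ) Δ
  · rw [Set.indicator_of_mem hu]
  · rw [Set.indicator_of_notMem hu, ditherPDF, if_neg (by rwa [abs_le]), zero_mul]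

/-- Asking for the formula on the open interval only keeps the jumps of the quantizer at the end
points out of the way. -/
lemma intervalIntegral_of_eqOn_affine {g : ℝ → ℝ} {α β A B : ℝ} (hαβ : α ≤ β)
    (h : ∀ u ∈ Set.Ioo α β, g u = A + B * u) :
    IntervalIntegrable g volume α β ∧
      ∫ u in α..β, g u = A * (β - α) + B * ((β ^ 2 - α ^ 2) / 2) := by
  have hc : Continuous fun u : ℝ => A + B * u := by fun_prop
  have h0 : ∀ᵐ u ∂(volume.restrict (Set.Ioc α β)), A + B * u = g u := by
    rw [← Measure.restrict_congr_set Ioo_ae_eq_Ioc]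
    exact (ae_restrict_iff' measurableSet_Ioo).2 (Eventually.of_forall fun u hu => (h u hu).symm)
  constructor
  · rw [intervalIntegrable_iff_integrableOn_Ioc_of_le hαβ]
    exact ((intervalIntegrable_iff_integrableOn_Ioc_of_le hαβ).1
      (hc.intervalIntegrable α β)).congr h0
  · rw [intervalIntegral.integral_of_le hαβ, ← integral_congr_ae h0,
      ← intervalIntegral.integral_of_le hαβ, intervalIntegral.integral_add
      (by simp) (by exact (continuous_const.mul continuous_id).intervalIntegrable _ _)]
    rw [intervalIntegral.integral_const, intervalIntegral.integral_const_mul, integral_id,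
      smul_eq_mul]
    ring

lemma midRiseUnbounded_eq {Δ : ℝ} (hΔ : 0 < Δ) {u : ℝ} {j : ℤ} (h1 : j * Δ ≤ u)
    (h2 : u < (j + 1) * Δ) : midRiseUnbounded Δ u = Δ * (j + 1 / 2) := by
  rw [midRiseUnbounded, Int.floor_eq_iff.2 ⟨(le_div_iff₀ hΔ).2 h1, (div_lt_iff₀ hΔ).2 h2⟩]

/-- The law of the dithered quantizer output for a fixed input. -/
lemma integral_midRiseUnbounded_dither {Δ : ℝ} (hΔ : 0 < Δ) (a : ℝ) (φ : ℝ → ℝ) :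
    ∫ u, φ (midRiseUnbounded Δ (a + u)) ∂(ditherMeasure Δ) =
      φ (Δ * (⌊a / Δ⌋ - 1 / 2)) * ((1 - Int.fract (a / Δ)) ^ 2 / 2)
      + φ (Δ * (⌊a / Δ⌋ + 1 / 2)) * (1 / 2 + Int.fract (a / Δ) - Int.fract (a / Δ) ^ 2)
      + φ (Δ * (⌊a / Δ⌋ + 3 / 2)) * (Int.fract (a / Δ) ^ 2 / 2) := by
  set j := ⌊a / Δ⌋ with hj
  set θ := Int.fract (a / Δ) with hθ
  have hθ0 : 0 ≤ θ := Int.fract_nonneg _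
  have hθ1 : θ < 1 := Int.fract_lt_one _
  have ha : a = Δ * (j + θ) := by
    rw [hj, hθ, Int.floor_add_fract]; field_simp
  have hθΔ : 0 ≤ θ * Δ := by positivity
  have hθΔ' : θ * Δ < Δ := by nlinarith
  rw [integral_ditherMeasure hΔ]
  have hneg : ∀ u, -Δ < u → u ≤ 0 → ditherPDF Δ u = 1 / Δ * (1 + u / Δ) := fun u h1 h2 => by
    rw [ditherPDF, if_pos (by rw [abs_le]; constructor <;> linarith), abs_of_nonpos h2]; ring
  have hpos : ∀ u, u < Δ → 0 ≤ u → ditherPDF Δ u = 1 / Δ * (1 - u / Δ) := fun u h1 h2 => by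
    rw [ditherPDF, if_pos (by rw [abs_le]; constructor <;> linarith), abs_of_nonneg h2]
  -- The density has its kink at `0`, and the output cell of `a + u` changes at `u = -θΔ` and `u = Δ
  -- - θΔ`. These points cut the support into four pieces on which the integrand is affine; the two
  -- middle ones share a cell.
  obtain ⟨i1, e1⟩ := intervalIntegral_of_eqOn_affine
    (g := fun u => ditherPDF Δ u * φ (midRiseUnbounded Δ (a + u))) (α := -Δ) (β := -(θ * Δ))
    (A := 1 / Δ * φ (Δ * (j - 1 / 2))) (B := 1 / Δ ^ 2 * φ (Δ * (j - 1 / 2)))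
    (by linarith) (fun u hu => by
      rw [hneg u hu.1 (by linarith [hu.2]), midRiseUnbounded_eq hΔ (j := j - 1)
        (by push_cast; nlinarith [hu.1]) (by push_cast; nlinarith [hu.2])]
      rw [show Δ * (((j - 1 : ℤ) : ℝ) + 1 / 2) = Δ * (j - 1 / 2) by push_cast; ring]
      field_simp)
  obtain ⟨i2, e2⟩ := intervalIntegral_of_eqOn_affine
    (g := fun u => ditherPDF Δ u * φ (midRiseUnbounded Δ (a + u))) (α := -(θ * Δ)) (β := 0)
    (A := 1 / Δ * φ (Δ * (j + 1 / 2))) (B := 1 / Δ ^ 2 * φ (Δ * (j + 1 / 2)))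
    (by linarith) (fun u hu => by
      rw [hneg u (by linarith [hu.1]) hu.2.le, midRiseUnbounded_eq hΔ (j := j)
        (by nlinarith [hu.1]) (by nlinarith [hu.2])]
      field_simp)
  obtain ⟨i3, e3⟩ := intervalIntegral_of_eqOn_affine
    (g := fun u => ditherPDF Δ u * φ (midRiseUnbounded Δ (a + u))) (α := 0) (β := Δ - θ * Δ)
    (A := 1 / Δ * φ (Δ * (j + 1 / 2))) (B := -(1 / Δ ^ 2 * φ (Δ * (j + 1 / 2))))
    (by linarith) (fun u hu => by
      rw [hpos u (by linarith [hu.2]) hu.1.le, midRiseUnbounded_eq hΔ (j := j)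
        (by nlinarith [hu.1]) (by nlinarith [hu.2])]
      field_simp; ring)
  obtain ⟨i4, e4⟩ := intervalIntegral_of_eqOn_affine
    (g := fun u => ditherPDF Δ u * φ (midRiseUnbounded Δ (a + u))) (α := Δ - θ * Δ) (β := Δ)
    (A := 1 / Δ * φ (Δ * (j + 3 / 2))) (B := -(1 / Δ ^ 2 * φ (Δ * (j + 3 / 2))))
    (by linarith) (fun u hu => by
      rw [hpos u hu.2 (by linarith [hu.1]), midRiseUnbounded_eq hΔ (j := j + 1)
        (by push_cast; nlinarith [hu.1]) (by push_cast; nlinarith [hu.2])]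
      rw [show Δ * (((j + 1 : ℤ) : ℝ) + 1 / 2) = Δ * (j + 3 / 2) by push_cast; ring]
      field_simp; ring)
  rw [← intervalIntegral.integral_add_adjacent_intervals ((i1.trans i2).trans i3) i4,
    ← intervalIntegral.integral_add_adjacent_intervals (i1.trans i2) i3,
    ← intervalIntegral.integral_add_adjacent_intervals i1 i2, e1, e2, e3, e4]
  generalize φ (Δ * (j - 1 / 2)) = x1
  generalize φ (Δ * (j + 1 / 2)) = x2
  generalize φ (Δ * (j + 3 / 2)) = x3
  field_simp
  ring

/-- The output takes three consecutive cell midpoints; weighted by the three probabilities, their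
average is exactly `a`. -/
lemma integral_midRiseUnbounded_sub {Δ : ℝ} (hΔ : 0 < Δ) (a : ℝ) :
    ∫ u, (midRiseUnbounded Δ (a + u) - a) ∂(ditherMeasure Δ) = 0 := by
  have h := integral_midRiseUnbounded_dither hΔ a (fun v => v - a)
  have ha : a = Δ * (⌊a / Δ⌋ + Int.fract (a / Δ)) := by
    rw [Int.floor_add_fract]; field_simp
  rw [h]
  generalize (⌊a / Δ⌋ : ℝ) = j at *
  generalize Int.fract (a / Δ) = θ at *
  subst ha; ring

/-- The dependence on the fractional part cancels in the three-point law. Triangular dither is used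
for this reason: the error power does not depend on the input. -/
lemma integral_midRiseUnbounded_sub_sq {Δ : ℝ} (hΔ : 0 < Δ) (a : ℝ) :
    ∫ u, (midRiseUnbounded Δ (a + u) - a) ^ 2 ∂(ditherMeasure Δ) = Δ ^ 2 / 4 := by
  have h := integral_midRiseUnbounded_dither hΔ a (fun v => (v - a) ^ 2)
  have ha : a = Δ * (⌊a / Δ⌋ + Int.fract (a / Δ)) := by
    rw [Int.floor_add_fract]; field_simp
  rw [h]
  generalize (⌊a / Δ⌋ : ℝ) = j at *
  generalize Int.fract (a / Δ) = θ at *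
  subst ha; ring

lemma ae_abs_le_ditherMeasure (Δ : ℝ) : ∀ᵐ u ∂(ditherMeasure Δ), |u| ≤ Δ := by
  rw [ditherMeasure, ae_withDensity_iff (measurable_ditherPDF Δ).ennreal_ofReal]
  refine Eventually.of_forall fun u hu => ?_
  by_contra h
  exact hu (by simp [ditherPDF, h])

section Probability

variable {Ω : Type*} [MeasurableSpace Ω] {P : Measure Ω} [IsProbabilityMeasure P] {Δ : ℝ}
  {A Y W : Ω → ℝ}

omit [IsProbabilityMeasure P] in
lemma ae_abs_midRiseUnbounded_sub_le (hΔ : 0 < Δ) (hW : AEMeasurable W P)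
    (hlaw : P.map W = ditherMeasure Δ) (Y : Ω → ℝ) :
    ∀ᵐ ω ∂P, |midRiseUnbounded Δ (Y ω + W ω) - Y ω| ≤ 2 * Δ := by
  have h := ae_abs_le_ditherMeasure Δ
  rw [← hlaw] at h
  filter_upwards [ae_of_ae_map hW h] with ω hω
  have h1 := abs_midRiseUnbounded_sub_le hΔ (Y ω + W ω)
  calc _ = |(midRiseUnbounded Δ (Y ω + W ω) - (Y ω + W ω)) + W ω| := by congr 1; ring
    _ ≤ _ := abs_add_le _ _
    _ ≤ _ := by linarith

lemma memLp_midRiseUnbounded_sub (hΔ : 0 < Δ) (hY : AEMeasurable Y P) (hW : AEMeasurable W P)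
    (hlaw : P.map W = ditherMeasure Δ) :
    MemLp (fun ω => midRiseUnbounded Δ (Y ω + W ω) - Y ω) 2 P := by
  refine MemLp.of_bound (AEMeasurable.aestronglyMeasurable ?_) (2 * Δ)
    (ae_abs_midRiseUnbounded_sub_le hΔ hW hlaw Y)
  exact ((measurable_midRiseUnbounded Δ).comp_aemeasurable (hY.add hW)).sub hY

/-- The quantization error of a dithered quantizer is uncorrelated with everything that is
independent of the dither. -/
lemma integral_mul_midRiseUnbounded_sub (hΔ : 0 < Δ) (hA : MemLp A 2 P) (hY : AEMeasurable Y P)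
    (hW : AEMeasurable W P) (hlaw : P.map W = ditherMeasure Δ)
    (hind : IndepFun (fun ω => (A ω, Y ω)) W P) :
    ∫ ω, A ω * (midRiseUnbounded Δ (Y ω + W ω) - Y ω) ∂P = 0 := by
  have hAY : AEMeasurable (fun ω => (A ω, Y ω)) P := hA.aestronglyMeasurable.aemeasurable.prodMk hY
  have hmap := (indepFun_iff_map_prod_eq_prod_map_map hAY hW).1 hind
  have hG : Measurable (fun p : (ℝ × ℝ) × ℝ => p.1.1 * (midRiseUnbounded Δ (p.1.2 + p.2) - p.1.2)) := by
    fun_prop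
  have hint : Integrable (fun p : (ℝ × ℝ) × ℝ =>
      p.1.1 * (midRiseUnbounded Δ (p.1.2 + p.2) - p.1.2))
      ((P.map (fun ω => (A ω, Y ω))).prod (P.map W)) := by
    rw [← hmap, integrable_map_measure hG.aestronglyMeasurable (hAY.prodMk hW)]
    exact hA.integrable_mul (memLp_midRiseUnbounded_sub hΔ hY hW hlaw)
  have e : ∫ ω, A ω * (midRiseUnbounded Δ (Y ω + W ω) - Y ω) ∂P
      = ∫ p, (fun p : (ℝ × ℝ) × ℝ => p.1.1 * (midRiseUnbounded Δ (p.1.2 + p.2) - p.1.2)) p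
        ∂(P.map (fun ω => ((A ω, Y ω), W ω))) :=
    (integral_map (hAY.prodMk hW) hG.aestronglyMeasurable).symm
  have : IsProbabilityMeasure (P.map W) := Measure.isProbabilityMeasure_map hW
  -- Under the product law, integrating the dither first leaves the conditional mean error, which is
  -- zero for every input.
  rw [e, hmap, integral_prod _ hint]
  refine integral_eq_zero_of_ae (Eventually.of_forall fun p => ?_)
  simp only [integral_const_mul, hlaw, integral_midRiseUnbounded_sub hΔ, mul_zero, Pi.zero_apply]

lemma integral_midRiseUnbounded_sub_sq_eq (hΔ : 0 < Δ) (hY : AEMeasurable Y P)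
    (hW : AEMeasurable W P) (hlaw : P.map W = ditherMeasure Δ) (hind : IndepFun Y W P) :
    ∫ ω, (midRiseUnbounded Δ (Y ω + W ω) - Y ω) ^ 2 ∂P = Δ ^ 2 / 4 := by
  have hmap := (indepFun_iff_map_prod_eq_prod_map_map hY hW).1 hind
  have hG : Measurable (fun p : ℝ × ℝ => (midRiseUnbounded Δ (p.1 + p.2) - p.1) ^ 2) := by
    fun_prop
  have hint : Integrable (fun p : ℝ × ℝ => (midRiseUnbounded Δ (p.1 + p.2) - p.1) ^ 2)
      ((P.map Y).prod (P.map W)) := by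
    rw [← hmap, integrable_map_measure hG.aestronglyMeasurable (hY.prodMk hW)]
    exact (memLp_midRiseUnbounded_sub hΔ hY hW hlaw).integrable_sq
  have e : ∫ ω, (midRiseUnbounded Δ (Y ω + W ω) - Y ω) ^ 2 ∂P
      = ∫ p, (fun p : ℝ × ℝ => (midRiseUnbounded Δ (p.1 + p.2) - p.1) ^ 2) p
        ∂(P.map (fun ω => (Y ω, W ω))) :=
    (integral_map (hY.prodMk hW) hG.aestronglyMeasurable).symm
  have : IsProbabilityMeasure (P.map W) := Measure.isProbabilityMeasure_map hW
  have : IsProbabilityMeasure (P.map Y) := Measure.isProbabilityMeasure_map hY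
  rw [e, hmap, integral_prod _ hint]
  simp only [hlaw, integral_midRiseUnbounded_sub_sq hΔ, integral_const, probReal_univ,
    one_smul]

end Probability

end

/-! ### Correlations of the quantized samples -/

noncomputable section

variable {Ω : Type*} [MeasurableSpace Ω] {P : Measure Ω} [IsProbabilityMeasure P]

omit [IsProbabilityMeasure P] in
/-- Pairs of functions of `V` are independent of everything that is independent of `V`. -/
lemma ProbabilityTheory.IndepFun.prodMk_of_aestronglyMeasurable_comap {β : Type*}
    [mβ : MeasurableSpace β] {V : Ω → β} {A Y W : Ω → ℝ} (h : IndepFun V W P)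
    (hA : AEStronglyMeasurable[mβ.comap V] A P) (hY : AEStronglyMeasurable[mβ.comap V] Y P) :
    IndepFun (fun ω => (A ω, Y ω)) W P := by
  have hm : Measurable[mβ.comap V] (fun ω => (hA.mk A ω, hY.mk Y ω)) :=
    hA.stronglyMeasurable_mk.measurable.prodMk hY.stronglyMeasurable_mk.measurable
  have h1 : IndepFun (fun ω => (hA.mk A ω, hY.mk Y ω)) W P := by
    rw [IndepFun_iff_Indep] at h ⊢
    exact indep_of_indep_of_le_left h hm.comap_le
  refine h1.congr ?_ EventuallyEq.rfl
  filter_upwards [hA.ae_eq_mk, hY.ae_eq_mk] with ω h2 h3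
  rw [h2, h3]

/-- The hypotheses say that the joint law of the three variables is a product of three laws; the
conclusion is the other bracketing. -/
lemma ProbabilityTheory.IndepFun.prodMk_left_of_indepFun_prodMk {β γ δ : Type*}
    [MeasurableSpace β] [MeasurableSpace γ] [MeasurableSpace δ] {U : Ω → β} {V : Ω → γ}
    {X : Ω → δ} (hU : Measurable U) (hV : Measurable V) (hX : Measurable X)
    (hUV : IndepFun U V P) (h : IndepFun (fun ω => (U ω, V ω)) X P) :
    IndepFun (fun ω => (V ω, X ω)) U P := by
  have hVX : IndepFun V X P := h.comp (φ := Prod.snd) (ψ := id) measurable_snd measurable_id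
  refine IndepFun.symm ?_
  have : IsProbabilityMeasure (P.map U) := Measure.isProbabilityMeasure_map hU.aemeasurable
  have : IsProbabilityMeasure (P.map V) := Measure.isProbabilityMeasure_map hV.aemeasurable
  have : IsProbabilityMeasure (P.map X) := Measure.isProbabilityMeasure_map hX.aemeasurable
  rw [indepFun_iff_map_prod_eq_prod_map_map hU.aemeasurable (hV.prodMk hX).aemeasurable,
    (indepFun_iff_map_prod_eq_prod_map_map hV.aemeasurable hX.aemeasurable).1 hVX,
    ← Measure.prodAssoc_prod, ← (indepFun_iff_map_prod_eq_prod_map_map hU.aemeasurable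
      hV.aemeasurable).1 hUV, ← (indepFun_iff_map_prod_eq_prod_map_map
      (hU.prodMk hV).aemeasurable hX.aemeasurable).1 h,
    Measure.map_map MeasurableEquiv.prodAssoc.measurable ((hU.prodMk hV).prodMk hX)]
  rfl

variable {M K : ℕ} {x : ℝ → Ω → Fin M → ℝ} {Δ : ℝ} {w : ℤ → Ω → Fin K → ℝ}

namespace TaskADC.IsDither

omit [IsProbabilityMeasure P] in
lemma indepFun_of_indepFun {β : Type*} [MeasurableSpace β] {V : Ω → β}
    (h : IndepFun (fun ω n => w n ω) V P) (p : ℤ × Fin K) :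
    IndepFun V (fun ω => w p.1 ω p.2) P :=
  (h.comp (φ := fun u : ℤ → Fin K → ℝ => u p.1 p.2) (ψ := id)
    ((measurable_pi_apply p.2).comp (measurable_pi_apply p.1)) measurable_id).symm

lemma indepFun_prodMk (hw : IsDither P Δ x w) (hx : IsZeroMeanWSS P x) {p q : ℤ × Fin K}
    (hpq : p ≠ q) :
    IndepFun (fun ω => (w q.1 ω q.2, fun t => x t ω)) (fun ω => w p.1 ω p.2) P := by
  refine IndepFun.prodMk_left_of_indepFun_prodMk (hw.measurable _ _) (hw.measurable _ _)
    hx.measurable_process (hw.indep.indepFun hpq) ?_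
  exact hw.indep_input.comp (φ := fun u : ℤ → Fin K → ℝ => (u p.1 p.2, u q.1 q.2)) (ψ := id)
    (((measurable_pi_apply p.2).comp (measurable_pi_apply p.1)).prodMk
    ((measurable_pi_apply q.2).comp (measurable_pi_apply q.1))) measurable_id

/-- The output of a dithered quantizer without overload. -/
def quantized (Δ : ℝ) (w : ℤ → Ω → Fin K → ℝ) (Y : ℤ × Fin K → Ω → ℝ) (p : ℤ × Fin K) (ω : Ω) : ℝ :=
  midRiseUnbounded Δ (Y p ω + w p.1 ω p.2)

variable {Y : ℤ × Fin K → Ω → ℝ}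

lemma memLp_quantized_sub (hw : IsDither P Δ x w) (hΔ : 0 < Δ) {p : ℤ × Fin K}
    (hY : MemLp (Y p) 2 P) : MemLp (fun ω => quantized Δ w Y p ω - Y p ω) 2 P :=
  memLp_midRiseUnbounded_sub hΔ hY.aestronglyMeasurable.aemeasurable
    (hw.measurable _ _).aemeasurable (hw.law _ _)

lemma memLp_quantized (hw : IsDither P Δ x w) (hΔ : 0 < Δ) {p : ℤ × Fin K}
    (hY : MemLp (Y p) 2 P) : MemLp (quantized Δ w Y p) 2 P := by
  have := (hw.memLp_quantized_sub hΔ hY).add hY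
  refine this.ae_eq (Eventually.of_forall fun ω => ?_)
  simp

/-- Dithered quantization preserves correlations with functions of `V` when the dither is
independent of `V`. -/
lemma integral_mul_quantized (hw : IsDither P Δ x w) (hΔ : 0 < Δ) {β : Type*}
    [mβ : MeasurableSpace β] {V : Ω → β} {p : ℤ × Fin K}
    (hV : IndepFun V (fun ω => w p.1 ω p.2) P) {A : Ω → ℝ} (hA : MemLp A 2 P)
    (hAm : AEStronglyMeasurable[mβ.comap V] A P) (hY : MemLp (Y p) 2 P)
    (hYm : AEStronglyMeasurable[mβ.comap V] (Y p) P) :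
    ∫ ω, A ω * quantized Δ w Y p ω ∂P = ∫ ω, A ω * Y p ω ∂P := by
  have h := integral_mul_midRiseUnbounded_sub hΔ hA hY.aestronglyMeasurable.aemeasurable
    (hw.measurable p.1 p.2).aemeasurable (hw.law _ _)
    (hV.prodMk_of_aestronglyMeasurable_comap hAm hYm)
  have h2 : ∀ ω, A ω * (midRiseUnbounded Δ (Y p ω + w p.1 ω p.2) - Y p ω)
      = A ω * quantized Δ w Y p ω - A ω * Y p ω := fun ω => by rw [quantized]; ring
  simp only [h2] at h
  rw [integral_sub (f := fun ω => A ω * quantized Δ w Y p ω) (g := fun ω => A ω * Y p ω)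
    (hA.integrable_mul (hw.memLp_quantized hΔ hY)) (hA.integrable_mul hY)] at h
  linarith

/-- On the diagonal, expand the squared error and use that quantization preserves the correlation
with `Y p`. Off the diagonal, the dither at `q` is independent of the pair formed by the dither at
`p` and the process, of which the output at `p` is a function; so the two outputs can be replaced by
their inputs one after the other. -/
lemma integral_quantized_mul_quantized (hw : IsDither P Δ x w) (hx : IsZeroMeanWSS P x)
    (hΔ : 0 < Δ) (hY : ∀ p, MemLp (Y p) 2 P)
    (hYm : ∀ p, AEStronglyMeasurable[processSigma x] (Y p) P) (p q : ℤ × Fin K) :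
    ∫ ω, quantized Δ w Y p ω * quantized Δ w Y q ω ∂P
      = ∫ ω, Y p ω * Y q ω ∂P + if p = q then Δ ^ 2 / 4 else 0 := by
  have hX := indepFun_of_indepFun hw.indep_input
  split_ifs with hpq
  · subst hpq
    have h1 := hw.integral_mul_quantized hΔ (hX p) (hY p) (hYm p) (hY p) (hYm p)
    have h2 := integral_midRiseUnbounded_sub_sq_eq hΔ (hY p).aestronglyMeasurable.aemeasurable
      (hw.measurable p.1 p.2).aemeasurable (hw.law _ _)
      (((hX p).prodMk_of_aestronglyMeasurable_comap (hYm p) (hYm p)).comp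
        (φ := Prod.fst) (ψ := id) measurable_fst measurable_id)
    change ∫ ω, (quantized Δ w Y p ω - Y p ω) ^ 2 ∂P = _ at h2
    have hZ := hw.memLp_quantized hΔ (hY p)
    have h3 : ∀ ω, (quantized Δ w Y p ω - Y p ω) ^ 2 = quantized Δ w Y p ω * quantized Δ w Y p ω
        - 2 * (Y p ω * quantized Δ w Y p ω) + Y p ω * Y p ω := fun ω => by ring
    simp only [h3] at h2
    rw [integral_add, integral_sub, integral_const_mul, h1] at h2
    · linarith
    · exact hZ.integrable_mul hZ
    · exact ((hY p).integrable_mul hZ).const_mul 2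
    · exact (hZ.integrable_mul hZ).sub (((hY p).integrable_mul hZ).const_mul 2)
    · exact (hY p).integrable_mul (hY p)
  · have hle : processSigma x ≤ MeasurableSpace.comap (fun ω => (w p.1 ω p.2, fun t => x t ω))
        inferInstance := by
      rw [processSigma, show (fun ω t => x t ω) = Prod.snd ∘ (fun ω => (w p.1 ω p.2, fun t => x t ω))
        from rfl, ← MeasurableSpace.comap_comp]
      exact MeasurableSpace.comap_mono measurable_snd.comap_le
    have hYm' : ∀ r, AEStronglyMeasurable[MeasurableSpace.comap
        (fun ω => (w p.1 ω p.2, fun t => x t ω)) inferInstance] (Y r) P := fun r =>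
      (hYm r).mono hle
    have hWm : Measurable[MeasurableSpace.comap
        (fun ω => (w p.1 ω p.2, fun t => x t ω)) inferInstance] (fun ω => w p.1 ω p.2) :=
      Measurable.comp (g := (Prod.fst : ℝ × (ℝ → Fin M → ℝ) → ℝ)) measurable_fst (comap_measurable _)
    have hZm : AEStronglyMeasurable[MeasurableSpace.comap
        (fun ω => (w p.1 ω p.2, fun t => x t ω)) inferInstance] (quantized Δ w Y p) P := by
      refine ⟨fun ω => midRiseUnbounded Δ ((hYm' p).mk (Y p) ω + w p.1 ω p.2), ?_, ?_⟩
      · exact ((measurable_midRiseUnbounded Δ).comp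
          ((hYm' p).stronglyMeasurable_mk.measurable.add hWm)).stronglyMeasurable
      · filter_upwards [(hYm' p).ae_eq_mk] with ω hω
        rw [quantized, hω]
    rw [hw.integral_mul_quantized hΔ (hw.indepFun_prodMk hx (Ne.symm hpq))
      (hw.memLp_quantized hΔ (hY p)) hZm (hY q) (hYm' q)]
    have h1 := hw.integral_mul_quantized hΔ (hX p) (hY q) (hYm q) (hY p) (hYm p)
    rw [add_zero]
    simpa only [mul_comm] using h1

end TaskADC.IsDither

end

/-! ### Folding integrals over the line into the band -/

noncomputable section

section Tsum

variable {α : Type*} [MeasurableSpace α] {μ : Measure α} {ι : Type*} [Countable ι]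
  {F : ι → α → ℂ}

lemma lintegral_tsum_enorm_ne_top (hF : ∀ i, Integrable (F i) μ)
    (hs : Summable fun i => ∫ a, ‖F i a‖ ∂μ) : ∫⁻ a, ∑' i, ‖F i a‖ₑ ∂μ ≠ ⊤ := by
  rw [lintegral_tsum fun i => (hF i).aestronglyMeasurable.enorm]
  simp only [← ofReal_integral_norm_eq_lintegral_enorm (hF _)]
  exact hs.tsum_ofReal_ne_top

lemma ae_summable_of_summable_integral_norm (hF : ∀ i, Integrable (F i) μ)
    (hs : Summable fun i => ∫ a, ‖F i a‖ ∂μ) : ∀ᵐ a ∂μ, Summable fun i => F i a := by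
  have h := ae_lt_top' (AEMeasurable.tsum fun i =>
    (hF i).aestronglyMeasurable.enorm) (lintegral_tsum_enorm_ne_top hF hs)
  filter_upwards [h] with a ha
  refine Summable.of_norm ?_
  have := ENNReal.summable_toReal ha.ne
  simpa using this

lemma integrable_tsum_of_summable_integral_norm (hF : ∀ i, Integrable (F i) μ)
    (hs : Summable fun i => ∫ a, ‖F i a‖ ∂μ) : Integrable (fun a => ∑' i, F i a) μ := by
  refine ⟨?_, ?_⟩
  · refine aestronglyMeasurable_of_tendsto_ae (u := (atTop : Filter (Finset ι)))
      (f := fun s a => ∑ i ∈ s, F i a)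
      (fun s => Finset.aestronglyMeasurable_fun_sum s fun i _ => (hF i).aestronglyMeasurable) ?_
    filter_upwards [ae_summable_of_summable_integral_norm hF hs] with a ha
    exact ha.hasSum
  · refine lt_of_le_of_lt (lintegral_mono fun a => ?_) (lintegral_tsum_enorm_ne_top hF hs).lt_top
    exact enorm_tsum_le_tsum_enorm

end Tsum

section Folding

lemma Ioc_band_eq (fs : ℝ) :
    Set.Ioc (-(fs / 2)) (fs / 2) = Set.Ioc (-(fs / 2)) (-(fs / 2) + fs) := by
  congr 1; ring

variable {fs : ℝ} (hfs : 0 < fs) {F : ℝ → ℂ} (hF : Integrable F)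
include hfs

/-- Translates of a half-open interval of length `fs` tile the line. The reflection of the index
reflects that the aliases are shifted by `-k fs`. -/
lemma hasSum_setIntegral_shift {E : Type*} [NormedAddCommGroup E] [NormedSpace ℝ E] {G : ℝ → E}
    (hG : Integrable G) (a : ℝ) :
    HasSum (fun k : ℤ => ∫ f in Set.Ioc a (a + fs), G (f - k * fs)) (∫ f, G f) := by
  have h := hasSum_integral_iUnion (f := G) (μ := volume)
    (s := fun n : ℤ => Set.Ioc (a + n • fs) (a + (n + 1) • fs)) (fun n => measurableSet_Ioc)
    (Set.pairwise_disjoint_Ioc_add_zsmul a fs) hG.integrableOn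
  rw [iUnion_Ioc_add_zsmul hfs, setIntegral_univ] at h
  refine ((Equiv.neg ℤ).hasSum_iff.2 h).congr_fun ?_
  intro k
  simp only [Function.comp, Equiv.neg_apply]
  rw [← intervalIntegral.integral_of_le (by linarith), intervalIntegral.integral_comp_sub_right,
    intervalIntegral.integral_of_le (by linarith)]
  congr 3 <;> · simp; ring

include hF

omit hfs in
lemma integrableOn_shift (a : ℝ) (k : ℤ) :
    Integrable (fun f => F (f - k * fs)) (volume.restrict (Set.Ioc a (a + fs))) :=
  (hF.comp_sub_right _).integrableOn

lemma summable_integral_norm_shift (a : ℝ) :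
    Summable fun k : ℤ => ∫ f in Set.Ioc a (a + fs), ‖F (f - k * fs)‖ :=
  (hasSum_setIntegral_shift hfs hF.norm a).summable

/-- The aliases of an integrable function are summable almost everywhere. -/
lemma ae_summable_shift : ∀ᵐ f : ℝ, Summable fun k : ℤ => F (f - k * fs) := by
  have h : ∀ n : ℤ, ∀ᵐ f : ℝ, f ∈ Set.Ioc (0 + n • fs) (0 + (n + 1) • fs) →
      Summable fun k : ℤ => F (f - k * fs) := by
    intro n
    have := ae_summable_of_summable_integral_norm (integrableOn_shift hF (0 + n • fs))
      (summable_integral_norm_shift hfs hF (0 + n • fs))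
    rw [ae_restrict_iff' measurableSet_Ioc] at this
    have e : (0 + n • fs) + fs = 0 + (n + 1) • fs := by simp; ring
    rwa [e] at this
  filter_upwards [ae_all_iff.2 h] with f hf
  have hmem : f ∈ ⋃ n : ℤ, Set.Ioc (0 + n • fs) (0 + (n + 1) • fs) := by
    rw [iUnion_Ioc_add_zsmul hfs]; trivial
  obtain ⟨n, hn⟩ := Set.mem_iUnion.1 hmem
  exact hf n hn

lemma integrable_tsum_shift :
    Integrable (fun f => ∑' k : ℤ, F (f - k * fs)) (bandMeasure fs) := by
  rw [integrable_bandMeasure_iff hfs, Ioc_band_eq]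
  exact integrable_tsum_of_summable_integral_norm (integrableOn_shift hF _)
    (summable_integral_norm_shift hfs hF _)

lemma integral_tsum_shift :
    ∫ f, ∑' k : ℤ, F (f - k * fs) ∂(bandMeasure fs) = ((1 / fs : ℝ) : ℂ) * ∫ f, F f := by
  rw [integral_bandMeasure hfs, intervalIntegral.integral_of_le (by linarith)]
  congr 1
  rw [Ioc_band_eq]
  have h1 := hasSum_setIntegral_shift hfs hF (-(fs / 2))
  have h2 := hasSum_integral_of_summable_integral_norm (integrableOn_shift hF (-(fs / 2)))
    (summable_integral_norm_shift hfs hF (-(fs / 2)))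
  exact h2.unique h1

/-- Fourier coefficients of the aliased sum. -/
lemma integral_bandChar_mul_tsum_shift (n : ℤ) :
    ∫ f, bandChar fs n f * ∑' k : ℤ, F (f - k * fs) ∂(bandMeasure fs)
      = ((1 / fs : ℝ) : ℂ) * ∫ f, bandChar fs n f * F f := by
  have hF' : Integrable fun f => bandChar fs n f * F f :=
    hF.bdd_mul (c := 1) (continuous_bandChar fs n).aestronglyMeasurable
      (Eventually.of_forall fun f => (norm_bandChar fs n f).le)
  rw [← integral_tsum_shift hfs hF']
  -- The exponential has period `fs`, so it is common to all aliases and leaves the sum.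
  simp only [bandChar_sub_zsmul hfs, tsum_mul_left]

end Folding

end

/-! ### Exponentials and Fourier coefficients in the weighted space on the band -/

noncomputable section

lemma hermForm_smul_single_right {ι : Type*} [Fintype ι] [DecidableEq ι] (A : Matrix ι ι ℂ)
    (a : ι → ℂ) (r : ℂ) (l : ι) :
    hermForm A a (r • Pi.single l 1) = star r * ∑ i, a i * A i l := by
  rw [hermForm_smul_right, hermForm]
  congr 1
  refine Finset.sum_congr rfl fun i _ => ?_
  rw [Finset.sum_eq_single l] <;> simp +contextual

lemma hermForm_smul_single {ι : Type*} [Fintype ι] [DecidableEq ι] (A : Matrix ι ι ℂ)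
    (r s : ℂ) (k l : ι) :
    hermForm A (r • Pi.single k 1) (s • Pi.single l 1) = r * star s * A k l := by
  rw [hermForm_smul_left, hermForm_smul_single_right, Finset.sum_eq_single k]
  · simp [mul_assoc]
  · simp +contextual
  · simp

lemma sq_integral_le_integral_sq {α : Type*} [MeasurableSpace α] {μ : Measure α}
    [IsProbabilityMeasure μ] {f : α → ℝ} (hf : MemLp f 2 μ) :
    (∫ x, f x ∂μ) ^ 2 ≤ ∫ x, f x ^ 2 ∂μ := by
  have h := variance_nonneg f μ
  rw [variance_eq_sub hf] at h
  simpa using h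

namespace SpectralWeight

variable {fs : ℝ} (hfs : 0 < fs) {K : ℕ} {W : SpectralWeight (bandMeasure fs) (Fin K)}

/-- The exponentials as elements of the weighted space on the band. -/
def expSpace (hW : ∀ i j, Integrable (fun f => W.toFun f i j) (bandMeasure fs))
    (p : ℤ × Fin K) : W.Space :=
  toSpace W (fun f => bandChar fs p.1 f • Pi.single p.2 1)
    (fun i => ((continuous_bandChar fs p.1).mul continuous_const).aestronglyMeasurable)
    (by
      simp only [hermForm_smul_single]
      refine (hW p.2 p.2).bdd_mul (c := 1) ?_ (Eventually.of_forall fun f => ?_)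
      · exact ((continuous_bandChar fs p.1).mul
          (continuous_bandChar fs p.1).star).aestronglyMeasurable
      · rw [norm_mul, norm_star, norm_bandChar, one_mul])

variable {hW : ∀ i j, Integrable (fun f => W.toFun f i j) (bandMeasure fs)}

lemma inner_expSpace (p : ℤ × Fin K) (g : W.Space) : inner ℂ (expSpace hW p) g =
    ∫ f, bandChar fs (-p.1) f * ∑ i, g.val f i * W.toFun f i p.2 ∂(bandMeasure fs) := by
  rw [inner_def]
  simp only [expSpace, toSpace_val, hermForm_smul_single_right, star_bandChar]

lemma inner_expSpace_expSpace (p q : ℤ × Fin K) : inner ℂ (expSpace hW q) (expSpace hW p) =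
    ∫ f, bandChar fs (p.1 - q.1) f * W.toFun f p.2 q.2 ∂(bandMeasure fs) := by
  rw [inner_def]
  simp only [expSpace, toSpace_val, hermForm_smul_single, star_bandChar, sub_eq_add_neg,
    bandChar_add]

lemma integrable_sum_mul (hW : ∀ i j, Integrable (fun f => W.toFun f i j) (bandMeasure fs))
    (g : W.Space) (l : Fin K) :
    Integrable (fun f => ∑ i, g.val f i * W.toFun f i l) (bandMeasure fs) := by
  have h := g.integrable (expSpace hW (0, l))
  simpa only [expSpace, toSpace_val, hermForm_smul_single_right, bandChar_zero,
    star_one, one_mul] using h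

include hfs

/-- The inner products with the exponentials are the Fourier coefficients of the entries of `g W`,
and these determine an integrable function. This turns the normal equations into a pointwise matrix
equation. -/
lemma ae_sum_mul_eq (g : W.Space) {S : ℝ → Fin K → ℂ}
    (hS : ∀ l, Integrable (fun f => S f l) (bandMeasure fs))
    (h : ∀ p, inner ℂ (expSpace hW p) g
      = ∫ f, bandChar fs (-p.1) f * S f p.2 ∂(bandMeasure fs)) :
    ∀ᵐ f ∂(bandMeasure fs), ∀ l, ∑ i, g.val f i * W.toFun f i l = S f l := by
  rw [ae_all_iff]
  intro l
  have hi := integrable_sum_mul hW g l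
  have hb : ∀ (n : ℤ) {F : ℝ → ℂ}, Integrable F (bandMeasure fs) →
      Integrable (fun f => bandChar fs n f * F f) (bandMeasure fs) := fun n F hF =>
    hF.bdd_mul (c := 1) (continuous_bandChar fs n).aestronglyMeasurable
      (Eventually.of_forall fun f => (norm_bandChar fs n f).le)
  have := ae_eq_zero_of_integral_bandChar_mul_eq_zero hfs (hi.sub (hS l)) (fun n => by
    have h1 := h (-n, l)
    rw [inner_expSpace, neg_neg] at h1
    simp only [Pi.sub_apply, mul_sub]
    rw [integral_sub (hb n hi) (hb n (hS l)), h1, sub_self])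
  filter_upwards [this] with f hf
  exact sub_eq_zero.1 hf

variable {c : ℝ}

/-- The Fourier coefficients of an element of a coercive weighted space. -/
def IsCoercive.tap (hC : W.IsCoercive c) (p : ℤ × Fin K) : W.Space →L[ℂ] ℂ :=
  have := isProbabilityMeasure_bandMeasure hfs
  have hint : ∀ g : W.Space, Integrable (fun f => bandChar fs (-p.1) f * g.val f p.2)
      (bandMeasure fs) := fun g => by
    refine Integrable.bdd_mul (c := 1) ?_ (continuous_bandChar fs _).aestronglyMeasurable
      (Eventually.of_forall fun f => (norm_bandChar fs _ f).le)
    exact ((hC.memLp g).integrable one_le_two).norm.mono' (g.aesm p.2)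
      (Eventually.of_forall fun f => norm_le_pi_norm _ _)
  LinearMap.mkContinuous
    { toFun := fun g => ∫ f, bandChar fs (-p.1) f * g.val f p.2 ∂(bandMeasure fs)
      map_add' := fun g g' => by
        rw [← integral_add (hint g) (hint g')]
        simp [mul_add]
      map_smul' := fun r g => by
        simp only [RingHom.id_apply, smul_eq_mul]
        rw [← integral_const_mul]
        simp [mul_left_comm] } (√(c⁻¹)) (fun g => by
    -- On a probability space the squared mean is at most the mean square, and coercivity bounds the
    -- unweighted mean square by `c⁻¹` times the weighted one.
    refine abs_le_of_sq_le_sq' ?_ (by positivity) |>.2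
    rw [mul_pow, Real.sq_sqrt (inv_nonneg.2 hC.1.le)]
    refine le_trans ?_ (hC.integral_norm_sq_le g)
    refine le_trans ?_ (sq_integral_le_integral_sq (hC.memLp g).norm)
    gcongr
    refine (norm_integral_le_integral_norm _).trans ?_
    refine integral_mono (hint g).norm ((hC.memLp g).integrable one_le_two).norm fun f => ?_
    simp only [norm_mul, norm_bandChar, one_mul]
    exact norm_le_pi_norm _ _)

lemma IsCoercive.tap_apply (hC : W.IsCoercive c) (p : ℤ × Fin K) (g : W.Space) :
    hC.tap hfs p g = ∫ f, bandChar fs (-p.1) f * g.val f p.2 ∂(bandMeasure fs) := rfl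

lemma IsCoercive.tap_expSpace (hC : W.IsCoercive c) (p q : ℤ × Fin K) :
    hC.tap hfs p (expSpace hW q) = if q = p then 1 else 0 := by
  rw [tap_apply]
  simp only [expSpace, toSpace_val, Pi.smul_apply, smul_eq_mul, ← mul_assoc, ← bandChar_add]
  rw [integral_mul_const, integral_bandChar hfs, Pi.single_apply]
  have h : q = p ↔ -p.1 + q.1 = 0 ∧ p.2 = q.2 := by
    rw [Prod.ext_iff, neg_add_eq_zero, eq_comm (a := p.1), eq_comm (a := p.2)]
  simp only [h, ite_and, mul_ite, mul_one, mul_zero]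
  split_ifs <;> rfl

/-- Coercivity makes the entries of `g` integrable, so vanishing Fourier coefficients force `g = 0`
almost everywhere. -/
lemma IsCoercive.norm_eq_zero_of_tap_eq_zero (hC : W.IsCoercive c) (g : W.Space)
    (h : ∀ p, hC.tap hfs p g = 0) : ‖g‖ = 0 := by
  have := isProbabilityMeasure_bandMeasure hfs
  have h0 : ∀ᵐ f ∂(bandMeasure fs), ∀ i, g.val f i = 0 := by
    rw [ae_all_iff]
    intro i
    refine ae_eq_zero_of_integral_bandChar_mul_eq_zero hfs ?_ fun n => ?_
    · exact ((hC.memLp g).integrable one_le_two).norm.mono' (g.aesm i)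
        (Eventually.of_forall fun f => norm_le_pi_norm _ _)
    · have := h (-n, i)
      rwa [tap_apply, neg_neg] at this
  have : ‖g‖ ^ 2 = 0 := by
    rw [norm_sq_eq]
    refine integral_eq_zero_of_ae ?_
    filter_upwards [h0] with f hf
    simp [hermForm, hf]
  exact pow_eq_zero_iff (two_ne_zero) |>.1 this

end SpectralWeight

end

/-! ### Limits of finite combinations and their taps -/

noncomputable section

/-- `v` is a limit of finite combinations of `z` whose coefficients tend to `G`. -/
def IsTapLimit {ι 𝓗 : Type*} [NormedAddCommGroup 𝓗] [InnerProductSpace ℝ 𝓗] (z : ι → 𝓗)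
    (G : ι → ℝ) (v : 𝓗) : Prop :=
  ∃ c : ℕ → ι →₀ ℝ, (∀ p, Tendsto (fun j => c j p) atTop (𝓝 (G p))) ∧
    Tendsto (fun j => Finsupp.linearCombination ℝ z (c j)) atTop (𝓝 v)

section

variable {𝓗 : Type*} [NormedAddCommGroup 𝓗] [InnerProductSpace ℝ 𝓗]
  {fs : ℝ} (hfs : 0 < fs) {K : ℕ} {W : SpectralWeight (bandMeasure fs) (Fin K)}
  {hW : ∀ i j, Integrable (fun f => W.toFun f i j) (bandMeasure fs)} {c : ℝ} (hC : W.IsCoercive c)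
  {z : ℤ × Fin K → 𝓗} (hz : ∀ p q, ((inner ℝ (z p) (z q) : ℝ) : ℂ) =
    inner ℂ (SpectralWeight.expSpace hW q) (SpectralWeight.expSpace hW p))

open SpectralWeight

include hz in
lemma inner_linearCombination_eq (a : ℤ × Fin K →₀ ℝ) (q : ℤ × Fin K) :
    ((inner ℝ (Finsupp.linearCombination ℝ z a) (z q) : ℝ) : ℂ) =
      inner ℂ (expSpace hW q) (Finsupp.linearCombination ℝ (expSpace hW) a) := by
  simp only [Finsupp.linearCombination_apply, Finsupp.sum, sum_inner, inner_sum, inner_smul_left,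
    Complex.ofReal_sum, ← Complex.coe_smul, inner_smul_right, ← hz]
  simp

include hz in
-- Norms of finite combinations depend only on the Gram matrix, which the samples share with the
-- exponentials.
lemma norm_linearCombination_eq (a : ℤ × Fin K →₀ ℝ) :
    ‖Finsupp.linearCombination ℝ z a‖ = ‖Finsupp.linearCombination ℝ (expSpace hW) a‖ := by
  have h : ((‖Finsupp.linearCombination ℝ z a‖ ^ 2 : ℝ) : ℂ)
      = ((‖Finsupp.linearCombination ℝ (expSpace hW) a‖ ^ 2 : ℝ) : ℂ) := by
    rw [← real_inner_self_eq_norm_sq]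
    have h2 : inner ℂ (Finsupp.linearCombination ℝ (expSpace hW) a)
      (Finsupp.linearCombination ℝ (expSpace hW) a)
        = ((‖Finsupp.linearCombination ℝ (expSpace hW) a‖ ^ 2 : ℝ) : ℂ) := by
      rw [inner_self_eq_norm_sq_to_K]; simp
    have key : ∀ b : W.Space, inner ℂ (Finsupp.linearCombination ℝ (expSpace hW) a) b
        = ∑ p ∈ a.support, (a p : ℂ) * inner ℂ (expSpace hW p) b := fun b => by
      simp only [Finsupp.linearCombination_apply, Finsupp.sum, sum_inner, ← Complex.coe_smul,
        inner_smul_left, Complex.conj_ofReal]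
    rw [← h2, key]
    nth_rw 2 [Finsupp.linearCombination_apply]
    simp only [Finsupp.sum, inner_sum, inner_smul_right, Complex.ofReal_sum, Complex.ofReal_mul,
      inner_linearCombination_eq hz]
  have h' : ‖Finsupp.linearCombination ℝ z a‖ ^ 2
      = ‖Finsupp.linearCombination ℝ (expSpace hW) a‖ ^ 2 := by exact_mod_cast h
  exact (pow_left_inj₀ (norm_nonneg _) (norm_nonneg _) two_ne_zero).1 h'

lemma tap_linearCombination (a : ℤ × Fin K →₀ ℝ) (p : ℤ × Fin K) :
    hC.tap hfs p (Finsupp.linearCombination ℝ (expSpace hW) a) = a p := by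
  simp only [Finsupp.linearCombination_apply, Finsupp.sum, map_sum, ← Complex.coe_smul, map_smul,
    hC.tap_expSpace hfs, smul_eq_mul, mul_ite, mul_one, mul_zero, Finset.sum_ite_eq']
  split_ifs with h
  · rfl
  · rw [Finsupp.notMem_support_iff.1 h, Complex.ofReal_zero]

include hz hC

/-- By the isometry the trigonometric polynomials are Cauchy as well; completeness gives a limit
`g`, and norms, correlations and taps pass to it by continuity. In particular convergence of the
combinations alone forces every tap to converge. -/
lemma exists_tendsto_expSpace {a : ℕ → ℤ × Fin K →₀ ℝ} {v : 𝓗}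
    (ha : Tendsto (fun j => Finsupp.linearCombination ℝ z (a j)) atTop (𝓝 v)) :
    ∃ g : W.Space, Tendsto (fun j => Finsupp.linearCombination ℝ (expSpace hW) (a j)) atTop (𝓝 g) ∧
      ‖v‖ = ‖g‖ ∧ (∀ q, ((inner ℝ v (z q) : ℝ) : ℂ) = inner ℂ (expSpace hW q) g) ∧
      ∀ p, Tendsto (fun j => ((a j p : ℝ) : ℂ)) atTop (𝓝 (hC.tap hfs p g)) := by
  have := hC.completeSpace
  have hcau : CauchySeq fun j => Finsupp.linearCombination ℝ (expSpace hW) (a j) := by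
    have h := ha.cauchySeq
    rw [Metric.cauchySeq_iff] at h ⊢
    intro ε hε
    obtain ⟨N, hN⟩ := h ε hε
    refine ⟨N, fun m hm n hn => ?_⟩
    have := hN m hm n hn
    rwa [dist_eq_norm, ← map_sub, norm_linearCombination_eq hz, map_sub, ← dist_eq_norm] at this
  obtain ⟨g, hg⟩ := cauchySeq_tendsto_of_complete hcau
  refine ⟨g, hg, ?_, fun q => ?_, fun p => ?_⟩
  · refine tendsto_nhds_unique ha.norm (hg.norm.congr fun j => ?_)
    exact (norm_linearCombination_eq hz _).symm
  · refine tendsto_nhds_unique ((Complex.continuous_ofReal.tendsto _).comp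
      (ha.inner (𝕜 := ℝ) (tendsto_const_nhds (x := z q))))
      (((tendsto_const_nhds (x := expSpace hW q)).inner (𝕜 := ℂ) hg).congr fun j => ?_)
    exact (inner_linearCombination_eq hz _ _).symm
  · refine (((hC.tap hfs p).continuous.tendsto _).comp hg).congr fun j => ?_
    exact tap_linearCombination hfs hC _ _

lemma IsTapLimit.tap_eq {G : ℤ × Fin K → ℝ} {v : 𝓗} (h : IsTapLimit z G v) :
    ∃ g : W.Space, ‖v‖ = ‖g‖ ∧ (∀ q, ((inner ℝ v (z q) : ℝ) : ℂ) = inner ℂ (expSpace hW q) g) ∧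
      ∀ p, (G p : ℂ) = hC.tap hfs p g := by
  obtain ⟨a, h1, h2⟩ := h
  obtain ⟨g, -, h3, h4, h5⟩ := exists_tendsto_expSpace hfs hC hz h2
  exact ⟨g, h3, h4, fun p => tendsto_nhds_unique
    ((Complex.continuous_ofReal.tendsto _).comp (h1 p)) (h5 p)⟩

omit hz hC in
lemma IsTapLimit.sub {G G' : ℤ × Fin K → ℝ} {v v' : 𝓗} (h : IsTapLimit z G v)
    (h' : IsTapLimit z G' v') : IsTapLimit z (G - G') (v - v') := by
  obtain ⟨a, h1, h2⟩ := h
  obtain ⟨a', h1', h2'⟩ := h'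
  refine ⟨fun j => a j - a' j, fun p => ?_, ?_⟩
  · simpa using (h1 p).sub (h1' p)
  · simpa using h2.sub h2'

include hfs

/-- The difference of the two representations has limit zero, and bounded functionals vanish on its
representative of norm zero. -/
lemma IsTapLimit.taps_unique {G G' : ℤ × Fin K → ℝ} {v : 𝓗} (h : IsTapLimit z G v)
    (h' : IsTapLimit z G' v) : G = G' := by
  obtain ⟨g, h1, -, h2⟩ := (h.sub h').tap_eq hfs hC hz
  have hg : ‖g‖ = 0 := by rw [← h1]; simp
  funext p
  have h3 := (hC.tap hfs p).le_opNorm g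
  rw [hg, mul_zero, ← h2] at h3
  have h4 := norm_le_zero_iff.1 h3
  rw [Complex.ofReal_eq_zero] at h4
  exact sub_eq_zero.1 h4

/-- The difference has all taps zero, hence norm zero. So the tap-by-tap definition of a mean-square
output is independent of the approximating sequence. -/
lemma IsTapLimit.limit_unique {G : ℤ × Fin K → ℝ} {v v' : 𝓗} (h : IsTapLimit z G v)
    (h' : IsTapLimit z G v') : v = v' := by
  obtain ⟨g, h1, -, h2⟩ := (h.sub h').tap_eq hfs hC hz
  have := hC.norm_eq_zero_of_tap_eq_zero hfs g fun p => by rw [← h2]; simp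
  rw [this] at h1
  exact sub_eq_zero.1 (norm_eq_zero.1 h1)

omit hz hC hfs in
lemma IsTapLimit.mem_closure {G : ℤ × Fin K → ℝ} {v : 𝓗} (h : IsTapLimit z G v) :
    v ∈ (Submodule.span ℝ (Set.range z)).topologicalClosure := by
  obtain ⟨a, -, h2⟩ := h
  refine mem_closure_of_tendsto h2 (Eventually.of_forall fun j => ?_)
  rw [← Finsupp.range_linearCombination]
  exact LinearMap.mem_range_self _ _

/-- The taps of approximating real combinations converge, and the limits are the required
coefficients. The optimal filter is real for this reason, without any symmetry argument on the
spectra. -/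
lemma exists_isTapLimit {v : 𝓗} (h : v ∈ (Submodule.span ℝ (Set.range z)).topologicalClosure) :
    ∃ G, IsTapLimit z G v := by
  obtain ⟨u, hu, hlim⟩ := mem_closure_iff_seq_limit.1 h
  have hu' : ∀ j, ∃ a, Finsupp.linearCombination ℝ z a = u j := fun j => by
    have := hu j
    rw [SetLike.mem_coe, ← Finsupp.range_linearCombination] at this
    exact this
  choose a ha using hu'
  have hlim' : Tendsto (fun j => Finsupp.linearCombination ℝ z (a j)) atTop (𝓝 v) := by
    simpa only [ha] using hlim
  obtain ⟨g, -, -, -, h5⟩ := exists_tendsto_expSpace hfs hC hz hlim'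
  refine ⟨fun p => (hC.tap hfs p g).re, a, fun p => ?_, hlim'⟩
  exact (Complex.continuous_re.tendsto _).comp (h5 p)

/-- The frequency-domain form of a limit of linear combinations with given correlations. -/
lemma IsTapLimit.exists_spectral {G : ℤ × Fin K → ℝ} {v : 𝓗} (h : IsTapLimit z G v)
    {S : ℝ → Fin K → ℂ} (hS : ∀ l, Integrable (fun f => S f l) (bandMeasure fs))
    (hv : ∀ q : ℤ × Fin K, ((inner ℝ v (z q) : ℝ) : ℂ)
      = ∫ f, bandChar fs (-q.1) f * S f q.2 ∂(bandMeasure fs)) :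
    ∃ g : W.Space, ((‖v‖ ^ 2 : ℝ) : ℂ) = inner ℂ g g ∧
      (∀ᵐ f ∂(bandMeasure fs), ∀ l, ∑ i, g.val f i * W.toFun f i l = S f l) ∧
      ∀ p : ℤ × Fin K, (G p : ℂ) = ∫ f, bandChar fs (-p.1) f * g.val f p.2 ∂(bandMeasure fs) := by
  obtain ⟨g, h1, h2, h3⟩ := h.tap_eq hfs hC hz
  refine ⟨g, ?_, ae_sum_mul_eq (hW := hW) hfs g hS fun p => ?_, h3⟩
  · rw [h1, inner_self_eq_norm_sq_to_K]; simp
  · rw [← h2, hv]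

end

end

/-! ### The aliased spectra -/

noncomputable section

lemma Matrix.posSemidef_of_hermForm_nonneg {ι : Type*} [Fintype ι] {A : Matrix ι ι ℂ}
    (hA : A.IsHermitian) (h : ∀ a, 0 ≤ hermForm A a a) : A.PosSemidef := by
  refine Matrix.PosSemidef.of_dotProduct_mulVec_nonneg hA fun x => ?_
  convert h (star x) using 1
  simp only [hermForm, dotProduct, Matrix.mulVec, Pi.star_apply, star_star, Finset.mul_sum,
    mul_assoc]

lemma hasSum_matrix_apply {κ m n : Type*} {X : κ → Matrix m n ℂ} {T : Matrix m n ℂ}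
    (h : HasSum X T) (i : m) (j : n) : HasSum (fun k => X k i j) (T i j) :=
  Pi.hasSum.1 (Pi.hasSum.1 h i) j

lemma Matrix.PosSemidef.of_hasSum {κ ι : Type*} [Fintype ι] {X : κ → Matrix ι ι ℂ}
    {T : Matrix ι ι ℂ} (h : HasSum X T) (hX : ∀ k, (X k).PosSemidef) : T.PosSemidef := by
  refine Matrix.posSemidef_of_hermForm_nonneg ?_ fun a => ?_
  · refine Matrix.IsHermitian.ext fun i j => ?_
    refine (hasSum_matrix_apply h j i).star.unique ?_
    simpa only [(hX _).1.apply] using hasSum_matrix_apply h i j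
  · have hs : HasSum (fun k => hermForm (X k) a a) (hermForm T a a) := by
      refine hasSum_sum fun i _ => hasSum_sum fun j _ => ?_
      exact ((hasSum_matrix_apply h i j).mul_left _).mul_right _
    exact hs.nonneg fun k => (hX k).hermForm_self_nonneg a

section Alias

variable {L L' M : ℕ} {fs : ℝ} (hfs : 0 < fs) {A : ℝ → Matrix (Fin L) (Fin M) ℂ}
    {C : ℝ → Matrix (Fin M) (Fin M) ℂ} {B : ℝ → Matrix (Fin L') (Fin M) ℂ}

include hfs in
lemma ae_summable_aliasTerm (h : ∀ i j, Integrable fun f => (A f * C f * (B f)ᴴ) i j) :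
    ∀ᵐ f : ℝ, Summable (aliasTerm fs A C B f) := by
  have : ∀ᵐ f : ℝ, ∀ i j, Summable fun k : ℤ =>
      (A (f - k * fs) * C (f - k * fs) * (B (f - k * fs))ᴴ) i j :=
    ae_all_iff.2 fun i => ae_all_iff.2 fun j =>
      ae_summable_shift (F := fun f => (A f * C f * (B f)ᴴ) i j) hfs (h i j)
  filter_upwards [this] with f hf
  exact Pi.summable.2 fun i => Pi.summable.2 fun j => hf i j

lemma tsum_aliasTerm_apply {f : ℝ} (h : Summable (aliasTerm fs A C B f)) (i : Fin L)
    (j : Fin L') : (∑' k, aliasTerm fs A C B f k) i j =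
      ∑' k : ℤ, (fun f => (A f * C f * (B f)ᴴ) i j) (f - k * fs) :=
  ((hasSum_matrix_apply h.hasSum i j).tsum_eq).symm

include hfs in
lemma integrable_tsum_aliasTerm (h : ∀ i j, Integrable fun f => (A f * C f * (B f)ᴴ) i j)
    (i : Fin L) (j : Fin L') :
    Integrable (fun f => (∑' k, aliasTerm fs A C B f k) i j) (bandMeasure fs) := by
  refine (integrable_tsum_shift hfs (h i j)).congr ?_
  filter_upwards [(bandMeasure_absolutelyContinuous fs).ae_le (ae_summable_aliasTerm hfs h)]
    with f hf
  exact (tsum_aliasTerm_apply hf i j).symm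

include hfs in
lemma integral_bandChar_mul_tsum_aliasTerm
    (h : ∀ i j, Integrable fun f => (A f * C f * (B f)ᴴ) i j) (n : ℤ) (i : Fin L) (j : Fin L') :
    ∫ f, bandChar fs n f * (∑' k, aliasTerm fs A C B f k) i j ∂(bandMeasure fs)
      = ((1 / fs : ℝ) : ℂ) * ∫ f, bandChar fs n f * (A f * C f * (B f)ᴴ) i j := by
  rw [← integral_bandChar_mul_tsum_shift hfs (h i j)]
  refine integral_congr_ae ?_
  filter_upwards [(bandMeasure_absolutelyContinuous fs).ae_le (ae_summable_aliasTerm hfs h)]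
    with f hf
  rw [tsum_aliasTerm_apply hf i j]

lemma ae_posSemidef_tsum_aliasTerm (hC : ∀ᵐ f : ℝ, (C f).PosSemidef)
    (h : ∀ᵐ f : ℝ, Summable (aliasTerm fs A C A f)) :
    ∀ᵐ f : ℝ, (∑' k, aliasTerm fs A C A f k).PosSemidef := by
  have h1 : ∀ᵐ f : ℝ, ∀ k : ℤ, (C (f - k * fs)).PosSemidef := ae_all_iff.2 fun k =>
    (measurePreserving_sub_right volume ((k : ℝ) * fs)).quasiMeasurePreserving.ae hC
  filter_upwards [h, h1] with f hf hf1
  exact Matrix.PosSemidef.of_hasSum hf.hasSum fun k => (hf1 k).mul_mul_conjTranspose_same _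

end Alias

section OutputSpectrum

variable {K M : ℕ} {fs Δ : ℝ} (hfs : 0 < fs) (hΔ : 0 < Δ) {C : ℝ → Matrix (Fin M) (Fin M) ℂ}
  {H : ℝ → Matrix (Fin K) (Fin M) ℂ}

include hfs

lemma posSemidef_smul_tsum_aliasTerm {f : ℝ} (h : (∑' k, aliasTerm fs H C H f k).PosSemidef) :
    (((1 / fs : ℝ) : ℂ) • ∑' k, aliasTerm fs H C H f k).PosSemidef :=
  h.smul (by rw [Complex.zero_le_real]; positivity)

include hΔ

lemma posDef_outputSpectrum {f : ℝ} (h : (∑' k, aliasTerm fs H C H f k).PosSemidef) :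
    (outputSpectrum fs Δ C H f).PosDef := by
  refine Matrix.PosDef.posSemidef_add (posSemidef_smul_tsum_aliasTerm hfs h) ?_
  exact Matrix.PosDef.one.smul (by rw [Complex.zero_lt_real]; positivity)

/-- The aliased part is nonnegative, so the dither term alone gives the lower bound. The norm of `a`
is the supremum norm, which the Euclidean one dominates. -/
lemma coercive_outputSpectrum {f : ℝ} (h : (∑' k, aliasTerm fs H C H f k).PosSemidef)
    (a : Fin K → ℂ) : Δ ^ 2 / 4 * ‖a‖ ^ 2 ≤ (hermForm (outputSpectrum fs Δ C H f) a a).re := by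
  have h1 : hermForm (outputSpectrum fs Δ C H f) a a
      = hermForm (((1 / fs : ℝ) : ℂ) • ∑' k, aliasTerm fs H C H f k) a a
        + ((Δ ^ 2 / 4 * ∑ i, ‖a i‖ ^ 2 : ℝ) : ℂ) := by
    have h2 : ((Δ ^ 2 / 4 * ∑ i, ‖a i‖ ^ 2 : ℝ) : ℂ)
        = hermForm (((Δ ^ 2 / 4 : ℝ) : ℂ) • (1 : Matrix (Fin K) (Fin K) ℂ)) a a := by
      simp only [hermForm, Matrix.smul_apply, Matrix.one_apply, smul_eq_mul, mul_ite, mul_one,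
        mul_zero, ite_mul, zero_mul, Finset.sum_ite_eq, Finset.mem_univ, if_true]
      push_cast
      rw [Finset.mul_sum]
      refine Finset.sum_congr rfl fun i _ => ?_
      rw [← Complex.mul_conj', Complex.star_def]; ring
    rw [h2]
    simp only [hermForm, outputSpectrum, Matrix.add_apply, mul_add, add_mul,
      Finset.sum_add_distrib]
  have h3 : ‖a‖ ^ 2 ≤ ∑ i, ‖a i‖ ^ 2 := by
    have h0 : 0 ≤ ∑ i, ‖a i‖ ^ 2 := by positivity
    rw [← Real.sq_sqrt h0]
    gcongr
    refine (pi_norm_le_iff_of_nonneg (Real.sqrt_nonneg _)).2 fun i => Real.le_sqrt_of_sq_le ?_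
    exact Finset.single_le_sum (f := fun i => ‖a i‖ ^ 2) (fun _ _ => by positivity)
      (Finset.mem_univ i)
  rw [h1, Complex.add_re, Complex.ofReal_re]
  have h4 := (posSemidef_smul_tsum_aliasTerm hfs h).hermForm_self_re_nonneg a
  have h5 : Δ ^ 2 / 4 * ‖a‖ ^ 2 ≤ Δ ^ 2 / 4 * ∑ i, ‖a i‖ ^ 2 := by gcongr
  linarith

variable (hC : ∀ᵐ f : ℝ, (C f).PosSemidef)
  (hint : ∀ i j, Integrable fun f => (H f * C f * (H f)ᴴ) i j)

include hint

omit hΔ in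
lemma integrable_outputSpectrum (i j : Fin K) :
    Integrable (fun f => outputSpectrum fs Δ C H f i j) (bandMeasure fs) := by
  have := isProbabilityMeasure_bandMeasure hfs
  simp only [outputSpectrum, Matrix.add_apply, Matrix.smul_apply, smul_eq_mul]
  exact ((integrable_tsum_aliasTerm hfs hint i j).const_mul _).add (integrable_const _)

/-- The output spectrum as a weight on the band. -/
def outputWeight : SpectralWeight (bandMeasure fs) (Fin K) where
  toFun := outputSpectrum fs Δ C H
  aestronglyMeasurable := fun i j => (integrable_outputSpectrum hfs hint i j).aestronglyMeasurable
  posSemidef := by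
    filter_upwards [(bandMeasure_absolutelyContinuous fs).ae_le
      (ae_posSemidef_tsum_aliasTerm hC (ae_summable_aliasTerm hfs hint))] with f hf
    exact (posDef_outputSpectrum hfs hΔ hf).posSemidef

lemma isCoercive_outputWeight : (outputWeight hfs hΔ hC hint).IsCoercive (Δ ^ 2 / 4) := by
  refine ⟨by positivity, ?_⟩
  filter_upwards [(bandMeasure_absolutelyContinuous fs).ae_le
    (ae_posSemidef_tsum_aliasTerm hC (ae_summable_aliasTerm hfs hint))] with f hf a
  exact coercive_outputSpectrum hfs hΔ hf a

omit hΔ in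
lemma integral_bandChar_mul_outputSpectrum (n : ℤ) (i j : Fin K) :
    ∫ f, bandChar fs n f * outputSpectrum fs Δ C H f i j ∂(bandMeasure fs)
      = ((1 / fs : ℝ) : ℂ) * (((1 / fs : ℝ) : ℂ) *
          ∫ f, bandChar fs n f * (H f * C f * (H f)ᴴ) i j)
        + if n = 0 ∧ i = j then ((Δ ^ 2 / 4 : ℝ) : ℂ) else 0 := by
  have := isProbabilityMeasure_bandMeasure hfs
  rw [← integral_bandChar_mul_tsum_aliasTerm hfs hint, ← integral_const_mul]
  have h2 : (if n = 0 ∧ i = j then ((Δ ^ 2 / 4 : ℝ) : ℂ) else 0)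
      = ∫ f, bandChar fs n f * (((Δ ^ 2 / 4 : ℝ) : ℂ) • (1 : Matrix (Fin K) (Fin K) ℂ)) i j
        ∂(bandMeasure fs) := by
    rw [integral_mul_const, integral_bandChar hfs, Matrix.smul_apply, Matrix.one_apply, ite_and]
    split_ifs <;> simp
  have hb : ∀ {F : ℝ → ℂ}, Integrable F (bandMeasure fs) →
      Integrable (fun f => bandChar fs n f * F f) (bandMeasure fs) := fun hF =>
    hF.bdd_mul (c := 1) (continuous_bandChar fs n).aestronglyMeasurable
      (Eventually.of_forall fun f => (norm_bandChar fs n f).le)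
  rw [h2, ← integral_add ((hb (integrable_tsum_aliasTerm hfs hint i j)).const_mul _)
    (hb (integrable_const _))]
  refine integral_congr_ae (Eventually.of_forall fun f => ?_)
  simp only [outputSpectrum, Matrix.add_apply, Matrix.smul_apply, smul_eq_mul]
  ring

end OutputSpectrum

end

/-! ### Digital filters as combinations of samples, and optimality by projection -/

noncomputable section

variable {Ω : Type*} [MeasurableSpace Ω] {P : Measure Ω} {N K : ℕ} {z : ℤ → Ω → Fin K → ℝ}

lemma toLp_finset_sum {ι : Type*} (s : Finset ι) {f : ι → Ω → ℝ} (hf : ∀ i, MemLp (f i) 2 P)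
    (h : MemLp (fun ω => ∑ i ∈ s, f i ω) 2 P) :
    h.toLp _ = ∑ i ∈ s, (hf i).toLp (f i) := by
  classical
  induction s using Finset.induction_on with
  | empty =>
    have h0 : MemLp (0 : Ω → ℝ) 2 P := MemLp.zero
    rw [Finset.sum_empty, ← MemLp.toLp_zero h0]
    exact MemLp.toLp_congr _ _ (Eventually.of_forall fun ω => by simp)
  | insert i s hi ih =>
    rw [Finset.sum_insert hi, ← ih (memLp_finsetSum _ fun i _ => hf i), ← MemLp.toLp_add]
    simp only [Finset.sum_insert hi]
    rfl

/-- The coefficients of the samples `z[n]ₖ` in the `i`-th output of a filter with finitely many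
taps. -/
def rowTaps (G : ℤ →₀ Matrix (Fin N) (Fin K) ℝ) (i : Fin N) : ℤ × Fin K →₀ ℝ :=
  Finsupp.onFinset ((G.support.image Neg.neg) ×ˢ Finset.univ) (fun p => G (-p.1) i p.2) (by
    intro p hp
    simp only [Finset.mem_product, Finset.mem_image, Finsupp.mem_support_iff, Finset.mem_univ,
      and_true]
    refine ⟨-p.1, fun h => hp (by simp [h]), neg_neg _⟩)

lemma rowTaps_apply (G : ℤ →₀ Matrix (Fin N) (Fin K) ℝ) (i : Fin N) (p : ℤ × Fin K) :
    rowTaps G i p = G (-p.1) i p.2 := rfl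

/-- The rows of a matrix filter can be prescribed independently; finitely many finite supports are
merged, with time reversed as in the convolution. -/
lemma exists_rowTaps_eq (c : Fin N → ℤ × Fin K →₀ ℝ) :
    ∃ G : ℤ →₀ Matrix (Fin N) (Fin K) ℝ, ∀ i, rowTaps G i = c i := by
  classical
  refine ⟨Finsupp.onFinset (Finset.univ.biUnion fun i => (c i).support.image fun p => -p.1)
    (fun n => Matrix.of fun i k => c i (-n, k)) ?_, fun i => ?_⟩
  · intro n hn
    by_contra h
    refine hn (Matrix.ext fun i k => ?_)
    by_contra h0
    refine h ?_
    simp only [Finset.mem_biUnion, Finset.mem_image, Finset.mem_univ, true_and]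
    exact ⟨i, (-n, k), Finsupp.mem_support_iff.2 h0, neg_neg n⟩
  · ext p
    rw [rowTaps_apply]
    simp

omit [MeasurableSpace Ω] in
lemma firOutput_apply (G : ℤ →₀ Matrix (Fin N) (Fin K) ℝ) (ω : Ω) (i : Fin N) :
    firOutput G z ω i = (rowTaps G i).sum fun p r => r * z p.1 ω p.2 := by
  rw [rowTaps, Finsupp.onFinset_sum _ (by simp), Finset.sum_product, Finset.sum_image (by simp),
    firOutput, Finsupp.sum, Finset.sum_apply]
  simp [Matrix.mulVec, dotProduct]

variable (hzm : ∀ n k, MemLp (fun ω => z n ω k) 2 P)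

/-- The samples as elements of the space of square-integrable random variables. -/
def sampleLp (p : ℤ × Fin K) : Lp ℝ 2 P := (hzm p.1 p.2).toLp _

include hzm in
lemma memLp_firOutput (G : ℤ →₀ Matrix (Fin N) (Fin K) ℝ) (i : Fin N) :
    MemLp (fun ω => firOutput G z ω i) 2 P := by
  simp only [firOutput_apply]
  exact memLp_finsetSum _ fun p _ => (hzm p.1 p.2).const_mul _

lemma toLp_firOutput (G : ℤ →₀ Matrix (Fin N) (Fin K) ℝ) (i : Fin N) :
    (memLp_firOutput hzm G i).toLp _ =
      Finsupp.linearCombination ℝ (sampleLp hzm) (rowTaps G i) := by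
  have h : MemLp (fun ω => ∑ p ∈ (rowTaps G i).support, rowTaps G i p * z p.1 ω p.2) 2 P :=
    memLp_finsetSum _ fun p _ => (hzm p.1 p.2).const_mul _
  have e : (memLp_firOutput hzm G i).toLp _ = h.toLp _ := by
    refine MemLp.toLp_congr _ _ (Eventually.of_forall fun ω => ?_)
    exact firOutput_apply G ω i
  rw [e, toLp_finset_sum _ (fun p => (hzm p.1 p.2).const_mul (rowTaps G i p))]
  rfl

/-- Both kinds of convergence are entrywise, so the matrix problem splits into scalar ones, one for
each output; approximants chosen separately for the rows are glued by `exists_rowTaps_eq`. -/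
lemma isDigitalOutput_iff {G : ℤ → Matrix (Fin N) (Fin K) ℝ} {v : Ω → Fin N → ℝ}
    (hv : ∀ i, MemLp (fun ω => v ω i) 2 P) :
    IsDigitalOutput P z G v ↔
      ∀ i, IsTapLimit (sampleLp hzm) (fun p => G (-p.1) i p.2) ((hv i).toLp _) := by
  constructor
  · rintro ⟨-, Gj, h1, h2⟩ i
    refine ⟨fun j => rowTaps (Gj j) i, fun p => ?_, ?_⟩
    · exact tendsto_pi_nhds.1 (tendsto_pi_nhds.1 (h1 (-p.1)) i) p.2
    · simp only [← toLp_firOutput hzm]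
      exact tendsto_toLp (fun j => memLp_firOutput hzm (Gj j) i) (hv i) (h2 i)
  · intro h
    choose c h1 h2 using h
    choose Gj hGj using fun j => exists_rowTaps_eq (fun i => c i j)
    refine ⟨hv, Gj, fun n => ?_, fun i => ?_⟩
    · refine tendsto_pi_nhds.2 fun i => tendsto_pi_nhds.2 fun k => ?_
      have := h1 i (-n, k)
      simp only [neg_neg] at this
      refine this.congr fun j => ?_
      rw [← hGj, rowTaps_apply, neg_neg]
    · have := h2 i
      simp only [← hGj, ← toLp_firOutput hzm] at this
      exact (Lp.tendsto_Lp_iff_tendsto_eLpNorm'' _ _ _ (hv i)).1 this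

lemma meanSq_sub_eq {u v : Ω → Fin N → ℝ} (hu : ∀ i, MemLp (fun ω => u ω i) 2 P)
    (hv : ∀ i, MemLp (fun ω => v ω i) 2 P) :
    meanSq P (fun ω => u ω - v ω) = ∑ i, ‖(hu i).toLp _ - (hv i).toLp _‖ ^ 2 := by
  rw [meanSq]
  simp only [Pi.sub_apply]
  rw [integral_finsetSum (f := fun i ω => (u ω i - v ω i) ^ 2) _
    fun i _ => ((hu i).sub (hv i)).integrable_sq]
  refine Finset.sum_congr rfl fun i _ => ?_
  rw [← MemLp.toLp_sub, MemLp.norm_toLp_two_sq]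
  simp

lemma meanSq_eq {u : Ω → Fin N → ℝ} (hu : ∀ i, MemLp (fun ω => u ω i) 2 P) :
    meanSq P u = ∑ i, ‖(hu i).toLp _‖ ^ 2 := by
  rw [meanSq, integral_finsetSum _ fun i _ => (hu i).integrable_sq]
  refine Finset.sum_congr rfl fun i _ => ?_
  rw [MemLp.norm_toLp_two_sq]
  simp

/-- The closed span of the samples. -/
abbrev sampleSpan : Submodule ℝ (Lp ℝ 2 P) :=
  (Submodule.span ℝ (Set.range (sampleLp hzm))).topologicalClosure

instance : CompleteSpace (sampleSpan hzm) :=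
  (Submodule.isClosed_topologicalClosure _).completeSpace_coe

lemma norm_sub_sq_of_mem_sampleSpan (u : Lp ℝ 2 P) {v : Lp ℝ 2 P} (hv : v ∈ sampleSpan hzm) :
    ‖u - v‖ ^ 2 = ‖u - (sampleSpan hzm).starProjection u‖ ^ 2
      + ‖(sampleSpan hzm).starProjection u - v‖ ^ 2 := by
  have h : inner ℝ (u - (sampleSpan hzm).starProjection u)
      ((sampleSpan hzm).starProjection u - v) = 0 :=
    Submodule.starProjection_inner_eq_zero _ _
      (Submodule.sub_mem _ (Submodule.starProjection_apply_mem _ _) hv)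
  have := norm_add_sq_eq_norm_sq_add_norm_sq_real h
  rw [sub_add_sub_cancel] at this
  simpa only [pow_two] using this

variable {fs : ℝ} (hfs : 0 < fs) {W : SpectralWeight (bandMeasure fs) (Fin K)}
  {hW : ∀ i j, Integrable (fun f => W.toFun f i j) (bandMeasure fs)} {c : ℝ} (hC : W.IsCoercive c)
  (hz : ∀ p q, ((inner ℝ (sampleLp hzm p) (sampleLp hzm q) : ℝ) : ℂ) =
    inner ℂ (SpectralWeight.expSpace hW q) (SpectralWeight.expSpace hW p))
  {u : Ω → Fin N → ℝ} (hu : ∀ i, MemLp (fun ω => u ω i) 2 P)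
  {Gopt : ℤ → Matrix (Fin N) (Fin K) ℝ}
  (hG : ∀ i, IsTapLimit (sampleLp hzm) (fun p => Gopt (-p.1) i p.2)
    ((sampleSpan hzm).starProjection ((hu i).toLp _)))

include hfs hC hz hG

lemma toLp_eq_starProjection_of_isDigitalOutput {v : Ω → Fin N → ℝ}
    (hv : ∀ i, MemLp (fun ω => v ω i) 2 P) (h : IsDigitalOutput P z Gopt v) (i : Fin N) :
    (hv i).toLp _ = (sampleSpan hzm).starProjection ((hu i).toLp _) :=
  ((isDigitalOutput_iff hzm hv).1 h i).limit_unique hfs hC hz (hG i)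

/-- By Pythagoras the excess error of any output is its squared distance to the projection. An
optimal output must therefore be the projection, and the limit determines the taps. -/
lemma isMSEOptimal_iff (G : ℤ → Matrix (Fin N) (Fin K) ℝ) : IsMSEOptimal P z u G ↔ G = Gopt := by
  let v₀ : Ω → Fin N → ℝ := fun ω i => (sampleSpan hzm).starProjection ((hu i).toLp _) ω
  have hv₀ : ∀ i, MemLp (fun ω => v₀ ω i) 2 P := fun i => Lp.memLp _
  have e₀ : ∀ i, (hv₀ i).toLp _ = (sampleSpan hzm).starProjection ((hu i).toLp _) := fun i =>
    Lp.toLp_coeFn _ _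
  have hv₀' : IsDigitalOutput P z Gopt v₀ :=
    (isDigitalOutput_iff hzm hv₀).2 fun i => by rw [e₀]; exact hG i
  have hmse : ∀ (G' : ℤ → Matrix (Fin N) (Fin K) ℝ) (v' : Ω → Fin N → ℝ)
      (hv' : ∀ i, MemLp (fun ω => v' ω i) 2 P), IsDigitalOutput P z G' v' →
      meanSq P (fun ω => u ω - v' ω) = meanSq P (fun ω => u ω - v₀ ω) +
        ∑ i, ‖(sampleSpan hzm).starProjection ((hu i).toLp _) - (hv' i).toLp _‖ ^ 2 := by
    intro G' v' hv' h
    rw [meanSq_sub_eq hu hv', meanSq_sub_eq hu hv₀, ← Finset.sum_add_distrib]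
    refine Finset.sum_congr rfl fun i _ => ?_
    rw [norm_sub_sq_of_mem_sampleSpan hzm _
      ((isDigitalOutput_iff hzm hv').1 h i).mem_closure, e₀]
  constructor
  · rintro ⟨v, hv, hopt⟩
    have h1 := hopt Gopt v₀ hv₀'
    rw [hmse G v hv.1 hv] at h1
    have h2 : ∑ i, ‖(sampleSpan hzm).starProjection ((hu i).toLp _) - (hv.1 i).toLp _‖ ^ 2 = 0 :=
      le_antisymm (by linarith) (Finset.sum_nonneg fun i _ => by positivity)
    rw [Finset.sum_eq_zero_iff_of_nonneg fun i _ => by positivity] at h2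
    funext n
    ext i k
    have h3 := sub_eq_zero.1 (norm_eq_zero.1 (pow_eq_zero_iff two_ne_zero |>.1
      (h2 i (Finset.mem_univ i))))
    have h4 := (isDigitalOutput_iff hzm hv.1).1 hv i
    rw [← h3] at h4
    have := congrFun (h4.taps_unique hfs hC hz (hG i)) (-n, k)
    simpa using this
  · rintro rfl
    refine ⟨v₀, hv₀', fun G' v' h => ?_⟩
    rw [hmse G' v' h.1 h]
    linarith [Finset.sum_nonneg fun (i : Fin N) (_ : i ∈ Finset.univ) =>
      sq_nonneg ‖(sampleSpan hzm).starProjection ((hu i).toLp _) - (h.1 i).toLp _‖]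

end

/-! ### Cross-correlations, orthogonality and the Wiener equation -/

noncomputable section

section Spectra

variable {Ω : Type*} [MeasurableSpace Ω] {P : Measure Ω} {M L L' : ℕ}
  {x : ℝ → Ω → Fin M → ℝ} {C : ℝ → Matrix (Fin M) (Fin M) ℂ} {hC : IsJointPSD P x C}
  {A : ℝ → Matrix (Fin L) (Fin M) ℂ} {B : ℝ → Matrix (Fin L') (Fin M) ℂ}
  {t t' : ℝ} {l : Fin L} {l' : Fin L'} {a b : hC.weight.Space}

lemma inner_eq_of_val_eq_shiftedRow (ha : a.val = shiftedRow A t l) (hb : b.val = shiftedRow B t' l') :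
    inner ℂ b a = ∫ f, timeShift (t - t') f * (A f * C f * (B f)ᴴ) l l' := by
  rw [SpectralWeight.inner_def, ha, hb]
  exact integral_congr_ae (Eventually.of_forall fun f => hermForm_shiftedRow A B t t' l l' f)

lemma integrable_of_val_eq_shiftedRow (ha : a.val = shiftedRow A t l)
    (hb : b.val = shiftedRow B t l') : Integrable fun f => (A f * C f * (B f)ᴴ) l l' := by
  have h := a.integrable b
  rw [ha, hb] at h
  refine h.congr (Eventually.of_forall fun f => ?_)
  refine (hermForm_shiftedRow A B t t l l' f).trans ?_
  rw [sub_self, show timeShift 0 f = 1 by simp [timeShift], one_mul]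
  rfl

lemma timeShift_samples (fs : ℝ) (n m : ℤ) (f : ℝ) :
    timeShift (n * (1 / fs) - m * (1 / fs)) f = bandChar fs (n - m) f := by
  rw [timeShift, bandChar_eq]
  congr 3; push_cast; ring

end Spectra

section Projection

variable {Ω : Type*} [MeasurableSpace Ω] {P : Measure Ω} {K : ℕ} {z : ℤ → Ω → Fin K → ℝ}
  {hzm : ∀ n k, MemLp (fun ω => z n ω k) 2 P} {d : Lp ℝ 2 P}

lemma inner_eq_zero_of_mem_sampleSpan (hd : ∀ p, inner ℝ d (sampleLp hzm p) = 0) {v : Lp ℝ 2 P}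
    (hv : v ∈ sampleSpan hzm) : inner ℝ d v = 0 := by
  have h1 : Submodule.span ℝ (Set.range (sampleLp hzm)) ≤
      LinearMap.ker (innerSL ℝ d : Lp ℝ 2 P →L[ℝ] ℝ).toLinearMap := by
    rw [Submodule.span_le]
    rintro _ ⟨p, rfl⟩
    exact hd p
  exact Submodule.topologicalClosure_minimal _ h1
    (ContinuousLinearMap.isClosed_ker (innerSL ℝ d : Lp ℝ 2 P →L[ℝ] ℝ)) hv

/-- The projection onto the closed span depends only on correlations with the samples; this lets `s`
be replaced by its MMSE estimate. -/
lemma starProjection_eq_of_inner_sub_eq_zero {u u' : Lp ℝ 2 P}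
    (h : ∀ p, inner ℝ (u - u') (sampleLp hzm p) = 0) :
    (sampleSpan hzm).starProjection u = (sampleSpan hzm).starProjection u' := by
  refine Submodule.eq_starProjection_of_mem_of_inner_eq_zero
    (Submodule.starProjection_apply_mem _ _) fun w hw => ?_
  rw [← sub_add_sub_cancel u u', inner_add_left, inner_eq_zero_of_mem_sampleSpan h hw,
    Submodule.starProjection_inner_eq_zero _ _ hw, add_zero]

lemma sampleLp_mem_sampleSpan (p : ℤ × Fin K) : sampleLp hzm p ∈ sampleSpan hzm :=
  Submodule.le_topologicalClosure _ (Submodule.subset_span ⟨p, rfl⟩)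

lemma inner_starProjection_sampleLp (u : Lp ℝ 2 P) (p : ℤ × Fin K) :
    inner ℝ ((sampleSpan hzm).starProjection u) (sampleLp hzm p) = inner ℝ u (sampleLp hzm p) := by
  have := Submodule.starProjection_inner_eq_zero (K := sampleSpan hzm) u _
    (sampleLp_mem_sampleSpan p)
  rw [inner_sub_left] at this
  linarith

end Projection

section Task

variable {Ω : Type*} [MeasurableSpace Ω] {P : Measure Ω} [IsProbabilityMeasure P] {M N : ℕ}
  {x : ℝ → Ω → Fin M → ℝ} {C : ℝ → Matrix (Fin M) (Fin M) ℂ} {s : Ω → Fin N → ℝ}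
  {Γ : ℝ → Matrix (Fin N) (Fin M) ℂ} {sT : Ω → Fin N → ℝ}

/-- The task and its MMSE estimate have the same correlations with functions of the process. -/
lemma TaskADC.IsLinearTask.integral_mul_eq (hs : IsLinearTask P x C s Γ sT)
    (hx : IsZeroMeanWSS P x) (i : Fin N) {A : Ω → ℝ}
    (hA : MemLp A 2 P) (hAm : AEStronglyMeasurable[processSigma x] A P) :
    ∫ ω, s ω i * A ω ∂P = ∫ ω, sT ω i * A ω ∂P := by
  have h := condExp_mul_of_aestronglyMeasurable_right hAm ((hs.memLp i).integrable_mul hA)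
    ((hs.memLp i).integrable one_le_two)
  have h1 := integral_condExp (μ := P) (f := (fun ω => s ω i) * A) hx.processSigma_le
  rw [integral_congr_ae h] at h1
  refine h1.symm.trans (integral_congr_ae ?_)
  filter_upwards [hs.mmse i] with ω hω
  rw [Pi.mul_apply, ← hω]

end Task

section Wiener

variable {K N : ℕ} {fs : ℝ}

lemma eq_mul_inv_of_row_eq {S : Matrix (Fin N) (Fin K) ℂ} {A : Matrix (Fin K) (Fin K) ℂ}
    (hA : IsUnit A) {g : Fin N → Fin K → ℂ} (h : ∀ i l, ∑ k, g i k * A k l = S i l) :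
    Matrix.of g = S * A⁻¹ := by
  have : Matrix.of g * A = S := Matrix.ext fun i l => h i l
  rw [← this, Matrix.mul_nonsing_inv_cancel_right _ _ ((Matrix.isUnit_iff_isUnit_det A).1 hA)]

lemma mul_inv_mul_conjTranspose_apply {S : Matrix (Fin N) (Fin K) ℂ}
    {A : Matrix (Fin K) (Fin K) ℂ} (hA : IsUnit A) (hA' : A.IsHermitian) {g : Fin N → Fin K → ℂ}
    (h : ∀ i l, ∑ k, g i k * A k l = S i l) (i j : Fin N) :
    (S * A⁻¹ * Sᴴ) i j = hermForm A (g i) (g j) := by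
  have h1 : Matrix.of g * A = S := Matrix.ext fun i l => h i l
  rw [← eq_mul_inv_of_row_eq hA h, ← h1, Matrix.conjTranspose_mul, hA'.eq, ← Matrix.mul_assoc,
    mul_mul_conjTranspose_apply]
  rfl

end Wiener

end

/-! ### The main theorem -/

theorem proposition1 {Ω : Type*} [MeasurableSpace Ω] (P : Measure Ω) [IsProbabilityMeasure P]
    {M N K : ℕ}
    (x : ℝ → Ω → Fin M → ℝ) (hx : IsZeroMeanWSS P x)
    (C : ℝ → Matrix (Fin M) (Fin M) ℂ) (hC : IsJointPSD P x C)
    (s : Ω → Fin N → ℝ) (Γ : ℝ → Matrix (Fin N) (Fin M) ℂ)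
    (hΓ : ∀ i m, AEMeasurable (fun f => Γ f i m))
    (sT : Ω → Fin N → ℝ) (hs : IsLinearTask P x C s Γ sT)
    (H : ℝ → Matrix (Fin K) (Fin M) ℂ) (hH : ∀ k m, AEMeasurable (fun f => H f k m))
    (y : ℝ → Ω → Fin K → ℝ) (hy : ∀ t, IsFilterOutputAt P x C H t (y t))
    (fs : ℝ) (hfs : 0 < fs) (γ : ℝ) (hγ : 0 < γ) (b : ℕ) (Δ : ℝ) (hΔ : Δ = stepSize γ b)
    (w : ℤ → Ω → Fin K → ℝ) (hw : IsDither P Δ x w)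
    (hload : NoOverload P fs γ y w)
    (z : ℤ → Ω → Fin K → ℝ) (hz : z = adcOutput fs γ b y w)
    (S : ℝ → Matrix (Fin N) (Fin K) ℂ) (hS : S = crossSpectrum fs Γ C H)
    (Cz : ℝ → Matrix (Fin K) (Fin K) ℂ) (hCz : Cz = outputSpectrum fs Δ C H) :
    -- the series and integrals in the closed forms converge, and `Cz` is invertible
    (∀ᵐ f : ℝ, Summable (aliasTerm fs Γ C H f) ∧ Summable (aliasTerm fs H C H f) ∧
      IsUnit (Cz f)) ∧
    BandIntegrable fs (fun f => S f * (Cz f)⁻¹) ∧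
    BandIntegrable fs (fun f => S f * (Cz f)⁻¹ * (S f)ᴴ) ∧
    ∃ Gopt : ℤ → Matrix (Fin N) (Fin K) ℝ,
      -- the closed form of the filter
      (∀ n : ℤ, (Gopt n).map (fun r : ℝ => (r : ℂ)) = ((1 / fs : ℝ) : ℂ) •
        bandIntegral fs (fun f =>
          Complex.exp (2 * Real.pi * Complex.I * f * n * (1 / fs : ℝ)) • (S f * (Cz f)⁻¹))) ∧
      -- it is the MSE-minimizing filter
      (∀ G : ℤ → Matrix (Fin N) (Fin K) ℝ, IsMSEOptimal P z sT G ↔ G = Gopt) ∧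
      -- the resulting minimum MSE
      (∀ sHat : Ω → Fin N → ℝ, IsDigitalOutput P z Gopt sHat →
        ((meanSq P (fun ω => sT ω - sHat ω) : ℝ) : ℂ) = ((meanSq P sT : ℝ) : ℂ) -
          (((1 / fs : ℝ) : ℂ) • bandIntegral fs (fun f => S f * (Cz f)⁻¹ * (S f)ᴴ)).trace) ∧
      -- the same filter minimizes the MSE with respect to the task vector itself
      (IndepFun (fun ω n => w n ω) (fun ω => (s ω, fun t => x t ω)) P →
        (∀ G : ℤ → Matrix (Fin N) (Fin K) ℝ, IsMSEOptimal P z s G ↔ G = Gopt) ∧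
        ∀ sHat : Ω → Fin N → ℝ, IsDigitalOutput P z Gopt sHat →
          meanSq P (fun ω => s ω - sHat ω) =
            meanSq P (fun ω => s ω - sT ω) + meanSq P (fun ω => sT ω - sHat ω)) := by
  subst hS hCz
  set S := crossSpectrum fs Γ C H
  set Cz := outputSpectrum fs Δ C H
  have hΔ0 : 0 < Δ := by rw [hΔ, stepSize]; positivity
  -- spectral representatives
  choose aY haY hYlim using fun t k => (hy t).exists_isSpectralLimit hC hH k
  choose aS haS hSlim using fun i => hs.linear.exists_isSpectralLimit hC hΓ i
  have hHH : ∀ i j, Integrable fun f => (H f * C f * (H f)ᴴ) i j := fun i j =>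
    integrable_of_val_eq_shiftedRow (haY 0 i) (haY 0 j)
  have hΓH : ∀ i j, Integrable fun f => (Γ f * C f * (H f)ᴴ) i j := fun i j =>
    integrable_of_val_eq_shiftedRow (haS i) (haY 0 j)
  have hS' : ∀ i l, Integrable (fun f => S f i l) (bandMeasure fs) :=
    integrable_tsum_aliasTerm hfs hΓH
  have hpsd := ae_posSemidef_tsum_aliasTerm hC.posSemidef (ae_summable_aliasTerm hfs hHH)
  have hCzpos : ∀ᵐ f : ℝ, (Cz f).PosDef := 
    hpsd.mono fun f hf => posDef_outputSpectrum hfs hΔ0 hf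
  have hCzpos' : ∀ᵐ f ∂(bandMeasure fs), (Cz f).PosDef :=
    (bandMeasure_absolutelyContinuous fs).ae_le hCzpos
  have hcoer := isCoercive_outputWeight hfs hΔ0 hC.posSemidef hHH
  have hW : ∀ i j, Integrable
      (fun f => (outputWeight hfs hΔ0 hC.posSemidef hHH).toFun f i j) (bandMeasure fs) :=
    integrable_outputSpectrum hfs hHH
  -- the samples before and after quantization
  set Y : ℤ × Fin K → Ω → ℝ := fun p ω => sample fs y p.1 ω p.2 with hYdef
  have hYmem : ∀ p, MemLp (Y p) 2 P := fun p => ((hy _).1 p.2).const_mul _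
  have hYm : ∀ p, AEStronglyMeasurable[processSigma x] (Y p) P := fun p =>
    ((hYlim (p.1 * (1 / fs)) p.2).aestronglyMeasurable_processSigma hx ((hy _).1 p.2)).const_mul _
  -- Without overload the saturated branch has probability zero, so the quantizer of unlimited range
  -- describes the outputs almost surely.
  have hzq : ∀ n k, (fun ω => z n ω k) =ᵐ[P] IsDither.quantized Δ w Y (n, k) := by
    intro n k
    have h0 : ∀ᵐ ω ∂P, ¬ γ ≤ |sample fs y n ω k + w n ω k| := by
      rw [ae_iff]; simpa using hload n k
    filter_upwards [h0] with ω hω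
    rw [hz, adcOutput, midRise_eq (not_le.1 hω), ← hΔ]
    rfl
  have hzm : ∀ n k, MemLp (fun ω => z n ω k) 2 P := fun n k =>
    (hw.memLp_quantized hΔ0 (hYmem (n, k))).ae_eq (hzq n k).symm
  have hTmem := hs.linear.1
  have hTm : ∀ i, AEStronglyMeasurable[processSigma x] (fun ω => sT ω i) P := fun i =>
    (hSlim i).aestronglyMeasurable_processSigma hx (hTmem i)
  have hX := IsDither.indepFun_of_indepFun hw.indep_input
  -- Each sample contributes a factor `Tₛ`. Of the two here, one is matched by the folding and one
  -- by the factor in `Cz`; in the correlation with `s̃` below there is only one, which explains why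
  -- `S` carries none.
  have hYY : ∀ p q, ((∫ ω, Y p ω * Y q ω ∂P : ℝ) : ℂ) = ((1 / fs : ℝ) : ℂ) *
      (((1 / fs : ℝ) : ℂ) * ∫ f, bandChar fs (p.1 - q.1) f * (H f * C f * (H f)ᴴ) p.2 q.2) := by
    intro p q
    have h1 := (hYlim (p.1 * (1 / fs)) p.2).integral_mul_eq_inner hx
      (hYlim (q.1 * (1 / fs)) q.2) ((hy _).1 p.2) ((hy _).1 q.2)
    rw [inner_eq_of_val_eq_shiftedRow (haY _ _) (haY _ _)] at h1
    simp only [timeShift_samples] at h1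
    rw [← h1, ← Complex.ofReal_mul, ← Complex.ofReal_mul, ← integral_const_mul,
      ← integral_const_mul]
    congr 2
    funext ω
    simp only [hYdef, sample]
    ring
  have hTY : ∀ i q, ((∫ ω, sT ω i * Y q ω ∂P : ℝ) : ℂ)
      = ∫ f, bandChar fs (-q.1) f * S f i q.2 ∂(bandMeasure fs) := by
    intro i q
    have h1 := (hSlim i).integral_mul_eq_inner hx (hYlim (q.1 * (1 / fs)) q.2) (hTmem i)
      ((hy _).1 q.2)
    rw [inner_eq_of_val_eq_shiftedRow (haS _) (haY _ _)] at h1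
    have h2 : ∀ f, timeShift (0 - q.1 * (1 / fs)) f = bandChar fs (-q.1) f := fun f => by
      rw [← zero_sub, ← timeShift_samples]; simp
    simp only [h2] at h1
    refine Eq.trans ?_ (integral_bandChar_mul_tsum_aliasTerm hfs hΓH (-q.1) i q.2).symm
    rw [← h1, ← Complex.ofReal_mul, ← integral_const_mul]
    congr 2
    funext ω
    simp only [hYdef, sample]
    ring
  -- Gram matrices
  have hgram : ∀ p q, ((inner ℝ (sampleLp hzm p) (sampleLp hzm q) : ℝ) : ℂ) =
      inner ℂ (SpectralWeight.expSpace hW q)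
        (SpectralWeight.expSpace hW p) := by
    intro p q
    rw [sampleLp, sampleLp, inner_toLp_toLp, SpectralWeight.inner_expSpace_expSpace]
    refine Eq.trans ?_ (integral_bandChar_mul_outputSpectrum hfs hHH (p.1 - q.1) p.2 q.2).symm
    have h1 : ∫ ω, z p.1 ω p.2 * z q.1 ω q.2 ∂P
        = ∫ ω, IsDither.quantized Δ w Y p ω * IsDither.quantized Δ w Y q ω ∂P := by
      refine integral_congr_ae ?_
      filter_upwards [hzq p.1 p.2, hzq q.1 q.2] with ω h1 h2
      rw [h1, h2]
    rw [h1, hw.integral_quantized_mul_quantized hx hΔ0 hYmem hYm, Complex.ofReal_add, hYY]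
    congr 1
    simp only [sub_eq_zero, ← Prod.ext_iff]
    split_ifs <;> simp
  have hTz : ∀ i q, ((inner ℝ ((hTmem i).toLp _) (sampleLp hzm q) : ℝ) : ℂ)
      = ∫ f, bandChar fs (-q.1) f * S f i q.2 ∂(bandMeasure fs) := by
    intro i q
    rw [sampleLp, inner_toLp_toLp, ← hTY, ← hw.integral_mul_quantized hΔ0 (hX q) (hTmem i) (hTm i)
      (hYmem q) (hYm q)]
    congr 1
    refine integral_congr_ae ?_
    filter_upwards [hzq q.1 q.2] with ω h1
    rw [h1]
  -- the optimal filter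
  have hproj : ∀ i, ∃ G, IsTapLimit (sampleLp hzm) G
      ((sampleSpan hzm).starProjection ((hTmem i).toLp _)) := fun i =>
    exists_isTapLimit hfs hcoer hgram (Submodule.starProjection_apply_mem _ _)
  choose G hG using hproj
  -- The projection has the same correlations with the samples as `s̃`, so its representative solves
  -- `g Cz = S`.
  have hspec := fun i => (hG i).exists_spectral hfs hcoer hgram (S := fun f => S f i) (hS' i)
    (fun q => by rw [inner_starProjection_sampleLp, hTz])
  choose g hgnorm hgS hgtap using hspec
  have hrow : ∀ᵐ f ∂(bandMeasure fs), ∀ i l, ∑ k, (g i).val f k * Cz f k l = S f i l := 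
    ae_all_iff.2 hgS
  have hg1 : ∀ᵐ f ∂(bandMeasure fs), ∀ i k, (g i).val f k = (S f * (Cz f)⁻¹) i k := by
    filter_upwards [hCzpos', hrow] with f h1 h2 i k
    rw [← eq_mul_inv_of_row_eq h1.isUnit h2]
    rfl
  have hg2 : ∀ᵐ f ∂(bandMeasure fs), ∀ i j,
      hermForm (Cz f) ((g i).val f) ((g j).val f) = (S f * (Cz f)⁻¹ * (S f)ᴴ) i j := by
    filter_upwards [hCzpos', hrow] with f h1 h2 i j
    rw [mul_inv_mul_conjTranspose_apply h1.isUnit h1.1 h2]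
  have := isProbabilityMeasure_bandMeasure hfs
  -- The coefficient of `z[n]` is the tap at `-n`, so indices are reversed.
  set Gopt : ℤ → Matrix (Fin N) (Fin K) ℝ := fun n => Matrix.of fun i k => G i (-n, k) with hGopt
  have hGlim : ∀ i, IsTapLimit (sampleLp hzm) (fun p => Gopt (-p.1) i p.2)
      ((sampleSpan hzm).starProjection ((hTmem i).toLp _)) := fun i => by
    have : (fun p : ℤ × Fin K => Gopt (-p.1) i p.2) = G i := by
      funext p; simp [hGopt]
    rw [this]; exact hG i
  refine ⟨?_, fun i k => ?_, fun i j => ?_, Gopt, fun n => ?_, ?_, fun sHat hsHat => ?_, fun hind => ?_⟩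
  · filter_upwards [ae_summable_aliasTerm hfs hΓH, ae_summable_aliasTerm hfs hHH, hCzpos]
      with f h1 h2 h3
    exact ⟨h1, h2, h3.isUnit⟩
  · rw [← integrable_bandMeasure_iff_intervalIntegrable hfs]
    refine Integrable.congr (f := fun f => (g i).val f k) ?_ (hg1.mono fun f hf => hf i k)
    exact ((hcoer.memLp (g i)).integrable one_le_two).norm.mono' ((g i).aesm k)
      (Eventually.of_forall fun f => norm_le_pi_norm _ _)
  · rw [← integrable_bandMeasure_iff_intervalIntegrable hfs]
    -- The integrand equals `g Cz gᴴ`, integrable because the rows of `g` lie in the weighted space.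
    exact ((g i).integrable (g j)).congr (hg2.mono fun f hf => hf i j)
  · ext i k
    have h1 := hgtap i (-n, k)
    simp only [neg_neg] at h1
    refine h1.trans ?_
    rw [Matrix.smul_apply, smul_eq_mul]
    refine Eq.trans ?_ (integral_bandMeasure hfs _)
    exact integral_congr_ae (hg1.mono fun f hf =>
      congrArg (bandChar fs n f * ·) (hf i k))
  · exact isMSEOptimal_iff hzm hfs hcoer hgram hTmem hGlim
  · have e := toLp_eq_starProjection_of_isDigitalOutput hzm hfs hcoer hgram hTmem hGlim hsHat.1 hsHat
    rw [meanSq_sub_eq hTmem hsHat.1, meanSq_eq hTmem, Matrix.trace, Complex.ofReal_sum,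
      Complex.ofReal_sum, ← Finset.sum_sub_distrib]
    refine Finset.sum_congr rfl fun i _ => ?_
    -- Pythagoras with the zero output: the squared norm of `s̃` is the residual plus the squared
    -- norm of the projection.
    have h1 := norm_sub_sq_of_mem_sampleSpan hzm ((hTmem i).toLp _) (Submodule.zero_mem _)
    rw [sub_zero, sub_zero] at h1
    have h2 : (((1 / fs : ℝ) : ℂ) • bandIntegral fs (fun f => S f * (Cz f)⁻¹ * (S f)ᴴ)).diag i
        = ((‖(sampleSpan hzm).starProjection ((hTmem i).toLp _)‖ ^ 2 : ℝ) : ℂ) := by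
      rw [hgnorm i, SpectralWeight.inner_def, Matrix.diag_apply, Matrix.smul_apply, smul_eq_mul]
      refine (integral_bandMeasure hfs _).symm.trans ?_
      exact integral_congr_ae (hg2.mono fun f hf => (hf i i).symm)
    rw [e, h2, h1]
    push_cast
    ring
  · have hV := IsDither.indepFun_of_indepFun hind
    have hle : processSigma x ≤ MeasurableSpace.comap (fun ω => (s ω, fun t => x t ω))
        inferInstance := by
      rw [processSigma, show (fun ω t => x t ω) = Prod.snd ∘ (fun ω => (s ω, fun t => x t ω))
        from rfl, ← MeasurableSpace.comap_comp]
      exact MeasurableSpace.comap_mono measurable_snd.comap_le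
    have hsm : ∀ i, Measurable[MeasurableSpace.comap (fun ω => (s ω, fun t => x t ω))
        inferInstance] (fun ω => s ω i) := fun i =>
      Measurable.comp (g := fun q : (Fin N → ℝ) × (ℝ → Fin M → ℝ) => q.1 i)
        ((measurable_pi_apply i).comp measurable_fst) (comap_measurable _)
    -- Quantization preserves correlations with `s`, since the dither is independent of `(s, x)`,
    -- and those with `s̃`; the unquantized sample is a function of the process, where `s` and `s̃`
    -- have equal correlations.
    have horth : ∀ i p, inner ℝ ((hs.memLp i).toLp _ - (hTmem i).toLp _) (sampleLp hzm p) = 0 := by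
      intro i p
      have h1 : ∀ {u : Ω → ℝ}, ∫ ω, u ω * z p.1 ω p.2 ∂P
          = ∫ ω, u ω * IsDither.quantized Δ w Y p ω ∂P := fun {u} => by
        refine integral_congr_ae ?_
        filter_upwards [hzq p.1 p.2] with ω h1
        rw [h1]
      rw [inner_sub_left, sampleLp, inner_toLp_toLp, inner_toLp_toLp, h1, h1,
        hw.integral_mul_quantized hΔ0 (hX p) (hTmem i) (hTm i) (hYmem p) (hYm p),
        hw.integral_mul_quantized hΔ0 (hV p) (hs.memLp i)
          (hsm i).stronglyMeasurable.aestronglyMeasurable (hYmem p) ((hYm p).mono hle),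
        hs.integral_mul_eq hx i (hYmem p) (hYm p), sub_self]
    have horthT : ∀ i, inner ℝ ((hs.memLp i).toLp _ - (hTmem i).toLp _) ((hTmem i).toLp _) = 0 := by
      intro i
      rw [inner_sub_left, inner_toLp_toLp, inner_toLp_toLp,
        hs.integral_mul_eq hx i (hTmem i) (hTm i), sub_self]
    refine ⟨isMSEOptimal_iff hzm hfs hcoer hgram hs.memLp fun i => ?_, fun sHat hsHat => ?_⟩
    · rw [starProjection_eq_of_inner_sub_eq_zero (horth i)]
      exact hGlim i
    · rw [meanSq_sub_eq hs.memLp hsHat.1, meanSq_sub_eq hs.memLp hTmem,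
        meanSq_sub_eq hTmem hsHat.1, ← Finset.sum_add_distrib]
      refine Finset.sum_congr rfl fun i _ => ?_
      have h1 := inner_eq_zero_of_mem_sampleSpan (horth i)
        ((isDigitalOutput_iff hzm hsHat.1).1 hsHat i).mem_closure
      -- The MMSE error is orthogonal to `s̃` and to every output, so the two errors add in squares.
      have h2 : inner ℝ ((hs.memLp i).toLp _ - (hTmem i).toLp _)
          ((hTmem i).toLp _ - (hsHat.1 i).toLp _) = 0 := by
        rw [inner_sub_right, horthT, h1, sub_zero]
      have h3 := norm_add_sq_eq_norm_sq_add_norm_sq_real h2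
      rw [sub_add_sub_cancel] at h3
      simpa only [pow_two] using h3
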